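/- Throughout, computations are in exact real arithmetic: each operation $+,-,\times,/$, square root, logarithm, comparison, loading of a constant, drawing of a standard Gaussian number, and each increment of a real-bounded counter costs one step (indexing and copying are free), and a division by zero, a square root of a negative number or a logarithm of a nonpositive number counts as failure. For $0\ne A\in\mathbb R^{n\times n}$, $0\neq b\in\mathbb R^n$, $x\in\mathbb R^n$ let $$\mathrm{berr}_{A,b}(x)=\min\Big\{\frac{\|E\|_2}{\|A\|_2}\;:\;E\in\mathbb R^{n\times n},\ (A+E)x=b\Big\}$$ (with value $+\infty$ if there is no such $E$), where $\|\cdot\|_2$ is the spectral norm. **Algorithm MINBERR** (input: a routine for $v\mapsto Av$; $b$; a maximal number $k_{\max}\ge 1$ of iterations; a tolerance $\tau>0$; $\delta\in(0,1)$). 1. Put $q_0=0$, $q_1=b/\|b\|_2$, $\beta_1=1$. For $k=1,\dots,k_{\max}$: (a) Lanczos step: $\hat w=Aq_k-\beta_kq_{k-1}$, $\alpha_k=\hat w^\top q_k$, $w=\hat w-\alpha_kq_k$, $\beta_{k+1}=\|w\|_2$. If $\beta_{k+1}=0$, leave the loop and go to step 3. Otherwise $q_{k+1}=w/\beta_{k+1}$.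 (b) Let $\tilde T\in\mathbb R^{k\times k}$ be the upper triangular matrix with $\tilde T_{i,i}=\beta_{i+1}$, $\tilde T_{i,i+1}=\alpha_{i+1}$, $\tilde T_{i,i+2}=\beta_{i+2}$ and all other entries zero. Compute the last column of the Cholesky factorization of $\tilde T^\top\tilde T-\tau^2I_k$. If it breaks down (the last pivot is not positive), or if $k=k_{\max}$, leave the loop and go to step 2. 2. Let $v\in\mathbb R^k$ be a standard Gaussian vector. For $\ell=0,1,2,\dots$, while $\ell<2.23\ln(k/\delta^2)$: solve $\tilde T^\top z=v$ and $\tilde Tv'=z$ by substitution, and replace $v$ by $v'/\|v'\|_2$. Output $\hat x=\frac1\alpha\sum_{j\le k}v_jq_j$, where $\alpha=\frac1{\|b\|_2}(\alpha_1v_1+\beta_2v_2)$ (with $v_2=0$ if $k=1$). 3. Find by back substitution the null vector $v\in\mathbb R^k$ of $\tilde T$ with $v_k=1$. With $\alpha$ as in step 2, output $\hat x=\frac1\alpha\sum_{j\le k}v_jq_j$ if $\alpha\ne0$, and $\hat x=\frac{\|b\|_2}{\tau}\sum_{j\le k}v_jq_j$ if $\alpha=0$. **Corollary.** There is a universal constant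 $C>0$ with the following property. Let $A\in\mathbb R^{n\times n}$ be positive semidefinite, $b\in\mathbb R^n$, $A\neq0$, $b\ne0$, let $\epsilon,\delta\in(0,1)$, and suppose that a deterministic routine computes $v\mapsto Av$ in at most $\mathcal T_A$ steps. Let $k_{\max}\ge n$ or $k_{\max}\ge 3/\sqrt\epsilon$. Then, with probability at least $1-\delta$, MINBERR with tolerance $\tau=\frac23\epsilon\|A\|_2$ (which is $\frac23\epsilon$ if $A$ is normalized to $\|A\|_2=1$) stops with an output $\hat x$ such that $\mathrm{berr}_{A,b}(\hat x)\le\epsilon$, after at most $$\frac{C}{\sqrt\epsilon}\Big(\mathcal T_A+n+\log\frac1\delta\Big)$$ steps. Consequently, for every $c>0$ there is $C_c>0$, depending only on $c$, such that, if $Av$ is computed by the usual row-by-row multiplication with a dense matrix and $\log\frac1\delta\le c\,n^2$, then with probability at least $1-\delta$ MINBERR stops with $\mathrm{berr}_{A,b}(\hat x)\le\epsilon$ after at most $C_c\,n^2/\sqrt\epsilon$ steps. -/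

import Mathlib

open MeasureTheory ProbabilityTheory
open scoped ENNReal

namespace Minberr

/-! ### The model of computation: exact real arithmetic with unit-cost operations

A program over a type `R` of numbers is a tree of elementary operations. The algorithms below are
written for an arbitrary type `R` without any structure, so the operations listed here are the only
way in which they can produce a number or learn anything about one. -/

/-- The four binary arithmetic operations. -/
inductive BinOp : Type
  | add
  | sub
  | mul
  | div

/-- Programs that compute with numbers of type `R` and return a value of type `α`. -/
inductive Prog (R α : Type) : Type
  /-- stop and return `a` -/
  | ret (a : α) : Prog R α
  /-- load a rational constant -/
  | const (c : ℚ) (next : R → Prog R α) : Prog R α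
  /-- a binary arithmetic operation -/
  | bin (o : BinOp) (x y : R) (next : R → Prog R α) : Prog R α
  /-- square root -/
  | sqrt (x : R) (next : R → Prog R α) : Prog R α
  /-- natural logarithm -/
  | log (x : R) (next : R → Prog R α) : Prog R α
  /-- the test `x < y` -/
  | lt (x y : R) (next : Bool → Prog R α) : Prog R α
  /-- run a counter `ℓ = 0, 1, 2, …` as long as `ℓ < x`, and return its final value -/
  | countTo (x : R) (next : ℕ → Prog R α) : Prog R α
  /-- draw a fresh standard Gaussian number -/
  | gauss (next : R → Prog R α) : Prog R α

namespace Prog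

variable {R α β : Type}

/-- Sequential composition. -/
def bind : Prog R α → (α → Prog R β) → Prog R β
  | ret a, f => f a
  | const c k, f => const c fun r => (k r).bind f
  | bin o x y k, f => bin o x y fun r => (k r).bind f
  | sqrt x k, f => sqrt x fun r => (k r).bind f
  | log x k, f => log x fun r => (k r).bind f
  | lt x y k, f => lt x y fun r => (k r).bind f
  | countTo x k, f => countTo x fun r => (k r).bind f
  | gauss k, f => gauss fun r => (k r).bind f

instance : Monad (Prog R) where
  pure := ret
  bind := bind

end Prog

/-- The counters of a running program: the number of elementary operations executed so far and the
number of random numbers drawn so far. -/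
structure Counters : Type where
  steps : ℕ
  drawn : ℕ

/-- `m` more elementary operations. -/
def Counters.tick (s : Counters) (m : ℕ) : Counters := ⟨s.steps + m, s.drawn⟩

/-- Execution in exact real arithmetic; `ω 0, ω 1, …` are the random numbers that the program draws
one after the other. Every operation costs one step, where `countTo x` is charged for each test
and for each increment of its counter. A division by zero, the square root of a negative number and
the logarithm of a nonpositive number abort the run without a result. -/
noncomputable def Prog.run {α : Type} (ω : ℕ → ℝ) :
    Prog ℝ α → Counters → Option (α × Counters)
  | .ret a, s => some (a, s)
  | .const c k, s => (k (c : ℝ)).run ω (s.tick 1)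
  | .bin .add x y k, s => (k (x + y)).run ω (s.tick 1)
  | .bin .sub x y k, s => (k (x - y)).run ω (s.tick 1)
  | .bin .mul x y k, s => (k (x * y)).run ω (s.tick 1)
  | .bin .div x y k, s => open Classical in
      if y = 0 then none else (k (x / y)).run ω (s.tick 1)
  | .sqrt x k, s => open Classical in
      if x < 0 then none else (k (Real.sqrt x)).run ω (s.tick 1)
  | .log x k, s => open Classical in
      if x ≤ 0 then none else (k (Real.log x)).run ω (s.tick 1)
  | .lt x y k, s => open Classical in (k (decide (x < y))).run ω (s.tick 1)
  | .countTo x k, s => (k ⌈x⌉₊).run ω (s.tick (2 * ⌈x⌉₊ + 1))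
  | .gauss k, s => (k (ω s.drawn)).run ω ⟨s.steps + 1, s.drawn + 1⟩

/-- The law of the random numbers: independent standard Gaussians. -/
noncomputable def gaussianStream : Measure (ℕ → ℝ) :=
  Measure.infinitePi fun _ : ℕ => gaussianReal 0 1

/-! ### Elementary routines -/

section Routines

variable {R : Type}

def const (c : ℚ) : Prog R R := .const c .ret
def add (x y : R) : Prog R R := .bin .add x y .ret
def sub (x y : R) : Prog R R := .bin .sub x y .ret
def mul (x y : R) : Prog R R := .bin .mul x y .ret
def div (x y : R) : Prog R R := .bin .div x y .ret
def sqrt (x : R) : Prog R R := .sqrt x .ret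
def log (x : R) : Prog R R := .log x .ret
def lt (x y : R) : Prog R Bool := .lt x y .ret
def countTo (x : R) : Prog R ℕ := .countTo x .ret
def gauss : Prog R R := .gauss .ret

/-- Compute the entries of a vector one after the other. -/
def tabulate : (n : ℕ) → (Fin n → Prog R R) → Prog R (Fin n → R)
  | 0, _ => pure Fin.elim0
  | n + 1, f => do
      let v ← tabulate n fun i => f i.castSucc
      let x ← f (Fin.last n)
      pure (Fin.snoc (α := fun _ => R) v x)

/-- Compute `n` numbers one after the other and add them up. -/
def sum : (n : ℕ) → (Fin n → Prog R R) → Prog R R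
  | 0, _ => const 0
  | n + 1, f => do
      let s ← sum n fun i => f i.castSucc
      let x ← f (Fin.last n)
      add s x

/-- The inner product. -/
def dot {n : ℕ} (x y : Fin n → R) : Prog R R := sum n fun i => mul (x i) (y i)

/-- The Euclidean norm. -/
def norm {n : ℕ} (x : Fin n → R) : Prog R R := do
  let s ← dot x x
  sqrt s

/-- `x - c y`. -/
def subMul {n : ℕ} (x : Fin n → R) (c : R) (y : Fin n → R) : Prog R (Fin n → R) :=
  tabulate n fun i => do
    let t ← mul c (y i)
    sub (x i) t

/-- `x / c`. -/
def divBy {n : ℕ} (x : Fin n → R) (c : R) : Prog R (Fin n → R) :=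
  tabulate n fun i => div (x i) c

/-- The usual multiplication of a dense matrix with a vector, row by row. -/
def denseMulVec {n : ℕ} (A : Matrix (Fin n) (Fin n) R) (v : Fin n → R) : Prog R (Fin n → R) :=
  tabulate n fun i => dot (A i) v

/-- Compute entries `1, …, k` of an array whose other entries are `z`. -/
def fill (z : R) : (k : ℕ) → (ℕ → Prog R R) → Prog R (ℕ → R)
  | 0, _ => pure fun _ => z
  | k + 1, f => do
      let a ← fill z k f
      let x ← f (k + 1)
      pure (Function.update a (k + 1) x)

/-- Repeat a computation `N` times. -/
def iterate {α : Type} (f : α → Prog R α) : ℕ → α → Prog R α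
  | 0, a => pure a
  | N + 1, a => do
      let a' ← f a
      iterate f N a'

end Routines

/-! ### The algorithm MINBERR -/

section Algorithm

variable {R : Type} {n : ℕ}

/-- The data kept by the algorithm, in arrays: the Lanczos vectors `q 1, q 2, …` (and `q 0 = 0`), the
diagonal `al i` and the off-diagonal `be (i + 1)` of the tridiagonal matrix `T`, that is
`T i i = al i` and `T i (i + 1) = T (i + 1) i = be (i + 1)`, and the entries `rd i` in place `(i, i)`
and `ru i` in place `(i - 1, i)` of the Cholesky factor. -/
structure State (R : Type) (n : ℕ) : Type where
  q : ℕ → Fin n → R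
  al : ℕ → R
  be : ℕ → R
  rd : ℕ → R
  ru : ℕ → R

/-- How an iteration ends: `exhausted` means that the Krylov space is invariant (the next
off-diagonal entry is zero), `converged` that the Cholesky factorization breaks down. -/
inductive Status : Type
  | exhausted
  | converged
  | unfinished

/-! `T̃` is `T` without its first row: an upper triangular matrix with three diagonals, whose column
`j` has the entry `be (j + 1)` in row `j`, the entry `tMid j` in row `j - 1` and the entry `tTop j`
in row `j - 2`. Entries in the nonexistent rows `0` and `-1` are read as zero (`z`). -/

def State.tMid (z : R) (s : State R n) (j : ℕ) : R := if 2 ≤ j then s.al j else z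

def State.tTop (z : R) (s : State R n) (j : ℕ) : R := if 3 ≤ j then s.be j else z

/-- The Lanczos step number `k`, up to the normalization of the new vector `w`, which is returned. -/
def lanczosStep (mv : (Fin n → R) → Prog R (Fin n → R)) (k : ℕ) (s : State R n) :
    Prog R (State R n × (Fin n → R)) := do
  let Aq ← mv (s.q k)
  let w' ← subMul Aq (s.be k) (s.q (k - 1))
  let a ← dot w' (s.q k)
  let w ← subMul w' a (s.q k)
  let β ← norm w
  pure ({ s with al := Function.update s.al k a, be := Function.update s.be (k + 1) β }, w)

/-- The last column (number `k`) of the Cholesky factorization of `T̃ᵀ T̃ - tol² I`, from the last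
column of that matrix; the factorization breaks down if the last pivot is not positive.
For `k = 1, 2` the nonexistent entries are zero, since so are `tTop 1`, `tTop 2` and `tMid 1`. -/
def choleskyStep (z tol : R) (k : ℕ) (s : State R n) : Prog R (State R n × Status) := do
  let t := s.tTop z k
  let m := s.tMid z k
  let d := s.be (k + 1)
  -- the entries of the Gram matrix in rows `k - 2`, `k - 1` and `k`
  let g2 ← mul t (s.be (k - 1))
  let mb ← mul m (s.be k)
  let tm ← mul t (s.tMid z (k - 1))
  let g1 ← add mb tm
  let tt ← mul t t
  let mm ← mul m m
  let dd ← mul d d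
  let u ← add tt mm
  let g0 ← add u dd
  -- the entries of the Cholesky factor in these rows
  let r2 ← div g2 (s.rd (k - 2))
  let c ← mul (s.ru (k - 1)) r2
  let g1' ← sub g1 c
  let r1 ← div g1' (s.rd (k - 1))
  let tol2 ← mul tol tol
  let r22 ← mul r2 r2
  let r11 ← mul r1 r1
  let p1 ← sub g0 tol2
  let p2 ← sub p1 r22
  let p ← sub p2 r11
  let ok ← lt z p
  if ok then do
    let r0 ← sqrt p
    pure ({ s with rd := Function.update s.rd k r0, ru := Function.update s.ru k r1 },
      Status.unfinished)
  else
    pure (s, Status.converged)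

/-- One iteration. -/
def krylovStep (mv : (Fin n → R) → Prog R (Fin n → R)) (z tol : R) (k : ℕ) (s : State R n) :
    Prog R (State R n × Status) := do
  let (s, w) ← lanczosStep mv k s
  let pos ← lt z (s.be (k + 1))
  if pos then do
    let q' ← divBy w (s.be (k + 1))
    choleskyStep z tol k { s with q := Function.update s.q (k + 1) q' }
  else
    pure (s, Status.exhausted)

/-- Iterations `k, k + 1, …, k + m`, or fewer if one of them ends the loop. Returned are the final data,
the status, and the number of the last iteration. -/
def krylovLoop (mv : (Fin n → R) → Prog R (Fin n → R)) (z tol : R) :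
    ℕ → ℕ → State R n → Prog R (State R n × Status × ℕ)
  | 0, k, s => do
      let (s, st) ← krylovStep mv z tol k s
      pure (s, st, k)
  | m + 1, k, s => do
      let (s, st) ← krylovStep mv z tol k s
      match st with
      | .unfinished => krylovLoop mv z tol m (k + 1) s
      | st => pure (s, st, k)

/-- Forward substitution: the entries `1, …, k` of the solution `y` of `T̃ᵀ y = v`. -/
def forwardSubst (z : R) (s : State R n) (v : ℕ → R) : ℕ → Prog R (ℕ → R)
  | 0 => pure fun _ => z
  | j + 1 => do
      let y ← forwardSubst z s v j
      let a ← mul (s.tMid z (j + 1)) (y j)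
      let c ← mul (s.tTop z (j + 1)) (y (j - 1))
      let e ← sub (v (j + 1)) a
      let e' ← sub e c
      let x ← div e' (s.be (j + 2))
      pure (Function.update y (j + 1) x)

/-- Back substitution: starting from the array `v`, solve the equations number
`top, top - 1, …, top - m + 1` of the system `T̃ v = y` for the entries of `v` with these numbers. -/
def backSubst (s : State R n) (y : ℕ → R) (top : ℕ) (v : ℕ → R) : ℕ → Prog R (ℕ → R)
  | 0 => pure v
  | m + 1 => do
      let v ← backSubst s y top v m
      let i := top - m
      let a ← mul (s.al (i + 1)) (v (i + 1))
      let c ← mul (s.be (i + 2)) (v (i + 2))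
      let e ← sub (y i) a
      let e' ← sub e c
      let x ← div e' (s.be (i + 1))
      pure (Function.update v i x)

/-- One step of inverse iteration: solve `T̃ᵀ y = v` and `T̃ v' = y`, and normalize `v'`. -/
def inverseStep (z : R) (s : State R n) (k : ℕ) (v : ℕ → R) : Prog R (ℕ → R) := do
  let y ← forwardSubst z s v k
  let v' ← backSubst s y k (fun _ => z) k
  let sq ← sum k fun j => mul (v' (j + 1)) (v' (j + 1))
  let r ← sqrt sq
  fill z k fun j => div (v' j) r

/-- Inverse iteration from a Gaussian vector, repeated while `ℓ < 2.23 ln (k / δ²)`. -/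
def inverseIteration (z δ : R) (s : State R n) (k : ℕ) : Prog R (ℕ → R) := do
  let v ← fill z k fun _ => gauss
  let kk ← const k
  let δ2 ← mul δ δ
  let ratio ← div kk δ2
  let l ← log ratio
  let c ← const (223 / 100)
  let bound ← mul c l
  let N ← countTo bound
  iterate (inverseStep z s k) N v

/-- The vector `Q v`, where `Q` has the columns `q 1, …, q k`. -/
def applyBasis (s : State R n) (k : ℕ) (v : ℕ → R) : Prog R (Fin n → R) :=
  tabulate n fun i => sum k fun j => mul (s.q (j + 1) i) (v (j + 1))

/-- The scalar `α = (T₁₁ v₁ + T₁₂ v₂) / ‖b‖`, where `v₂` is zero if there is only one entry. -/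
def scaling (nb : R) (s : State R n) (v : ℕ → R) : Prog R R := do
  let a ← mul (s.al 1) (v 1)
  let c ← mul (s.be 2) (v 2)
  let e ← add a c
  div e nb

/-- The output after `k` iterations in the regular case: `Q v / α`, where `v` comes from
inverse iteration. -/
def regularOutput (z δ nb : R) (s : State R n) (k : ℕ) : Prog R (Fin n → R) := do
  let v ← inverseIteration z δ s k
  let α ← scaling nb s v
  let x ← applyBasis s k v
  divBy x α

/-- The output after `k` iterations if the Krylov space is exhausted. Then `T̃` is singular; its null
vector `v` with last entry `1` is found by back substitution. If `α ≠ 0`, the output is `Q v / α`, as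
in the regular case. Otherwise `Q v` is a null vector of `A`, which is scaled by `‖b‖ / tol`. -/
def exhaustedOutput (z tol nb : R) (s : State R n) (k : ℕ) : Prog R (Fin n → R) := do
  let o ← const 1
  let v ← backSubst s (fun _ => z) (k - 1) (Function.update (fun _ => z) k o) (k - 1)
  let α ← scaling nb s v
  let x ← applyBasis s k v
  let α2 ← mul α α
  let ok ← lt z α2
  if ok then
    divBy x α
  else do
    let c ← div tol nb
    divBy x c

/-- MINBERR, for a matrix that is given by a routine `mv` for its products with vectors, the right-hand
side `b`, the maximal number `kmax ≥ 1` of iterations, the tolerance `tol` for the smallest singular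
value of `T̃`, and the failure probability `δ`. -/
def minberr (mv : (Fin n → R) → Prog R (Fin n → R)) (b : Fin n → R) (kmax : ℕ) (tol δ : R) :
    Prog R (Fin n → R) := do
  let z ← const 0
  let o ← const 1
  let nb ← norm b
  let q1 ← divBy b nb
  let s : State R n :=
    { q := Function.update (fun _ _ => z) 1 q1
      al := fun _ => z
      be := Function.update (fun _ => z) 1 o
      rd := fun _ => o
      ru := fun _ => z }
  let (s, st, k) ← krylovLoop mv z tol (kmax - 1) 1 s
  match st with
  | .exhausted => exhaustedOutput z tol nb s k
  | _ => regularOutput z δ nb s k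

end Algorithm

/-! ### Backward error -/

/-- The spectral norm of a matrix: the operator norm for the Euclidean norm. -/
noncomputable def specNorm {n : ℕ} (A : Matrix (Fin n) (Fin n) ℝ) : ℝ :=
  ‖Matrix.toEuclideanCLM (n := Fin n) (𝕜 := ℝ) A‖

/-- The relative backward error of `x` for the system `A x = b`: the least `‖E‖₂ / ‖A‖₂` over all `E`
with `(A + E) x = b`; it is `∞` if there is no such `E`. -/
noncomputable def berr {n : ℕ} (A : Matrix (Fin n) (Fin n) ℝ) (b x : Fin n → ℝ) : ℝ≥0∞ :=
  ⨅ (E : Matrix (Fin n) (Fin n) ℝ) (_ : (A + E).mulVec x = b),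
    ENNReal.ofReal (specNorm E / specNorm A)

/-- The routine `mv` multiplies vectors with the matrix `A`, in at most `T` operations and
without drawing random numbers. -/
def MultipliesBy {n : ℕ} (mv : (Fin n → ℝ) → Prog ℝ (Fin n → ℝ))
    (A : Matrix (Fin n) (Fin n) ℝ) (T : ℕ) : Prop :=
  ∀ (v : Fin n → ℝ) (ω : ℕ → ℝ) (s : Counters),
    ∃ c ≤ T, (mv v).run ω s = some (A.mulVec v, s.tick c)

/-- With the random numbers `ω`, the program stops after at most `time` operations and returns a vector
whose backward error is at most `ε`. -/
def SolvesWithin {n : ℕ} (p : Prog ℝ (Fin n → ℝ)) (A : Matrix (Fin n) (Fin n) ℝ) (b : Fin n → ℝ)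
    (ε time : ℝ) (ω : ℕ → ℝ) : Prop :=
  ∃ (x : Fin n → ℝ) (s : Counters), p.run ω ⟨0, 0⟩ = some (x, s) ∧
    berr A b x ≤ ENNReal.ofReal ε ∧ (s.steps : ℝ) ≤ time

end Minberr

/-!
MINBERR runs Lanczos tridiagonalization on the Krylov space of `A` and `b`, and looks for a vector
`x = Q v / α` in it whose residual has no component along `b`. By the Lanczos relation
(`mulVec_comb`) the residual of `x` is then, up to the sign, `Q' (T̃ v) / α`, where `Q'` has
orthonormal columns, so that the relative residual `‖b - A x‖ / ‖x‖`, and with it the backward error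
(`berr_le`), is `‖T̃ v‖ / ‖v‖`. It has to be brought below `ε ‖A‖ = (3 / 2) tol`.

*Number of iterations.* Every polynomial in `A` applied to `b` gives a competitor `v`. The
Chebyshev-type polynomial `∑ⱼ (M - j) V j` with `V j (t) = (1 - T j (1 - 2 t)) / t` shows that the
smallest singular value of `T̃` is at most `6 ‖A‖ / (k (k + 2))` after `k` iterations
(`IsLanczos.exists_small`). As long as the Cholesky factorization of `T̃ᵀ T̃ - tol² I` exists, this
singular value is at least `tol` (`IsCholesky.le_sum_sq`), hence `k < 3 / √ε`; and `k < n`, because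
the Lanczos vectors are orthonormal (`IsLanczos.le_dim`). So the loop never ends because of `kmax`, but
either with an exhausted Krylov space, or with a breakdown of the factorization, which certifies a
singular value of at most `tol` (`IsCholesky.exists_of_breakdown`).

*Exhausted Krylov space.* The null vector of `T̃` gives a solution of `A x = b`, or, if `α = 0`, a null
vector of `A`, which has a small backward error when it is scaled to be long
(`exhaustedOutput_costs`).

*Breakdown.* `N` steps of inverse iteration compute `(T̃ᵀ T̃)⁻ᴺ g`, up to a factor, for a Gaussian
vector `g`. The norms that occur in the half steps form a log-convex sequence
(`inverseIteration_log_convex`). This bounds `‖T̃ v‖² / ‖v‖²` by `9 / 4` times the smallest eigenvalue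
of `T̃ᵀ T̃`, unless the component of `g` in the direction of an eigenvector `u` satisfies
`(u, g)² < (9 / 4)^(-2N) ‖g‖²` (`inverseIteration_quotient_le`). With `N ≥ 2.23 ln (k / δ²)` this has
probability at most `δ` (`gaussianStream_bad_le`), and the division by `α`, a nonzero linear functional
of `g`, fails with probability zero.

*Steps.* An iteration takes at most `T + 9 n + 25` operations, and a step of inverse iteration
`13 k + 2`. With `k ≤ n` and `k ≤ 4 / √ε` the total is as claimed (`cost_le`).
-/

namespace Minberr

/-! ### Execution of programs -/

namespace Prog

variable {R α β : Type}

theorem run_bind (ω : ℕ → ℝ) (p : Prog ℝ α) (f : α → Prog ℝ β) (s : Counters) :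
    (p >>= f).run ω s = (p.run ω s).bind fun r => (f r.1).run ω r.2 := by
  change (p.bind f).run ω s = _
  induction p generalizing s with
  | ret a => simp [Prog.bind, Prog.run]
  | const c k ih => simp [Prog.bind, Prog.run, ih]
  | bin o x y k ih =>
    cases o <;> simp only [Prog.bind, Prog.run, ih]
    split_ifs <;> simp
  | sqrt x k ih => simp only [Prog.bind, Prog.run, ih]; split_ifs <;> simp
  | log x k ih => simp only [Prog.bind, Prog.run, ih]; split_ifs <;> simp
  | lt x y k ih => simp [Prog.bind, Prog.run, ih]
  | countTo x k ih => simp [Prog.bind, Prog.run, ih]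
  | gauss k ih => simp [Prog.bind, Prog.run, ih]

end Prog

/-- Whatever the random numbers and the counters are, the program `p` returns `a` after at most `C`
operations and draws no random number. -/
def Costs {α : Type} (p : Prog ℝ α) (a : α) (C : ℕ) : Prop :=
  ∀ (ω : ℕ → ℝ) (s : Counters), ∃ c ≤ C, p.run ω s = some (a, s.tick c)

namespace Costs

variable {α β : Type}

theorem mono {p : Prog ℝ α} {a : α} {C D : ℕ} (h : Costs p a C) (hCD : C ≤ D) : Costs p a D := by
  intro ω s
  obtain ⟨c, hc, hr⟩ := h ω s
  exact ⟨c, hc.trans hCD, hr⟩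

theorem bind {p : Prog ℝ α} {f : α → Prog ℝ β} {a : α} {b : β} {C D : ℕ} (hp : Costs p a C)
    (hf : Costs (f a) b D) : Costs (p >>= f) b (C + D) := by
  intro ω s
  obtain ⟨c, hc, hr⟩ := hp ω s
  obtain ⟨d, hd, hr'⟩ := hf ω (s.tick c)
  refine ⟨c + d, by omega, ?_⟩
  rw [Prog.run_bind, hr]
  simpa [Counters.tick, add_assoc] using hr'

/-- A single operation, followed by the rest of a program. -/
theorem bind_one {p : Prog ℝ α} {f : α → Prog ℝ β} {a : α} {b : β} {D : ℕ} (hp : Costs p a 1)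
    (hf : Costs (f a) b D) : Costs (p >>= f) b (D + 1) :=
  add_comm D 1 ▸ hp.bind hf

theorem pure (a : α) : Costs (Pure.pure a : Prog ℝ α) a 0 := fun _ s => ⟨0, le_rfl, by
  change (Prog.ret a).run _ s = _
  simp [Prog.run, Counters.tick]⟩

theorem const (c : ℚ) : Costs (Minberr.const c) (c : ℝ) 1 := fun _ s =>
  ⟨1, le_rfl, by simp [Minberr.const, Prog.run]⟩

theorem add (x y : ℝ) : Costs (Minberr.add x y) (x + y) 1 := fun _ s =>
  ⟨1, le_rfl, by simp [Minberr.add, Prog.run]⟩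

theorem sub (x y : ℝ) : Costs (Minberr.sub x y) (x - y) 1 := fun _ s =>
  ⟨1, le_rfl, by simp [Minberr.sub, Prog.run]⟩

theorem mul (x y : ℝ) : Costs (Minberr.mul x y) (x * y) 1 := fun _ s =>
  ⟨1, le_rfl, by simp [Minberr.mul, Prog.run]⟩

theorem div (x : ℝ) {y : ℝ} (hy : y ≠ 0) : Costs (Minberr.div x y) (x / y) 1 := fun _ s =>
  ⟨1, le_rfl, by simp [Minberr.div, Prog.run, hy]⟩

theorem sqrt {x : ℝ} (hx : 0 ≤ x) : Costs (Minberr.sqrt x) (Real.sqrt x) 1 := fun _ s =>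
  ⟨1, le_rfl, by simp [Minberr.sqrt, Prog.run, hx.not_gt]⟩

theorem log {x : ℝ} (hx : 0 < x) : Costs (Minberr.log x) (Real.log x) 1 := fun _ s =>
  ⟨1, le_rfl, by simp [Minberr.log, Prog.run, hx.not_ge]⟩

open Classical in
theorem lt (x y : ℝ) : Costs (Minberr.lt x y) (decide (x < y)) 1 := fun _ s =>
  ⟨1, le_rfl, by simp [Minberr.lt, Prog.run]⟩

theorem lt_of_lt {x y : ℝ} (h : x < y) : Costs (Minberr.lt x y) true 1 := by
  classical
  simpa [h] using lt x y

theorem lt_of_not_lt {x y : ℝ} (h : ¬ x < y) : Costs (Minberr.lt x y) false 1 := by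
  classical
  simpa [h] using lt x y

theorem countTo (x : ℝ) : Costs (Minberr.countTo x) ⌈x⌉₊ (2 * ⌈x⌉₊ + 1) := fun _ s =>
  ⟨_, le_rfl, by simp [Minberr.countTo, Prog.run]⟩

theorem tabulate {C : ℕ} : ∀ {n : ℕ} {f : Fin n → Prog ℝ ℝ} {x : Fin n → ℝ},
    (∀ i, Costs (f i) (x i) C) → Costs (Minberr.tabulate n f) x (n * C)
  | 0, f, x, _ => by
    have : x = Fin.elim0 := Subsingleton.elim _ _
    rw [this]
    exact (Costs.pure _).mono (by simp)
  | n + 1, f, x, h => by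
    have h1 := tabulate (f := fun i => f i.castSucc) (x := fun i => x i.castSucc)
      fun i => h i.castSucc
    have h2 : Costs (Pure.pure (Fin.snoc (α := fun _ => ℝ) (fun i => x i.castSucc)
        (x (Fin.last n))) : Prog ℝ _) x 0 := by
      convert Costs.pure _
      exact (Fin.snoc_init_self x).symm
    exact (h1.bind ((h (Fin.last n)).bind h2)).mono (by ring_nf; rfl)

theorem sum {C : ℕ} : ∀ {n : ℕ} {f : Fin n → Prog ℝ ℝ} {x : Fin n → ℝ},
    (∀ i, Costs (f i) (x i) C) → Costs (Minberr.sum n f) (∑ i, x i) (n * (C + 1) + 1)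
  | 0, f, x, _ => by
    have h := Costs.const 0
    rw [Rat.cast_zero] at h
    rw [Fin.sum_univ_zero]
    exact h.mono (by simp)
  | n + 1, f, x, h => by
    have h1 := sum (f := fun i => f i.castSucc) (x := fun i => x i.castSucc)
      fun i => h i.castSucc
    rw [Fin.sum_univ_castSucc]
    exact (h1.bind ((h (Fin.last n)).bind (Costs.add _ _))).mono (by ring_nf; rfl)

theorem dot {n : ℕ} (x y : Fin n → ℝ) : Costs (Minberr.dot x y) (x ⬝ᵥ y) (n * 2 + 1) :=
  sum fun _ => Costs.mul _ _

theorem norm {n : ℕ} (x : Fin n → ℝ) :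
    Costs (Minberr.norm x) (Real.sqrt (x ⬝ᵥ x)) (n * 2 + 2) :=
  (dot x x).bind (sqrt (Finset.sum_nonneg fun _ _ => mul_self_nonneg _))

theorem subMul {n : ℕ} (x : Fin n → ℝ) (c : ℝ) (y : Fin n → ℝ) :
    Costs (Minberr.subMul x c y) (x - c • y) (n * 2) :=
  tabulate fun _ => (Costs.mul _ _).bind (Costs.sub _ _)

theorem divBy {n : ℕ} (x : Fin n → ℝ) {c : ℝ} (hc : c ≠ 0) :
    Costs (Minberr.divBy x c) (c⁻¹ • x) (n * 1) :=
  tabulate fun i => by simpa [div_eq_inv_mul] using Costs.div (x i) hc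

theorem denseMulVec {n : ℕ} (A : Matrix (Fin n) (Fin n) ℝ) (v : Fin n → ℝ) :
    Costs (Minberr.denseMulVec A v) (A.mulVec v) (n * (n * 2 + 1)) :=
  tabulate fun i => dot (A i) v

theorem fill (z : ℝ) {C : ℕ} {f : ℕ → Prog ℝ ℝ} {x : ℕ → ℝ} :
    ∀ {k : ℕ}, (∀ j, Costs (f j) (x j) C) →
      Costs (Minberr.fill z k f) (fun j => if 1 ≤ j ∧ j ≤ k then x j else z) (k * C)
  | 0, _ => by
    have : (fun j => if 1 ≤ j ∧ j ≤ 0 then x j else z) = fun _ => z := by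
      funext j; rw [if_neg (by omega)]
    rw [this]
    exact (Costs.pure _).mono (by simp)
  | k + 1, h => by
    have h1 := fill z (f := f) (x := x) (k := k) h
    have h2 : Costs (Pure.pure (Function.update (fun j => if 1 ≤ j ∧ j ≤ k then x j else z)
        (k + 1) (x (k + 1))) : Prog ℝ _)
        (fun j => if 1 ≤ j ∧ j ≤ k + 1 then x j else z) 0 := by
      convert Costs.pure _ using 1
      funext j
      by_cases hj : j = k + 1
      · subst hj; simp
      · rw [Function.update_of_ne hj]
        have : (1 ≤ j ∧ j ≤ k + 1) ↔ (1 ≤ j ∧ j ≤ k) := by omega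
        simp [this]
    exact (h1.bind ((h (k + 1)).bind h2)).mono (by ring_nf; rfl)

theorem iterate {α : Type} {f : α → Prog ℝ α} {C : ℕ} (P : α → Prop) {g : α → α}
    (hP : ∀ a, P a → P (g a)) (hf : ∀ a, P a → Costs (f a) (g a) C) :
    ∀ (N : ℕ) (a : α), P a → Costs (Minberr.iterate f N a) (g^[N] a) (N * C)
  | 0, a, _ => (Costs.pure a).mono (by simp)
  | N + 1, a, h =>
    ((hf a h).bind (iterate P hP hf N (g a) (hP a h))).mono (by ring_nf; rfl)

end Costs

/-- A block of `k` Gaussian numbers, taken from the current position of the random stream. -/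
theorem run_fill_gauss (z : ℝ) (ω : ℕ → ℝ) (s : Counters) : ∀ k : ℕ,
    (fill z k fun _ => gauss).run ω s =
      some (fun j => if 1 ≤ j ∧ j ≤ k then ω (s.drawn + (j - 1)) else z,
        ⟨s.steps + k, s.drawn + k⟩)
  | 0 => by
    have : (fun j => if 1 ≤ j ∧ j ≤ 0 then ω (s.drawn + (j - 1)) else z) = fun _ => z := by
      funext j; rw [if_neg (by omega)]
    rw [this]; rfl
  | k + 1 => by
    have h1 := run_fill_gauss z ω s k
    rw [fill, Prog.run_bind, h1]
    simp only [Option.bind_some]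
    rw [Prog.run_bind]
    simp only [gauss, Prog.run, Option.bind_some]
    change some (_, _) = some (_, _)
    congr 2
    funext j
    by_cases hj : j = k + 1
    · subst hj; simp
    · rw [Function.update_of_ne hj]
      have : (1 ≤ j ∧ j ≤ k + 1) ↔ (1 ≤ j ∧ j ≤ k) := by omega
      simp [this]

/-! ### The Lanczos recurrence -/

section Lanczos

variable {n : ℕ} {A : Matrix (Fin n) (Fin n) ℝ} {b : Fin n → ℝ} {s : State ℝ n} {k : ℕ}

/-- The first `k` Lanczos vectors for `A` and `b` and the coefficients that belong to them have been
computed: `q 1, …, q k` are orthonormal, start in the direction of `b`, and satisfy the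
three-term recurrence up to `A q (k - 1)`. -/
structure IsLanczos (A : Matrix (Fin n) (Fin n) ℝ) (b : Fin n → ℝ) (s : State ℝ n) (k : ℕ) :
    Prop where
  q_zero : s.q 0 = 0
  be_one : s.be 1 = 1
  q_one : s.q 1 = (√(b ⬝ᵥ b))⁻¹ • b
  be_pos : ∀ j, 1 ≤ j → j ≤ k → 0 < s.be j
  orth : ∀ i j, 1 ≤ i → i ≤ k → 1 ≤ j → j ≤ k → s.q i ⬝ᵥ s.q j = if i = j then 1 else 0
  recurrence : ∀ j, 1 ≤ j → j < k →
    A.mulVec (s.q j) = s.be (j + 1) • s.q (j + 1) + s.al j • s.q j + s.be j • s.q (j - 1)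

namespace IsLanczos

theorem congr {s' : State ℝ n} (h : IsLanczos A b s k) (hk : 1 ≤ k)
    (hq : ∀ j ≤ k, s'.q j = s.q j) (hal : ∀ j < k, s'.al j = s.al j)
    (hbe : ∀ j ≤ k, s'.be j = s.be j) : IsLanczos A b s' k where
  q_zero := by rw [hq 0 (by omega), h.q_zero]
  be_one := by rw [hbe 1 hk, h.be_one]
  q_one := by rw [hq 1 hk, h.q_one]
  be_pos j h1 h2 := by rw [hbe j h2]; exact h.be_pos j h1 h2
  orth i j h1 h2 h3 h4 := by rw [hq i h2, hq j h4]; exact h.orth i j h1 h2 h3 h4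
  recurrence j h1 h2 := by
    rw [hq j (by omega), hq (j + 1) (by omega), hq (j - 1) (by omega), hbe (j + 1) (by omega),
      hbe j (by omega), hal j h2]
    exact h.recurrence j h1 h2

theorem succ (h : IsLanczos A b s k) (hbe : 0 < s.be (k + 1))
    (horth : ∀ j, 1 ≤ j → j ≤ k → s.q (k + 1) ⬝ᵥ s.q j = 0)
    (hone : s.q (k + 1) ⬝ᵥ s.q (k + 1) = 1)
    (hrec : A.mulVec (s.q k) =
      s.be (k + 1) • s.q (k + 1) + s.al k • s.q k + s.be k • s.q (k - 1)) :
    IsLanczos A b s (k + 1) where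
  q_zero := h.q_zero
  be_one := h.be_one
  q_one := h.q_one
  be_pos j h1 h2 := by
    rcases Nat.lt_or_eq_of_le h2 with h3 | rfl
    · exact h.be_pos j h1 (by omega)
    · exact hbe
  orth i j h1 h2 h3 h4 := by
    rcases Nat.lt_or_eq_of_le h2 with h5 | rfl <;> rcases Nat.lt_or_eq_of_le h4 with h6 | rfl
    · exact h.orth i j h1 (by omega) h3 (by omega)
    · rw [dotProduct_comm, horth i h1 (by omega), if_neg (by omega)]
    · rw [horth j h3 (by omega), if_neg (by omega)]
    · simpa using hone
  recurrence j h1 h2 := by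
    rcases Nat.lt_or_eq_of_le (Nat.lt_succ_iff.1 h2) with h3 | rfl
    · exact h.recurrence j h1 h3
    · exact hrec

/-- The residual vector of the Lanczos step is orthogonal to all previous Lanczos vectors; this is
where the symmetry of `A` enters. -/
theorem residual_orth (hA : A.IsHermitian) (h : IsLanczos A b s k) (hk : 1 ≤ k)
    {w' w : Fin n → ℝ} (hw' : w' = A.mulVec (s.q k) - s.be k • s.q (k - 1))
    (hw : w = w' - (w' ⬝ᵥ s.q k) • s.q k) (j : ℕ) (h1 : 1 ≤ j) (h2 : j ≤ k) :
    w ⬝ᵥ s.q j = 0 := by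
  rcases Nat.lt_or_eq_of_le h2 with h3 | rfl
  · have hsymm : A.mulVec (s.q k) ⬝ᵥ s.q j = s.q k ⬝ᵥ A.mulVec (s.q j) := by
      rw [dotProduct_comm, Matrix.dotProduct_mulVec, ← Matrix.mulVec_transpose,
        show A.transpose = A from (by simpa using hA : A.IsSymm), dotProduct_comm]
    have hprev : s.q k ⬝ᵥ s.q (j - 1) = 0 := by
      rcases Nat.eq_zero_or_pos (j - 1) with h0 | h0
      · rw [h0, h.q_zero, dotProduct_zero]
      · rw [h.orth k (j - 1) hk le_rfl h0 (by omega), if_neg (by omega)]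
    rw [hw, hw', sub_dotProduct, sub_dotProduct, hsymm, h.recurrence j h1 h3]
    simp only [smul_dotProduct, dotProduct_add, dotProduct_smul, hprev,
      h.orth k j hk le_rfl h1 h2, h.orth k (j + 1) hk le_rfl (by omega) (by omega),
      if_neg (show k ≠ j by omega), smul_eq_mul, mul_zero, add_zero, sub_zero]
    rw [h.orth (k - 1) j (by omega) (by omega) h1 h2]
    by_cases hjk : k = j + 1
    · subst hjk; simp
    · rw [if_neg hjk, if_neg (by omega)]; simp
  · rw [hw, sub_dotProduct, smul_dotProduct, h.orth j j hk le_rfl hk le_rfl]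
    simp

theorem le_dim (h : IsLanczos A b s k) : k ≤ n := by
  classical
  let Q : Matrix (Fin k) (Fin n) ℝ := Matrix.of fun i => s.q (i + 1)
  have hQ : Q * Q.transpose = 1 := by
    ext i j
    rw [Matrix.mul_apply', Matrix.one_apply]
    have := h.orth (i + 1) (j + 1) (by omega) (by omega) (by omega) (by omega)
    simp only [Nat.add_right_cancel_iff, Fin.val_inj] at this
    exact this
  have h1 := Matrix.rank_mul_le_left Q Q.transpose
  rw [hQ, Matrix.rank_one, Fintype.card_fin] at h1
  simpa using h1.trans (Matrix.rank_le_width Q)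

/-- A combination of orthonormal vectors has the norm of its coefficient vector. -/
theorem dotProduct_comb (h : IsLanczos A b s k) (v : ℕ → ℝ) :
    (∑ j ∈ Finset.range k, v (j + 1) • s.q (j + 1)) ⬝ᵥ
      (∑ j ∈ Finset.range k, v (j + 1) • s.q (j + 1)) = ∑ j ∈ Finset.range k, v (j + 1) ^ 2 := by
  rw [sum_dotProduct]
  refine Finset.sum_congr rfl fun i hi => ?_
  rw [dotProduct_sum, Finset.sum_eq_single i]
  · have := h.orth (i + 1) (i + 1) (by omega) (by simpa using hi) (by omega) (by simpa using hi)
    rw [smul_dotProduct, dotProduct_smul, this]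
    simp [sq]
  · intro j hj hji
    have := h.orth (i + 1) (j + 1) (by omega) (by simpa using hi) (by omega) (by simpa using hj)
    rw [smul_dotProduct, dotProduct_smul, this, if_neg (by omega)]
    simp
  · exact fun hi' => absurd hi hi'

end IsLanczos

/-- Entry `i` of `T̃ v`, for an array `v` which is zero from place `k + 1` on. -/
def State.shiftedMul (s : State ℝ n) (v : ℕ → ℝ) (i : ℕ) : ℝ :=
  s.be (i + 1) * v i + s.al (i + 1) * v (i + 1) + s.be (i + 2) * v (i + 2)

/-- The Lanczos relation `A Q v = (T v)₁ q₁ + Q' (T̃ v)`, where `Q'` has the columns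
`q 2, …, q (k + 1)`. -/
theorem mulVec_comb (h0 : s.q 0 = 0)
    (hrec : ∀ j, 1 ≤ j → j ≤ k →
      A.mulVec (s.q j) = s.be (j + 1) • s.q (j + 1) + s.al j • s.q j + s.be j • s.q (j - 1))
    (v : ℕ → ℝ) (hv : ∀ j, k < j → v j = 0) :
    A.mulVec (∑ j ∈ Finset.range k, v (j + 1) • s.q (j + 1)) =
      (s.al 1 * v 1 + s.be 2 * v 2) • s.q 1 +
        ∑ i ∈ Finset.range k, s.shiftedMul v (i + 1) • s.q (i + 2) := by
  -- For arbitrary `v`, three boundary terms with `v (k + 1)` and `v (k + 2)` appear.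
  have key : ∀ m ≤ k, ∑ j ∈ Finset.range m, v (j + 1) • A.mulVec (s.q (j + 1)) +
      (s.al (m + 1) * v (m + 1) + s.be (m + 2) * v (m + 2)) • s.q (m + 1) +
        (s.be (m + 1) * v (m + 1)) • s.q m =
      (s.al 1 * v 1 + s.be 2 * v 2) • s.q 1 +
        ∑ i ∈ Finset.range m, s.shiftedMul v (i + 1) • s.q (i + 2) := by
    intro m
    induction m with
    | zero => intro _; simp [h0]
    | succ m ih =>
      intro hm
      rw [Finset.sum_range_succ, Finset.sum_range_succ, ← add_assoc, ← ih (by omega),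
        hrec (m + 1) (by omega) hm]
      simp only [State.shiftedMul, Nat.add_sub_cancel]
      module
  have := key k le_rfl
  rw [hv (k + 1) (by omega), hv (k + 2) (by omega)] at this
  simp only [mul_zero, add_zero, zero_smul] at this
  rw [Matrix.mulVec_sum, ← this]
  exact Finset.sum_congr rfl fun j _ => Matrix.mulVec_smul _ _ _

end Lanczos

/-! ### Triangular matrices with three diagonals and the Cholesky factorization -/

/-- The quadratic form `‖R v‖²` of an upper triangular matrix `R` with the entries `d j`, `e j`, `f j`
in column `j` and rows `j`, `j - 1`, `j - 2`, sorted by columns of the Gram matrix `Rᵀ R`. -/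
theorem sum_sq_band (d e f : ℕ → ℝ) (he : e 1 = 0) (hf1 : f 1 = 0) (hf2 : f 2 = 0) (k : ℕ)
    (v : ℕ → ℝ) (hv : ∀ j, k < j → v j = 0) :
    ∑ i ∈ Finset.range k, (d (i + 1) * v (i + 1) + e (i + 2) * v (i + 2) +
        f (i + 3) * v (i + 3)) ^ 2 =
      ∑ i ∈ Finset.range k, ((d (i + 1) ^ 2 + e (i + 1) ^ 2 + f (i + 1) ^ 2) * v (i + 1) ^ 2 +
        2 * (d i * e (i + 1) + e i * f (i + 1)) * (v i * v (i + 1)) +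
        2 * (d (i - 1) * f (i + 1)) * (v (i - 1) * v (i + 1))) := by
  -- For arbitrary `v`, boundary terms with `v (m + 1)` and `v (m + 2)` appear.
  have key : ∀ m : ℕ, ∑ i ∈ Finset.range m, (d (i + 1) * v (i + 1) + e (i + 2) * v (i + 2) +
        f (i + 3) * v (i + 3)) ^ 2 =
      ∑ i ∈ Finset.range m, ((d (i + 1) ^ 2 + e (i + 1) ^ 2 + f (i + 1) ^ 2) * v (i + 1) ^ 2 +
        2 * (d i * e (i + 1) + e i * f (i + 1)) * (v i * v (i + 1)) +
        2 * (d (i - 1) * f (i + 1)) * (v (i - 1) * v (i + 1))) +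
      ((e (m + 1) * v (m + 1) + f (m + 2) * v (m + 2)) ^ 2 +
        2 * d m * v m * (e (m + 1) * v (m + 1) + f (m + 2) * v (m + 2)) +
        (f (m + 1) * v (m + 1)) ^ 2 +
        2 * (d (m - 1) * v (m - 1) + e m * v m) * (f (m + 1) * v (m + 1))) := by
    intro m
    induction m with
    | zero => simp [he, hf1, hf2]
    | succ m ih =>
      rw [Finset.sum_range_succ, Finset.sum_range_succ, ih]
      simp only [Nat.add_sub_cancel]
      ring
  rw [key k, hv (k + 1) (by omega), hv (k + 2) (by omega)]
  simp

/-- Back substitution for an upper triangular matrix with three diagonals, in the notation of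
`sum_sq_band`: starting from the array `v`, the equations number `top, …, top - m + 1` are solved. -/
noncomputable def backSolve (d e f y : ℕ → ℝ) (top : ℕ) (v : ℕ → ℝ) : ℕ → ℕ → ℝ
  | 0 => v
  | m + 1 => Function.update (backSolve d e f y top v m) (top - m)
      ((y (top - m) - e (top - m + 1) * backSolve d e f y top v m (top - m + 1) -
        f (top - m + 2) * backSolve d e f y top v m (top - m + 2)) / d (top - m))

theorem backSolve_of_le (d e f y : ℕ → ℝ) {top : ℕ} (v : ℕ → ℝ) {m : ℕ} (hm : m ≤ top)
    {j : ℕ} (hj : j ≤ top - m ∨ top < j) : backSolve d e f y top v m j = v j := by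
  induction m with
  | zero => rfl
  | succ m ih =>
    rw [backSolve, Function.update_of_ne (by omega), ih (by omega) (by omega)]

theorem backSolve_spec (d e f y : ℕ → ℝ) {top : ℕ} (v : ℕ → ℝ) {m : ℕ} (hm : m ≤ top)
    (hd : ∀ i, top - m < i → i ≤ top → d i ≠ 0) {i : ℕ} (h1 : top - m < i) (h2 : i ≤ top) :
    d i * backSolve d e f y top v m i + e (i + 1) * backSolve d e f y top v m (i + 1) +
      f (i + 2) * backSolve d e f y top v m (i + 2) = y i := by
  induction m with
  | zero => omega
  | succ m ih =>
    rw [backSolve]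
    rw [Function.update_of_ne (show i + 1 ≠ top - m by omega),
      Function.update_of_ne (show i + 2 ≠ top - m by omega)]
    by_cases hi : i = top - m
    · subst hi
      rw [Function.update_self]
      have := hd _ h1 h2
      field_simp
      ring
    · rw [Function.update_of_ne hi]
      exact ih (by omega) (fun i h3 h4 => hd i (by omega) h4) (by omega)

section Cholesky

variable {n : ℕ} {s : State ℝ n} {tol : ℝ} {k : ℕ}

/-- The entry of the Cholesky factor in place `(j - 2, j)`. -/
noncomputable def State.rTop (s : State ℝ n) (j : ℕ) : ℝ :=
  s.tTop 0 j * s.be (j - 1) / s.rd (j - 2)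

/-- The first `k` columns of the Cholesky factorization of `T̃ᵀ T̃ - tol² I` have been computed. -/
structure IsCholesky (tol : ℝ) (s : State ℝ n) (k : ℕ) : Prop where
  rd_pos : ∀ j ≤ k, 0 < s.rd j
  off_diag : ∀ j, 1 ≤ j → j ≤ k → s.rd (j - 1) * s.ru j + s.ru (j - 1) * s.rTop j =
    s.tMid 0 j * s.be j + s.tTop 0 j * s.tMid 0 (j - 1)
  diag : ∀ j, 1 ≤ j → j ≤ k → s.rd j ^ 2 + s.ru j ^ 2 + s.rTop j ^ 2 + tol ^ 2 =
    s.tTop 0 j ^ 2 + s.tMid 0 j ^ 2 + s.be (j + 1) ^ 2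

theorem State.tMid_congr {s s' : State ℝ n} {j : ℕ} (h : s'.al j = s.al j) :
    s'.tMid 0 j = s.tMid 0 j := by simp [State.tMid, h]

theorem State.tTop_congr {s s' : State ℝ n} {j : ℕ} (h : s'.be j = s.be j) :
    s'.tTop 0 j = s.tTop 0 j := by simp [State.tTop, h]

theorem IsCholesky.congr {s' : State ℝ n} (h : IsCholesky tol s k)
    (hal : ∀ j ≤ k, s'.al j = s.al j) (hbe : ∀ j ≤ k + 1, s'.be j = s.be j)
    (hrd : ∀ j ≤ k, s'.rd j = s.rd j) (hru : ∀ j ≤ k, s'.ru j = s.ru j) :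
    IsCholesky tol s' k := by
  have hr : ∀ j ≤ k, s'.rTop j = s.rTop j := fun j hj => by
    rw [State.rTop, State.rTop, State.tTop_congr (hbe j (by omega)), hbe (j - 1) (by omega),
      hrd (j - 2) (by omega)]
  refine ⟨fun j hj => by rw [hrd j hj]; exact h.rd_pos j hj, fun j h1 h2 => ?_, fun j h1 h2 => ?_⟩
  · rw [hr j h2, hrd _ (by omega), hru j h2, hru (j - 1) (by omega), hbe j (by omega),
      State.tMid_congr (hal j h2), State.tMid_congr (hal (j - 1) (by omega)),
      State.tTop_congr (hbe j (by omega))]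
    exact h.off_diag j h1 h2
  · rw [hr j h2, hrd _ (by omega), hru j h2, hbe (j + 1) (by omega),
      State.tMid_congr (hal j h2), State.tTop_congr (hbe j (by omega))]
    exact h.diag j h1 h2

theorem IsCholesky.succ (h : IsCholesky tol s k) (h0 : 0 < s.rd (k + 1))
    (h1 : s.rd k * s.ru (k + 1) + s.ru k * s.rTop (k + 1) =
      s.tMid 0 (k + 1) * s.be (k + 1) + s.tTop 0 (k + 1) * s.tMid 0 k)
    (h2 : s.rd (k + 1) ^ 2 + s.ru (k + 1) ^ 2 + s.rTop (k + 1) ^ 2 + tol ^ 2 =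
      s.tTop 0 (k + 1) ^ 2 + s.tMid 0 (k + 1) ^ 2 + s.be (k + 2) ^ 2) :
    IsCholesky tol s (k + 1) := by
  refine ⟨fun j hj => ?_, fun j h3 h4 => ?_, fun j h3 h4 => ?_⟩
  all_goals
    rcases Nat.lt_or_eq_of_le ‹j ≤ k + 1› with h5 | rfl
  · exact h.rd_pos j (by omega)
  · exact h0
  · exact h.off_diag j h3 (by omega)
  · exact h1
  · exact h.diag j h3 (by omega)
  · exact h2

theorem State.shiftedMul_eq (s : State ℝ n) (v : ℕ → ℝ) (i : ℕ) :
    s.shiftedMul v (i + 1) = s.be (i + 2) * v (i + 1) + s.tMid 0 (i + 2) * v (i + 2) +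
      s.tTop 0 (i + 3) * v (i + 3) := by
  simp [State.shiftedMul, State.tMid, State.tTop]

/-- Comparison of the Gram matrix of `T̃` with that of a triangular matrix `R`: if
`T̃ᵀ T̃ = tol² I + Rᵀ R + p eₖ eₖᵀ`, the quadratic forms are related accordingly. -/
theorem sum_sq_shiftedMul (rd ru r2 : ℕ → ℝ) (p : ℝ) (h1 : ru 1 = 0) (h2 : r2 1 = 0)
    (h3 : r2 2 = 0)
    (htop : ∀ j, j < k → rd (j - 1) * r2 (j + 1) = s.be j * s.tTop 0 (j + 1))
    (hoff : ∀ j, j < k → rd j * ru (j + 1) + ru j * r2 (j + 1) =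
      s.be (j + 1) * s.tMid 0 (j + 1) + s.tMid 0 j * s.tTop 0 (j + 1))
    (hdiag : ∀ j, j < k → rd (j + 1) ^ 2 + ru (j + 1) ^ 2 + r2 (j + 1) ^ 2 + tol ^ 2 +
      (if j + 1 = k then p else 0) =
      s.be (j + 2) ^ 2 + s.tMid 0 (j + 1) ^ 2 + s.tTop 0 (j + 1) ^ 2)
    (v : ℕ → ℝ) (hv : ∀ j, k < j → v j = 0) :
    ∑ i ∈ Finset.range k, s.shiftedMul v (i + 1) ^ 2 =
      ∑ i ∈ Finset.range k, (rd (i + 1) * v (i + 1) + ru (i + 2) * v (i + 2) +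
        r2 (i + 3) * v (i + 3)) ^ 2 +
      tol ^ 2 * ∑ i ∈ Finset.range k, v (i + 1) ^ 2 +
      ∑ i ∈ Finset.range k, (if i + 1 = k then p else 0) * v (i + 1) ^ 2 := by
  have hT := sum_sq_band (fun j => s.be (j + 1)) (s.tMid 0) (s.tTop 0) (by simp [State.tMid])
    (by simp [State.tTop]) (by simp [State.tTop]) k v hv
  have hR := sum_sq_band rd ru r2 h1 h2 h3 k v hv
  simp only [State.shiftedMul_eq]
  rw [hR, hT, Finset.mul_sum, ← Finset.sum_add_distrib, ← Finset.sum_add_distrib]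
  refine Finset.sum_congr rfl fun i hi => ?_
  have hik : i < k := by simpa using hi
  have htop' : rd (i - 1) * r2 (i + 1) = s.be (i - 1 + 1) * s.tTop 0 (i + 1) := by
    rcases Nat.eq_zero_or_pos i with rfl | hpos
    · simp [h2, State.tTop]
    · rw [htop i hik, Nat.sub_add_cancel hpos]
  rw [← hdiag i hik, ← hoff i hik, ← htop']
  ring

theorem IsCholesky.rTop_spec (h : IsCholesky tol s k) {j : ℕ} (hj : j ≤ k + 1) :
    s.rd (j - 1) * s.rTop (j + 1) = s.be j * s.tTop 0 (j + 1) := by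
  have := (h.rd_pos (j - 1) (by omega)).ne'
  rw [State.rTop, show j + 1 - 2 = j - 1 by omega, Nat.add_sub_cancel]
  field_simp

theorem State.rTop_one (s : State ℝ n) : s.rTop 1 = 0 := by simp [State.rTop, State.tTop]

theorem State.rTop_two (s : State ℝ n) : s.rTop 2 = 0 := by simp [State.rTop, State.tTop]

/-- As long as the factorization does not break down, the smallest singular value of `T̃` is at least
`tol`. -/
theorem IsCholesky.le_sum_sq (h : IsCholesky tol s k) (v : ℕ → ℝ) (hv : ∀ j, k < j → v j = 0) :
    tol ^ 2 * ∑ i ∈ Finset.range k, v (i + 1) ^ 2 ≤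
      ∑ i ∈ Finset.range k, s.shiftedMul v (i + 1) ^ 2 := by
  rcases Nat.eq_zero_or_pos k with rfl | hk
  · simp
  have hru : s.ru 1 = 0 := by
    have := h.off_diag 1 le_rfl hk
    rw [s.rTop_one] at this
    simpa [State.tMid, State.tTop, (h.rd_pos 0 (by omega)).ne'] using this
  rw [sum_sq_shiftedMul (tol := tol) s.rd s.ru s.rTop 0 hru s.rTop_one s.rTop_two
    (fun j hj => h.rTop_spec (by omega))
    (fun j hj => by rw [mul_comm (s.be _), mul_comm (s.tMid 0 j)]
                    exact h.off_diag (j + 1) (by omega) (by omega))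
    (fun j hj => by
      have := h.diag (j + 1) (by omega) (by omega)
      rw [ite_self]; linarith) v hv]
  have : 0 ≤ ∑ i ∈ Finset.range k, (s.rd (i + 1) * v (i + 1) + s.ru (i + 2) * v (i + 2) +
        s.rTop (i + 3) * v (i + 3)) ^ 2 := Finset.sum_nonneg fun _ _ => sq_nonneg _
  simp only [ite_self, zero_mul, Finset.sum_const_zero]
  linarith

/-- If the factorization breaks down in column `k + 1`, with a last pivot `p ≤ 0`, the smallest singular
value of `T̃` is at most `tol`: the Gram matrix minus `tol² I` takes the value `p` at the vector
with last entry `1` that the Cholesky factor, with last pivot replaced by zero, maps to zero. -/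
theorem IsCholesky.exists_of_breakdown (h : IsCholesky tol s k) (r1 p : ℝ)
    (h1 : s.rd k * r1 + s.ru k * s.rTop (k + 1) =
      s.tMid 0 (k + 1) * s.be (k + 1) + s.tTop 0 (k + 1) * s.tMid 0 k)
    (h2 : p = s.tTop 0 (k + 1) ^ 2 + s.tMid 0 (k + 1) ^ 2 + s.be (k + 2) ^ 2 -
      tol ^ 2 - s.rTop (k + 1) ^ 2 - r1 ^ 2)
    (hp : p ≤ 0) :
    ∃ v : ℕ → ℝ, v (k + 1) = 1 ∧ (∀ j, k + 1 < j → v j = 0) ∧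
      ∑ i ∈ Finset.range (k + 1), s.shiftedMul v (i + 1) ^ 2 ≤
        tol ^ 2 * ∑ i ∈ Finset.range (k + 1), v (i + 1) ^ 2 := by
  set rd := Function.update s.rd (k + 1) 0 with hrd
  set ru := Function.update s.ru (k + 1) r1 with hru
  have hrd' : ∀ j ≤ k, rd j = s.rd j := fun j hj => Function.update_of_ne (by omega) _ _
  have hru' : ∀ j ≤ k, ru j = s.ru j := fun j hj => Function.update_of_ne (by omega) _ _
  set v0 : ℕ → ℝ := Function.update (fun _ => 0) (k + 1) 1 with hv0
  set v := backSolve rd ru s.rTop (fun _ => 0) k v0 k with hv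
  have hvk : v (k + 1) = 1 := by
    rw [hv, backSolve_of_le _ _ _ _ _ le_rfl (by omega)]; simp [hv0]
  have hvz : ∀ j, k + 1 < j → v j = 0 := fun j hj => by
    rw [hv, backSolve_of_le _ _ _ _ _ le_rfl (by omega), hv0, Function.update_of_ne (by omega)]
  refine ⟨v, hvk, hvz, ?_⟩
  have hru1 : ru 1 = 0 := by
    rcases Nat.eq_zero_or_pos k with rfl | hk
    · rw [s.rTop_one] at h1
      simpa [hru, State.tMid, State.tTop, (h.rd_pos 0 (by omega)).ne'] using h1
    · have := h.off_diag 1 le_rfl hk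
      rw [s.rTop_one] at this
      rw [hru' 1 hk]
      simpa [State.tMid, State.tTop, (h.rd_pos 0 (by omega)).ne'] using this
  rw [sum_sq_shiftedMul (tol := tol) rd ru s.rTop p hru1 s.rTop_one s.rTop_two
    (fun j hj => by rw [hrd' _ (by omega)]; exact h.rTop_spec (by omega))
    (fun j hj => by
      rw [mul_comm (s.be _), mul_comm (s.tMid 0 j), hrd' j (by omega), hru' j (by omega)]
      rcases Nat.lt_or_eq_of_le (Nat.lt_succ_iff.1 hj) with h5 | rfl
      · rw [hru' _ (by omega)]
        exact h.off_diag (j + 1) (by omega) (by omega)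
      · rw [hru, Function.update_self]; exact h1)
    (fun j hj => by
      rcases Nat.lt_or_eq_of_le (Nat.lt_succ_iff.1 hj) with h5 | rfl
      · rw [hru' _ (by omega), hrd' _ (by omega), if_neg (by omega)]
        have := h.diag (j + 1) (by omega) (by omega)
        linarith
      · rw [if_pos rfl, hru, hrd, Function.update_self, Function.update_self, h2]
        ring) v hvz]
  have hrows : ∑ i ∈ Finset.range (k + 1), (rd (i + 1) * v (i + 1) + ru (i + 2) * v (i + 2) +
        s.rTop (i + 3) * v (i + 3)) ^ 2 = 0 := by
    refine Finset.sum_eq_zero fun i hi => ?_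
    have hi' : i < k + 1 := by simpa using hi
    rcases Nat.lt_or_eq_of_le (Nat.lt_succ_iff.1 hi') with h5 | rfl
    · have := backSolve_spec rd ru s.rTop (fun _ => 0) v0 (le_refl k)
        (fun i _ h6 => by rw [hrd' i h6]; exact (h.rd_pos i h6).ne') (i := i + 1) (by omega) h5
      rw [← hv] at this
      rw [this]; simp
    · rw [hvz (i + 2) (by omega), hvz (i + 3) (by omega), hrd, Function.update_self]; simp
  have hlast : ∑ i ∈ Finset.range (k + 1), (if i + 1 = k + 1 then p else 0) * v (i + 1) ^ 2 ≤ 0 :=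
    Finset.sum_nonpos fun i _ => mul_nonpos_of_nonpos_of_nonneg (by split_ifs <;> simp [hp])
      (sq_nonneg _)
  rw [hrows]
  linarith

end Cholesky

/-! ### A Chebyshev-type bound on the smallest singular value -/

/-- The polynomials `V j (t) = (1 - T j (1 - 2 t)) / t`, with `T j` the Chebyshev polynomials of the first
kind, by their recurrence. -/
noncomputable def chebDiff (t : ℝ) : ℕ → ℝ
  | 0 => 0
  | 1 => 2
  | j + 2 => 2 * chebDiff t (j + 1) - 4 * t * chebDiff t (j + 1) - chebDiff t j + 4

theorem chebDiff_zero (j : ℕ) : chebDiff 0 j = 2 * (j : ℝ) ^ 2 := by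
  induction j using Nat.twoStepInduction with
  | zero => simp [chebDiff]
  | one => simp [chebDiff]
  | more j ih1 ih2 => rw [chebDiff, ih1, ih2]; push_cast; ring

theorem sin_sq_mul_chebDiff (θ : ℝ) (j : ℕ) :
    Real.sin θ ^ 2 * chebDiff (Real.sin θ ^ 2) j = 2 * Real.sin (j * θ) ^ 2 := by
  induction j using Nat.twoStepInduction with
  | zero => simp [chebDiff]
  | one => simp [chebDiff]; ring
  | more j ih1 ih2 =>
    rw [chebDiff]
    have h1 : ((j + 2 : ℕ) : ℝ) * θ = ((j + 1 : ℕ) : ℝ) * θ + θ := by push_cast; ring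
    have h2 : (j : ℝ) * θ = ((j + 1 : ℕ) : ℝ) * θ - θ := by push_cast; ring
    rw [h1]
    rw [h2] at ih1
    rw [Real.sin_add]
    rw [Real.sin_sub] at ih1
    have e1 := Real.sin_sq_add_cos_sq θ
    have e2 := Real.sin_sq_add_cos_sq (((j + 1 : ℕ) : ℝ) * θ)
    set S := Real.sin (((j + 1 : ℕ) : ℝ) * θ)
    set K := Real.cos (((j + 1 : ℕ) : ℝ) * θ)
    set x := Real.sin θ
    set y := Real.cos θ
    linear_combination (2 - 4 * x ^ 2) * ih2 - ih1 - 4 * x ^ 2 * e2 - 4 * S ^ 2 * e1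

theorem chebDiff_nonneg {t : ℝ} (h0 : 0 ≤ t) (h1 : t ≤ 1) (j : ℕ) : 0 ≤ chebDiff t j := by
  rcases h0.eq_or_lt with rfl | h0'
  · rw [chebDiff_zero]; positivity
  · have ht : Real.sin (Real.arcsin √t) ^ 2 = t := by
      rw [Real.sin_arcsin (by linarith [Real.sqrt_nonneg t]) (by simpa using h1), Real.sq_sqrt h0]
    have := sin_sq_mul_chebDiff (Real.arcsin √t) j
    rw [ht] at this
    nlinarith [sq_nonneg (Real.sin (j * Real.arcsin √t))]

theorem chebDiff_add_le {t : ℝ} (h0 : 0 ≤ t) (h1 : t ≤ 1) (i j : ℕ) :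
    chebDiff t (i + j) ≤ 2 * (chebDiff t i + chebDiff t j) := by
  rcases h0.eq_or_lt with rfl | h0'
  · simp only [chebDiff_zero]; push_cast; nlinarith [sq_nonneg ((i : ℝ) - j)]
  · have ht : Real.sin (Real.arcsin √t) ^ 2 = t := by
      rw [Real.sin_arcsin (by linarith [Real.sqrt_nonneg t]) (by simpa using h1), Real.sq_sqrt h0]
    set θ := Real.arcsin √t
    have hi := sin_sq_mul_chebDiff θ i
    have hj := sin_sq_mul_chebDiff θ j
    have hij := sin_sq_mul_chebDiff θ (i + j)
    rw [ht] at hi hj hij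
    have hs : Real.sin (((i + j : ℕ) : ℝ) * θ) ^ 2 ≤
        2 * Real.sin (i * θ) ^ 2 + 2 * Real.sin (j * θ) ^ 2 := by
      rw [show ((i + j : ℕ) : ℝ) * θ = i * θ + j * θ by push_cast; ring, Real.sin_add]
      have e1 := Real.sin_sq_add_cos_sq (i * θ)
      have e2 := Real.sin_sq_add_cos_sq (j * θ)
      nlinarith [sq_nonneg (Real.sin (i * θ) * Real.cos (j * θ) -
        Real.cos (i * θ) * Real.sin (j * θ)),
        sq_nonneg (Real.sin (i * θ) * Real.sin (j * θ))]
    have : t * chebDiff t (i + j) ≤ t * (2 * (chebDiff t i + chebDiff t j)) := by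
      rw [hij, mul_left_comm, mul_add, hi, hj]; linarith
    exact le_of_mul_le_mul_left this h0'

theorem sum_mul_sub (M : ℕ) :
    ∑ j ∈ Finset.range (M + 1), (j : ℝ) * ((M : ℝ) - j) = M * ((M : ℝ) ^ 2 - 1) / 6 := by
  have h : ∀ (m : ℕ) (c : ℝ), ∑ j ∈ Finset.range (m + 1), (j : ℝ) * (c - j) =
      c * (m * (m + 1)) / 2 - m * (m + 1) * (2 * m + 1) / 6 := by
    intro m c
    induction m with
    | zero => simp
    | succ m ih => rw [Finset.sum_range_succ, ih]; push_cast; ring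
  rw [h]; ring

/-- The weights `M - j` are at least `j (M - j) / M`, and the latter are symmetric, so that
`chebDiff_add_le` applies to the pairs `j`, `M - j`. -/
theorem chebDiff_le_sum {t : ℝ} (h0 : 0 ≤ t) (h1 : t ≤ 1) {M : ℕ} (hM : 1 ≤ M) :
    ((M : ℝ) ^ 2 - 1) / 24 * chebDiff t M ≤
      ∑ j ∈ Finset.range (M + 1), ((M : ℝ) - j) * chebDiff t j := by
  have hM' : (0 : ℝ) < M := by exact_mod_cast hM
  set W := ∑ j ∈ Finset.range (M + 1), (j : ℝ) * ((M : ℝ) - j) * chebDiff t j with hW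
  have hrefl : W = ∑ j ∈ Finset.range (M + 1), (j : ℝ) * ((M : ℝ) - j) * chebDiff t (M - j) := by
    rw [hW, ← Finset.sum_range_reflect]
    refine Finset.sum_congr rfl fun j hj => ?_
    have hj' : j ≤ M := by simpa [Nat.lt_succ_iff] using hj
    rw [Nat.add_sub_cancel, Nat.cast_sub hj']
    ring
  have h2W : M * ((M : ℝ) ^ 2 - 1) / 6 * chebDiff t M ≤ 4 * W := by
    have : 4 * W = ∑ j ∈ Finset.range (M + 1),
        (j : ℝ) * ((M : ℝ) - j) * (2 * (chebDiff t j + chebDiff t (M - j))) := by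
      have e : 4 * W = 2 * (W + W) := by ring
      rw [e]
      nth_rewrite 2 [hrefl]
      rw [hW, ← Finset.sum_add_distrib, Finset.mul_sum]
      exact Finset.sum_congr rfl fun j _ => by ring
    rw [this, ← sum_mul_sub, Finset.sum_mul]
    refine Finset.sum_le_sum fun j hj => ?_
    have hj' : j ≤ M := by simpa [Nat.lt_succ_iff] using hj
    have hjr : (j : ℝ) ≤ M := by exact_mod_cast hj'
    refine mul_le_mul_of_nonneg_left ?_ (mul_nonneg (by positivity) (by linarith))
    have := chebDiff_add_le h0 h1 j (M - j)
    rwa [Nat.add_sub_cancel' hj'] at this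
  have hWS : W ≤ M * ∑ j ∈ Finset.range (M + 1), ((M : ℝ) - j) * chebDiff t j := by
    rw [hW, Finset.mul_sum]
    refine Finset.sum_le_sum fun j hj => ?_
    have hjr : (j : ℝ) ≤ M := by exact_mod_cast (by simpa [Nat.lt_succ_iff] using hj : j ≤ M)
    have := mul_nonneg (sub_nonneg.2 hjr) (chebDiff_nonneg h0 h1 j)
    nlinarith
  have : M * (((M : ℝ) ^ 2 - 1) / 24 * chebDiff t M) ≤
      M * ∑ j ∈ Finset.range (M + 1), ((M : ℝ) - j) * chebDiff t j := by
    refine le_trans ?_ hWS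
    linarith
  exact le_of_mul_le_mul_left this hM'

section Matrices

variable {n : ℕ} {A : Matrix (Fin n) (Fin n) ℝ}

/-- The square of the Euclidean norm; on `Fin n → ℝ` itself Mathlib has the sup norm. -/
theorem norm_toLp_sq (x : Fin n → ℝ) : ‖WithLp.toLp 2 x‖ ^ 2 = x ⬝ᵥ x := by
  rw [EuclideanSpace.norm_sq_eq]
  simp [dotProduct, sq]

theorem dotProduct_self_nonneg' (x : Fin n → ℝ) : 0 ≤ x ⬝ᵥ x :=
  Finset.sum_nonneg fun _ _ => mul_self_nonneg _

theorem specNorm_pos (hA : A ≠ 0) : 0 < specNorm A := by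
  rw [specNorm, norm_pos_iff]
  simpa using hA

theorem norm_mulVec_le (A : Matrix (Fin n) (Fin n) ℝ) (x : Fin n → ℝ) :
    ‖WithLp.toLp 2 (A.mulVec x)‖ ≤ specNorm A * ‖WithLp.toLp 2 x‖ := by
  have := (Matrix.toEuclideanCLM (n := Fin n) (𝕜 := ℝ) A).le_opNorm (WithLp.toLp 2 x)
  rwa [Matrix.toEuclideanCLM_toLp] at this

theorem inner_toLp (x y : Fin n → ℝ) :
    inner ℝ (WithLp.toLp 2 x) (WithLp.toLp 2 y) = x ⬝ᵥ y := by
  rw [EuclideanSpace.inner_toLp_toLp, dotProduct_comm]; simp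

/-- Comparison of norms by comparison of the coefficients in an orthonormal basis of eigenvectors. -/
theorem dotProduct_le_of_eigenvectors (hA : A.IsHermitian) (x y : Fin n → ℝ) (c : ℝ)
    (h : ∀ (l : ℝ) (u : Fin n → ℝ), u ⬝ᵥ u = 1 → A.mulVec u = l • u →
      c * (u ⬝ᵥ x) ^ 2 ≤ (u ⬝ᵥ y) ^ 2) : c * (x ⬝ᵥ x) ≤ y ⬝ᵥ y := by
  have hexp : ∀ x : Fin n → ℝ, x ⬝ᵥ x =
      ∑ i, ((hA.eigenvectorBasis i : EuclideanSpace ℝ (Fin n)).ofLp ⬝ᵥ x) ^ 2 := by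
    intro x
    rw [← norm_toLp_sq, ← hA.eigenvectorBasis.sum_sq_norm_inner_right]
    refine Finset.sum_congr rfl fun i _ => ?_
    rw [← inner_toLp]
    simp
  rw [hexp x, hexp y, Finset.mul_sum]
  refine Finset.sum_le_sum fun i _ => h (hA.eigenvalues i) _ ?_ ?_
  · rw [← norm_toLp_sq]; simp
  · exact hA.mulVec_eigenvectorBasis i

theorem eigenvalue_le_specNorm {l : ℝ} {u : Fin n → ℝ} (hu : u ⬝ᵥ u = 1)
    (h : A.mulVec u = l • u) : l ≤ specNorm A := by
  have h1 := norm_mulVec_le A u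
  have hn : ‖WithLp.toLp 2 u‖ = 1 := by
    have := norm_toLp_sq u
    rw [hu] at this
    nlinarith [norm_nonneg (WithLp.toLp 2 u)]
  rw [h, WithLp.toLp_smul, norm_smul, hn, mul_one, mul_one] at h1
  exact (le_abs_self l).trans h1

theorem eigenvalue_nonneg (hA : A.PosSemidef) {l : ℝ} {u : Fin n → ℝ} (hu : u ⬝ᵥ u = 1)
    (h : A.mulVec u = l • u) : 0 ≤ l := by
  have := hA.dotProduct_mulVec_nonneg u
  rw [h, dotProduct_smul] at this
  simpa [hu] using this

theorem dotProduct_mulVec_symm (hA : A.IsHermitian) (x y : Fin n → ℝ) :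
    x ⬝ᵥ A.mulVec y = A.mulVec x ⬝ᵥ y := by
  rw [Matrix.dotProduct_mulVec, ← Matrix.mulVec_transpose,
    show A.transpose = A from (by simpa using hA : A.IsSymm)]

/-- The vectors `V j (A / a) b` with the polynomials `V j` of `chebDiff`. -/
noncomputable def chebVec (A : Matrix (Fin n) (Fin n) ℝ) (a : ℝ) (b : Fin n → ℝ) :
    ℕ → Fin n → ℝ
  | 0 => 0
  | 1 => (2 : ℝ) • b
  | j + 2 => (2 : ℝ) • chebVec A a b (j + 1) - (4 / a) • A.mulVec (chebVec A a b (j + 1)) -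
      chebVec A a b j + (4 : ℝ) • b

theorem dotProduct_chebVec (hA : A.IsHermitian) (a : ℝ) (b : Fin n → ℝ) {l : ℝ}
    {u : Fin n → ℝ} (h : A.mulVec u = l • u) (j : ℕ) :
    u ⬝ᵥ chebVec A a b j = chebDiff (l / a) j * (u ⬝ᵥ b) := by
  induction j using Nat.twoStepInduction with
  | zero => simp [chebVec, chebDiff]
  | one => simp [chebVec, chebDiff]
  | more j ih1 ih2 =>
    rw [chebVec, chebDiff]
    simp only [dotProduct_add, dotProduct_sub, dotProduct_smul, smul_eq_mul, ih1, ih2,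
      dotProduct_mulVec_symm hA, h, smul_dotProduct]
    ring

/-- The identity `4 t ∑ⱼ (M - j) V j (t) + V M (t) = 2 M²`. -/
theorem mulVec_sum_chebVec (a : ℝ) (b : Fin n → ℝ) (M : ℕ) :
    (4 / a) • A.mulVec (∑ j ∈ Finset.range (M + 1), ((M : ℝ) - j) • chebVec A a b j) +
      chebVec A a b M = (2 * (M : ℝ) ^ 2) • b := by
  have hG : ∀ M : ℕ, (4 / a) • A.mulVec (∑ j ∈ Finset.range (M + 1), chebVec A a b j) =
      (4 * (M : ℝ) + 2) • b - chebVec A a b (M + 1) + chebVec A a b M := by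
    intro M
    induction M with
    | zero => simp [chebVec]
    | succ M ih =>
      rw [Finset.sum_range_succ, Matrix.mulVec_add, smul_add, ih, chebVec]
      push_cast
      module
  induction M with
  | zero => simp [chebVec]
  | succ M ih =>
    have : ∑ j ∈ Finset.range (M + 1 + 1), (((M + 1 : ℕ) : ℝ) - j) • chebVec A a b j =
        ∑ j ∈ Finset.range (M + 1), ((M : ℝ) - j) • chebVec A a b j +
        ∑ j ∈ Finset.range (M + 1), chebVec A a b j := by
      rw [Finset.sum_range_succ, sub_self, zero_smul, add_zero, ← Finset.sum_add_distrib]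
      refine Finset.sum_congr rfl fun j _ => ?_
      push_cast
      module
    rw [this, Matrix.mulVec_add, smul_add, hG]
    have e : (4 / a) • A.mulVec (∑ j ∈ Finset.range (M + 1), ((M : ℝ) - j) • chebVec A a b j) =
      (2 * (M : ℝ) ^ 2) • b - chebVec A a b M := by rw [← ih]; module
    rw [e]
    push_cast
    module

/-- The inequality `chebDiff_le_sum`, transferred from the spectrum of `A / ‖A‖`, which lies in `[0, 1]`,
to vectors. -/
theorem chebVec_le_sum (hA : A.PosSemidef) (hA0 : A ≠ 0) (b : Fin n → ℝ) {M : ℕ} (hM : 1 ≤ M) :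
    (((M : ℝ) ^ 2 - 1) / 24) ^ 2 *
        (chebVec A (specNorm A) b M ⬝ᵥ chebVec A (specNorm A) b M) ≤
      (∑ j ∈ Finset.range (M + 1), ((M : ℝ) - j) • chebVec A (specNorm A) b j) ⬝ᵥ
        (∑ j ∈ Finset.range (M + 1), ((M : ℝ) - j) • chebVec A (specNorm A) b j) := by
  refine dotProduct_le_of_eigenvectors hA.isHermitian _ _ _ fun l u hu h => ?_
  have hpos := specNorm_pos hA0
  have ht0 : 0 ≤ l / specNorm A := div_nonneg (eigenvalue_nonneg hA hu h) hpos.le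
  have ht1 : l / specNorm A ≤ 1 := (div_le_one hpos).2 (eigenvalue_le_specNorm hu h)
  have hsum : u ⬝ᵥ (∑ j ∈ Finset.range (M + 1), ((M : ℝ) - j) • chebVec A (specNorm A) b j) =
      (∑ j ∈ Finset.range (M + 1), ((M : ℝ) - j) * chebDiff (l / specNorm A) j) * (u ⬝ᵥ b) := by
    rw [dotProduct_sum, Finset.sum_mul]
    refine Finset.sum_congr rfl fun j _ => ?_
    rw [dotProduct_smul, dotProduct_chebVec hA.isHermitian _ _ h, smul_eq_mul, mul_assoc]
  rw [hsum, dotProduct_chebVec hA.isHermitian _ _ h, mul_pow, mul_pow, ← mul_assoc, ← mul_pow]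
  refine mul_le_mul_of_nonneg_right ?_ (sq_nonneg _)
  have hM' : (1 : ℝ) ≤ M := by exact_mod_cast hM
  exact pow_le_pow_left₀ (mul_nonneg (by nlinarith) (chebDiff_nonneg ht0 ht1 M))
    (chebDiff_le_sum ht0 ht1 hM) 2

variable {b : Fin n → ℝ} {s : State ℝ n} {k : ℕ}

theorem IsLanczos.eq_smul_q_one (h : IsLanczos A b s k) (hb : b ≠ 0) :
    b = √(b ⬝ᵥ b) • s.q 1 := by
  have : √(b ⬝ᵥ b) ≠ 0 := by
    rw [Real.sqrt_ne_zero (dotProduct_self_nonneg' b)]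
    simpa using hb
  rw [h.q_one, smul_smul, mul_inv_cancel₀ this, one_smul]

theorem IsLanczos.mulVec_mem_span (h : IsLanczos A b s (k + 1)) {j : ℕ} (hj : j ≤ k)
    {x : Fin n → ℝ} (hx : x ∈ Submodule.span ℝ (s.q '' Set.Icc 1 j)) :
    A.mulVec x ∈ Submodule.span ℝ (s.q '' Set.Icc 1 (j + 1)) := by
  induction hx using Submodule.span_induction with
  | mem x hx =>
    obtain ⟨i, ⟨h1, h2⟩, rfl⟩ := hx
    rw [h.recurrence i h1 (by omega)]
    have hmem : ∀ l, 1 ≤ l → l ≤ j + 1 →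
        s.q l ∈ Submodule.span ℝ (s.q '' Set.Icc 1 (j + 1)) := fun l h3 h4 =>
      Submodule.subset_span ⟨l, ⟨h3, h4⟩, rfl⟩
    refine add_mem (add_mem (Submodule.smul_mem _ _ (hmem _ (by omega) (by omega)))
      (Submodule.smul_mem _ _ (hmem _ h1 (by omega)))) (Submodule.smul_mem _ _ ?_)
    rcases Nat.eq_zero_or_pos (i - 1) with h0 | h0
    · rw [h0, h.q_zero]; exact zero_mem _
    · exact hmem _ h0 (by omega)
  | zero => rw [Matrix.mulVec_zero]; exact zero_mem _
  | add x y _ _ hx hy => rw [Matrix.mulVec_add]; exact add_mem hx hy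
  | smul c x _ hx => rw [Matrix.mulVec_smul]; exact Submodule.smul_mem _ _ hx

theorem IsLanczos.chebVec_mem_span (h : IsLanczos A b s (k + 1)) (hb : b ≠ 0) (a : ℝ) (j : ℕ)
    (hj : j ≤ k + 1) : chebVec A a b j ∈ Submodule.span ℝ (s.q '' Set.Icc 1 j) := by
  have hmono : ∀ {i j : ℕ}, i ≤ j → ∀ {x : Fin n → ℝ},
      x ∈ Submodule.span ℝ (s.q '' Set.Icc 1 i) → x ∈ Submodule.span ℝ (s.q '' Set.Icc 1 j) :=
    fun hij _ hx => Submodule.span_mono (Set.image_mono (Set.Icc_subset_Icc_right hij)) hx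
  have hbm : b ∈ Submodule.span ℝ (s.q '' Set.Icc 1 1) := by
    rw [h.eq_smul_q_one hb]
    exact Submodule.smul_mem _ _ (Submodule.subset_span ⟨1, by simp, rfl⟩)
  induction j using Nat.twoStepInduction with
  | zero => simp [chebVec]
  | one => exact Submodule.smul_mem _ _ hbm
  | more j ih1 ih2 =>
    rw [chebVec]
    refine add_mem (sub_mem (sub_mem ?_ ?_) ?_) ?_
    · exact Submodule.smul_mem _ _ (hmono (by omega) (ih2 (by omega)))
    · exact Submodule.smul_mem _ _ (h.mulVec_mem_span (by omega) (ih2 (by omega)))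
    · exact hmono (by omega) (ih1 (by omega))
    · exact Submodule.smul_mem _ _ (hmono (by omega) hbm)

theorem exists_coeff_of_mem_span (q : ℕ → Fin n → ℝ) {k : ℕ} {x : Fin n → ℝ}
    (hx : x ∈ Submodule.span ℝ (q '' Set.Icc 1 k)) :
    ∃ v : ℕ → ℝ, (∀ j, k < j → v j = 0) ∧
      x = ∑ j ∈ Finset.range k, v (j + 1) • q (j + 1) := by
  rw [show Set.Icc 1 k = ((Finset.range k).image (· + 1) : Finset ℕ) by
    ext j; simp only [Set.mem_Icc, Finset.coe_image, Finset.coe_range, Set.mem_image, Set.mem_Iio]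
    constructor
    · exact fun h => ⟨j - 1, by omega, by omega⟩
    · rintro ⟨i, hi, rfl⟩; omega] at hx
  obtain ⟨c, hc⟩ := (Submodule.mem_span_image_finset_iff_exists_fun' ℝ).1 hx
  refine ⟨fun j => if j ≤ k then c j else 0, fun j hj => if_neg (by omega), ?_⟩
  rw [← hc, Finset.sum_image (by simp)]
  refine Finset.sum_congr rfl fun j hj => ?_
  have hj' : j + 1 ≤ k := Finset.mem_range.1 hj
  simp only [hj', if_true]

/-- After `k` Lanczos steps the smallest singular value of `T̃` is at most `6 ‖A‖ / (k (k + 2))`. -/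
theorem IsLanczos.exists_small (h : IsLanczos A b s (k + 1)) (hA : A.PosSemidef) (hA0 : A ≠ 0)
    (hb : b ≠ 0) (hk : 1 ≤ k) :
    ∃ v : ℕ → ℝ, (∀ j, k < j → v j = 0) ∧ 0 < ∑ i ∈ Finset.range k, v (i + 1) ^ 2 ∧
      ∑ i ∈ Finset.range k, s.shiftedMul v (i + 1) ^ 2 ≤
        (6 * specNorm A / (k * (k + 2))) ^ 2 * ∑ i ∈ Finset.range k, v (i + 1) ^ 2 := by
  set a := specNorm A with ha
  have hpos : 0 < a := specNorm_pos hA0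
  have hkr : (1 : ℝ) ≤ k := by exact_mod_cast hk
  set y := ∑ j ∈ Finset.range (k + 1 + 1), (((k + 1 : ℕ) : ℝ) - j) • chebVec A a b j with hy
  have hmem : y ∈ Submodule.span ℝ (s.q '' Set.Icc 1 k) := by
    rw [hy, Finset.sum_range_succ, sub_self, zero_smul, add_zero]
    refine Submodule.sum_mem _ fun j hj => Submodule.smul_mem _ _ ?_
    have hj' : j ≤ k := by simpa [Nat.lt_succ_iff] using hj
    exact Submodule.span_mono (Set.image_mono (Set.Icc_subset_Icc_right hj'))
      (h.chebVec_mem_span hb a j (by omega))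
  obtain ⟨v, hvz, hv⟩ := exists_coeff_of_mem_span s.q hmem
  have hrec : ∀ j, 1 ≤ j → j ≤ k →
      A.mulVec (s.q j) = s.be (j + 1) • s.q (j + 1) + s.al j • s.q j + s.be j • s.q (j - 1) :=
    fun j h1 h2 => h.recurrence j h1 (by omega)
  have hk' : IsLanczos A b s k := ⟨h.q_zero, h.be_one, h.q_one, fun j h1 h2 => h.be_pos j h1
    (by omega), fun i j h1 h2 h3 h4 => h.orth i j h1 (by omega) h3 (by omega),
    fun j h1 h2 => h.recurrence j h1 (by omega)⟩
  have hAy := mulVec_comb h.q_zero hrec v hvz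
  rw [← hv] at hAy
  have hyy : y ⬝ᵥ y = ∑ i ∈ Finset.range k, v (i + 1) ^ 2 := by
    rw [hv]; exact hk'.dotProduct_comb v
  have hid := mulVec_sum_chebVec (A := A) a b (k + 1)
  rw [← hy] at hid
  have hle := chebVec_le_sum hA hA0 b (M := k + 1) (by omega)
  rw [← ha, ← hy] at hle
  set V := chebVec A a b (k + 1)
  have hM : ((((k + 1 : ℕ) : ℝ) ^ 2 - 1) / 24) = k * (k + 2) / 24 := by push_cast; ring
  rw [hM] at hle
  refine ⟨v, hvz, ?_, ?_⟩
  · rw [← hyy]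
    refine (dotProduct_self_nonneg' y).lt_of_ne fun h0 => hb ?_
    have hy0 : y = 0 := by simpa using h0.symm
    have hV0 : V = 0 := by
      rw [← h0] at hle
      have h1 : (0 : ℝ) < (k * (k + 2) / 24) ^ 2 := by positivity
      have h2 : V ⬝ᵥ V ≤ 0 := by nlinarith
      simpa using le_antisymm h2 (dotProduct_self_nonneg' V)
    rw [hy0, hV0, Matrix.mulVec_zero, smul_zero, add_zero] at hid
    have : (2 * ((k + 1 : ℕ) : ℝ) ^ 2) ≠ 0 := by positivity
    exact (smul_eq_zero.1 hid.symm).resolve_left this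
  · -- `T̃ v` consists of the coefficients of `A y - c b` with respect to `q 2, …, q (k + 1)`.
    set c : ℝ := a / 4 * (2 * ((k + 1 : ℕ) : ℝ) ^ 2) with hc
    set u : ℕ → ℝ := fun j => if j = 1 then s.al 1 * v 1 + s.be 2 * v 2 - c * √(b ⬝ᵥ b)
      else s.shiftedMul v (j - 1) with hu
    have hcomb : (-(a / 4)) • V = ∑ j ∈ Finset.range (k + 1), u (j + 1) • s.q (j + 1) := by
      have h1 : (-(a / 4)) • V = A.mulVec y - c • b := by
        have h2 : (a / 4) • ((4 / a) • A.mulVec y + V) = c • b := by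
          rw [hid, smul_smul]
        rw [smul_add, smul_smul, show a / 4 * (4 / a) = 1 by field_simp, one_smul] at h2
        rw [← h2]; module
      rw [h1, hAy, Finset.sum_range_succ']
      have h3 : c • b = (c * √(b ⬝ᵥ b)) • s.q 1 := by
        conv_lhs => rw [h.eq_smul_q_one hb]
        rw [smul_smul]
      rw [h3]
      simp only [hu, if_true, Nat.add_sub_cancel, zero_add,
        show ∀ i : ℕ, i + 1 + 1 ≠ 1 from fun i => by omega, if_false]
      module
    have hn := h.dotProduct_comb u
    rw [← hcomb, Finset.sum_range_succ'] at hn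
    simp only [hu, if_true, Nat.add_sub_cancel, zero_add,
        show ∀ i : ℕ, i + 1 + 1 ≠ 1 from fun i => by omega, if_false] at hn
    have h4 : ∑ i ∈ Finset.range k, s.shiftedMul v (i + 1) ^ 2 ≤ (a / 4) ^ 2 * (V ⬝ᵥ V) := by
      have h5 : ((-(a / 4)) • V) ⬝ᵥ ((-(a / 4)) • V) = (a / 4) ^ 2 * (V ⬝ᵥ V) := by
        rw [smul_dotProduct, dotProduct_smul]; simp only [smul_eq_mul]; ring
      rw [← h5, hn]
      linarith [sq_nonneg (s.al 1 * v 1 + s.be 2 * v 2 - c * √(b ⬝ᵥ b))]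
    rw [← hyy]
    refine h4.trans ?_
    have h6 : (6 * a / (k * (k + 2))) ^ 2 * ((k * (k + 2) / 24) ^ 2 * (V ⬝ᵥ V)) =
        (a / 4) ^ 2 * (V ⬝ᵥ V) := by
      field_simp
      ring
    rw [← h6]
    exact mul_le_mul_of_nonneg_left hle (sq_nonneg _)

end Matrices

/-! ### The main loop -/

section Loop

variable {n : ℕ} {A : Matrix (Fin n) (Fin n) ℝ} {b : Fin n → ℝ} {s : State ℝ n} {k T : ℕ}
  {tol : ℝ} {mv : (Fin n → ℝ) → Prog ℝ (Fin n → ℝ)}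

theorem lanczosStep_costs (hmv : MultipliesBy mv A T) (k : ℕ) (s : State ℝ n) {a : ℝ}
    {w' w : Fin n → ℝ} (hw' : w' = A.mulVec (s.q k) - s.be k • s.q (k - 1))
    (ha : a = w' ⬝ᵥ s.q k) (hw : w = w' - a • s.q k) :
    Costs (lanczosStep mv k s)
      ({ s with al := Function.update s.al k a, be := Function.update s.be (k + 1) √(w ⬝ᵥ w) }, w)
      (T + 8 * n + 3) := by
  subst hw' ha hw
  have h1 : Costs (mv (s.q k)) (A.mulVec (s.q k)) T := fun ω s' => hmv _ ω s'
  refine Costs.mono (C := T + (n * 2 + (n * 2 + 1 + (n * 2 + (n * 2 + 2 + 0))))) ?_ (by omega)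
  refine h1.bind ((Costs.subMul _ _ _).bind ((Costs.dot _ _).bind ((Costs.subMul _ _ _).bind ?_)))
  refine (Costs.norm _).bind ?_
  exact Costs.pure _

/-- The new off-diagonal entry of the Cholesky factor in column `k`. -/
noncomputable def State.rMid (s : State ℝ n) (k : ℕ) : ℝ :=
  (s.tMid 0 k * s.be k + s.tTop 0 k * s.tMid 0 (k - 1) - s.ru (k - 1) * s.rTop k) / s.rd (k - 1)

/-- The pivot in column `k`. -/
noncomputable def State.pivot (s : State ℝ n) (tol : ℝ) (k : ℕ) : ℝ :=
  s.tTop 0 k * s.tTop 0 k + s.tMid 0 k * s.tMid 0 k + s.be (k + 1) * s.be (k + 1) - tol * tol -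
    s.rTop k * s.rTop k - s.rMid k * s.rMid k

theorem choleskyStep_costs_of_pos (h2 : s.rd (k - 2) ≠ 0) (h1 : s.rd (k - 1) ≠ 0)
    (hp : 0 < s.pivot tol k) :
    Costs (choleskyStep 0 tol k s)
      ({ s with rd := Function.update s.rd k √(s.pivot tol k),
                ru := Function.update s.ru k (s.rMid k) }, Status.unfinished) 21 := by
  unfold choleskyStep
  refine Costs.bind_one (Costs.mul _ _) ?_
  refine Costs.bind_one (Costs.mul _ _) ?_
  refine Costs.bind_one (Costs.mul _ _) ?_
  refine Costs.bind_one (Costs.add _ _) ?_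
  refine Costs.bind_one (Costs.mul _ _) ?_
  refine Costs.bind_one (Costs.mul _ _) ?_
  refine Costs.bind_one (Costs.mul _ _) ?_
  refine Costs.bind_one (Costs.add _ _) ?_
  refine Costs.bind_one (Costs.add _ _) ?_
  refine Costs.bind_one (Costs.div _ h2) ?_
  refine Costs.bind_one (Costs.mul _ _) ?_
  refine Costs.bind_one (Costs.sub _ _) ?_
  refine Costs.bind_one (Costs.div _ h1) ?_
  refine Costs.bind_one (Costs.mul _ _) ?_
  refine Costs.bind_one (Costs.mul _ _) ?_
  refine Costs.bind_one (Costs.mul _ _) ?_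
  refine Costs.bind_one (Costs.sub _ _) ?_
  refine Costs.bind_one (Costs.sub _ _) ?_
  refine Costs.bind_one (Costs.sub _ _) ?_
  refine Costs.bind_one (Costs.lt_of_lt hp) ?_
  rw [if_pos rfl]
  refine Costs.bind_one (Costs.sqrt hp.le) ?_
  exact Costs.pure _

theorem choleskyStep_costs_of_not_pos (h2 : s.rd (k - 2) ≠ 0) (h1 : s.rd (k - 1) ≠ 0)
    (hp : ¬ 0 < s.pivot tol k) :
    Costs (choleskyStep 0 tol k s) (s, Status.converged) 21 := by
  refine Costs.mono (C := 20) ?_ (by norm_num)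
  unfold choleskyStep
  refine Costs.bind_one (Costs.mul _ _) ?_
  refine Costs.bind_one (Costs.mul _ _) ?_
  refine Costs.bind_one (Costs.mul _ _) ?_
  refine Costs.bind_one (Costs.add _ _) ?_
  refine Costs.bind_one (Costs.mul _ _) ?_
  refine Costs.bind_one (Costs.mul _ _) ?_
  refine Costs.bind_one (Costs.mul _ _) ?_
  refine Costs.bind_one (Costs.add _ _) ?_
  refine Costs.bind_one (Costs.add _ _) ?_
  refine Costs.bind_one (Costs.div _ h2) ?_
  refine Costs.bind_one (Costs.mul _ _) ?_
  refine Costs.bind_one (Costs.sub _ _) ?_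
  refine Costs.bind_one (Costs.div _ h1) ?_
  refine Costs.bind_one (Costs.mul _ _) ?_
  refine Costs.bind_one (Costs.mul _ _) ?_
  refine Costs.bind_one (Costs.mul _ _) ?_
  refine Costs.bind_one (Costs.sub _ _) ?_
  refine Costs.bind_one (Costs.sub _ _) ?_
  refine Costs.bind_one (Costs.sub _ _) ?_
  refine Costs.bind_one (Costs.lt_of_not_lt hp) ?_
  exact Costs.pure _

/-- What is known after iteration `k`, depending on how it ended. -/
def Outcome (A : Matrix (Fin n) (Fin n) ℝ) (b : Fin n → ℝ) (tol : ℝ) (s : State ℝ n) (k : ℕ) :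
    Status → Prop
  | .exhausted => IsLanczos A b s k ∧ s.be (k + 1) = 0 ∧
      A.mulVec (s.q k) = s.al k • s.q k + s.be k • s.q (k - 1)
  | .converged => IsLanczos A b s (k + 1) ∧ ∃ v : ℕ → ℝ, (∀ j, k < j → v j = 0) ∧
      0 < ∑ i ∈ Finset.range k, v (i + 1) ^ 2 ∧
      ∑ i ∈ Finset.range k, s.shiftedMul v (i + 1) ^ 2 ≤
        tol ^ 2 * ∑ i ∈ Finset.range k, v (i + 1) ^ 2
  | .unfinished => IsLanczos A b s (k + 1) ∧ IsCholesky tol s k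

theorem choleskyStep_outcome (hL : IsLanczos A b s (k + 2)) (hC : IsCholesky tol s k) :
    ∃ s' st, Costs (choleskyStep 0 tol (k + 1) s) (s', st) 21 ∧
      Outcome A b tol s' (k + 1) st := by
  have hd2 : s.rd (k + 1 - 2) ≠ 0 := (hC.rd_pos _ (by omega)).ne'
  have hd1 : s.rd (k + 1 - 1) ≠ 0 := (hC.rd_pos _ (by omega)).ne'
  have hoff : s.rd k * s.rMid (k + 1) + s.ru k * s.rTop (k + 1) =
      s.tMid 0 (k + 1) * s.be (k + 1) + s.tTop 0 (k + 1) * s.tMid 0 k := by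
    rw [State.rMid, Nat.add_sub_cancel] at *
    field_simp
    ring
  by_cases hp : 0 < s.pivot tol (k + 1)
  · refine ⟨_, _, choleskyStep_costs_of_pos hd2 hd1 hp, ?_⟩
    set s' : State ℝ n := { s with
      rd := Function.update s.rd (k + 1) √(s.pivot tol (k + 1))
      ru := Function.update s.ru (k + 1) (s.rMid (k + 1)) } with hs'
    have hrd : ∀ j ≤ k, s'.rd j = s.rd j := fun j hj => Function.update_of_ne (by omega) _ _
    have hru : ∀ j ≤ k, s'.ru j = s.ru j := fun j hj => Function.update_of_ne (by omega) _ _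
    have hrd1 : s'.rd (k + 1) = √(s.pivot tol (k + 1)) := Function.update_self ..
    have hru1 : s'.ru (k + 1) = s.rMid (k + 1) := Function.update_self ..
    have hr2 : s'.rTop (k + 1) = s.rTop (k + 1) := by
      rw [State.rTop, hrd _ (by omega)]; rfl
    refine ⟨hL.congr (by omega) (fun _ _ => rfl) (fun _ _ => rfl) (fun _ _ => rfl),
      (hC.congr (s' := s') (fun _ _ => rfl) (fun _ _ => rfl) hrd hru).succ ?_ ?_ ?_⟩
    · rw [hrd1]; exact Real.sqrt_pos.2 hp
    · rw [hrd k le_rfl, hru k le_rfl, hru1, hr2]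
      exact hoff
    · rw [hrd1, hru1, hr2, Real.sq_sqrt hp.le, State.pivot]
      change _ = s.tTop 0 (k + 1) ^ 2 + s.tMid 0 (k + 1) ^ 2 + s.be (k + 2) ^ 2
      ring
  · refine ⟨_, _, choleskyStep_costs_of_not_pos hd2 hd1 hp, hL, ?_⟩
    obtain ⟨v, hv1, hvz, hv⟩ := hC.exists_of_breakdown (s.rMid (k + 1)) (s.pivot tol (k + 1)) hoff
      (by rw [State.pivot]; ring) (not_lt.1 hp)
    refine ⟨v, hvz, ?_, hv⟩
    rw [Finset.sum_range_succ, hv1]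
    have : 0 ≤ ∑ i ∈ Finset.range k, v (i + 1) ^ 2 := Finset.sum_nonneg fun _ _ => sq_nonneg _
    linarith

theorem krylovStep_outcome (hA : A.IsHermitian) (hmv : MultipliesBy mv A T)
    (hL : IsLanczos A b s (k + 1)) (hC : IsCholesky tol s k) :
    ∃ s' st, Costs (krylovStep mv 0 tol (k + 1) s) (s', st) (T + 9 * n + 25) ∧
      Outcome A b tol s' (k + 1) st := by
  set w' := A.mulVec (s.q (k + 1)) - s.be (k + 1) • s.q (k + 1 - 1) with hw'
  set a := w' ⬝ᵥ s.q (k + 1) with ha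
  set w := w' - a • s.q (k + 1) with hw
  have horth := hL.residual_orth hA (by omega) hw' hw
  set s1 : State ℝ n := { s with
    al := Function.update s.al (k + 1) a
    be := Function.update s.be (k + 1 + 1) √(w ⬝ᵥ w) } with hs1
  have hstep : Costs (lanczosStep mv (k + 1) s) (s1, w) (T + 8 * n + 3) :=
    lanczosStep_costs hmv (k + 1) s hw' ha hw
  have hal : ∀ j ≤ k, s1.al j = s.al j := fun j hj => Function.update_of_ne (by omega) _ _
  have hal1 : s1.al (k + 1) = a := Function.update_self ..
  have hbe : ∀ j ≤ k + 1, s1.be j = s.be j := fun j hj => Function.update_of_ne (by omega) _ _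
  have hbe1 : s1.be (k + 2) = √(w ⬝ᵥ w) := Function.update_self ..
  have hL1 : IsLanczos A b s1 (k + 1) := hL.congr (by omega) (fun _ _ => rfl)
    (fun j hj => hal j (by omega)) hbe
  have hC1 : IsCholesky tol s1 k := hC.congr hal hbe (fun _ _ => rfl) (fun _ _ => rfl)
  have hAq : A.mulVec (s1.q (k + 1)) =
      w + s1.al (k + 1) • s1.q (k + 1) + s1.be (k + 1) • s1.q (k + 1 - 1) := by
    rw [hal1, hbe (k + 1) le_rfl, hw, hw']
    change A.mulVec (s.q (k + 1)) = _ + a • s.q (k + 1) + s.be (k + 1) • s.q (k + 1 - 1)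
    abel
  by_cases hpos : 0 < s1.be (k + 2)
  · have hne := hpos.ne'
    set s2 : State ℝ n :=
      { s1 with q := Function.update s1.q (k + 2) ((s1.be (k + 2))⁻¹ • w) } with hs2
    have hq : ∀ j ≤ k + 1, s2.q j = s1.q j := fun j hj => Function.update_of_ne (by omega) _ _
    have hq2 : s2.q (k + 2) = (s1.be (k + 2))⁻¹ • w := Function.update_self ..
    have hL2 : IsLanczos A b s2 (k + 1) :=
      hL1.congr (by omega) hq (fun _ _ => rfl) (fun _ _ => rfl)
    have hww : w ⬝ᵥ w = s1.be (k + 2) ^ 2 := by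
      rw [hbe1, Real.sq_sqrt (dotProduct_self_nonneg' w)]
    have hL3 : IsLanczos A b s2 (k + 2) := by
      refine hL2.succ hpos (fun j h1 h2 => ?_) ?_ ?_
      · rw [hq2, hq j h2, smul_dotProduct]
        have : w ⬝ᵥ s1.q j = 0 := horth j h1 h2
        rw [this, smul_zero]
      · rw [hq2, smul_dotProduct, dotProduct_smul, hww]
        simp only [smul_eq_mul]
        field_simp
      · rw [hq2, hq (k + 1) le_rfl, hq (k + 1 - 1) (by omega), hAq]
        change _ = s1.be (k + 2) • (s1.be (k + 2))⁻¹ • w + s1.al (k + 1) • _ + s1.be (k + 1) • _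
        rw [smul_smul, mul_inv_cancel₀ hne, one_smul]
    have hC2 : IsCholesky tol s2 k := hC1.congr (fun _ _ => rfl) (fun _ _ => rfl)
      (fun _ _ => rfl) (fun _ _ => rfl)
    obtain ⟨s', st, hcost, hout⟩ := choleskyStep_outcome hL3 hC2
    refine ⟨s', st, ?_, hout⟩
    refine (hstep.bind (C := T + 8 * n + 3) (D := 1 + (n * 1 + 21)) ?_).mono (by omega)
    refine (Costs.lt_of_lt hpos).bind ?_
    exact (Costs.divBy w hne).bind hcost
  · refine ⟨s1, .exhausted, ?_, hL1, ?_, ?_⟩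
    · refine (hstep.bind (C := T + 8 * n + 3) (D := 1 + 0) ?_).mono (by omega)
      exact (Costs.lt_of_not_lt hpos).bind (Costs.pure _)
    · exact le_antisymm (not_lt.1 hpos) (by rw [hbe1]; exact Real.sqrt_nonneg _)
    · have hw0 : w = 0 := by
        have h0 : √(w ⬝ᵥ w) = 0 :=
          le_antisymm (by rw [← hbe1]; exact not_lt.1 hpos) (Real.sqrt_nonneg _)
        rw [Real.sqrt_eq_zero (dotProduct_self_nonneg' w)] at h0
        simpa using h0
      rw [hAq, hw0, zero_add]

/-- The state `s''` is the one before the last iteration `k' + 1`: it bounds the number of iterations, since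
the factorization has not yet broken down there. -/
theorem krylovLoop_outcome (hA : A.IsHermitian) (hmv : MultipliesBy mv A T) :
    ∀ (m k : ℕ) (s : State ℝ n), IsLanczos A b s (k + 1) → IsCholesky tol s k →
    ∃ s' st k', Costs (krylovLoop mv 0 tol m (k + 1) s) (s', st, k' + 1)
        ((k' + 1 - k) * (T + 9 * n + 25)) ∧
      k ≤ k' ∧ (st = .unfinished → k' = k + m) ∧ Outcome A b tol s' (k' + 1) st ∧
      ∃ s'', IsLanczos A b s'' (k' + 1) ∧ IsCholesky tol s'' k'
  | 0, k, s, hL, hC => by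
    obtain ⟨s', st, hcost, hout⟩ := krylovStep_outcome hA hmv hL hC
    refine ⟨s', st, k, ?_, le_rfl, fun _ => rfl, hout, s, hL, hC⟩
    rw [Nat.add_sub_cancel_left, one_mul]
    refine Costs.bind (C := T + 9 * n + 25) (D := 0) hcost ?_
    exact Costs.pure _
  | m + 1, k, s, hL, hC => by
    obtain ⟨s1, st, hcost, hout⟩ := krylovStep_outcome hA hmv hL hC
    cases st with
    | unfinished =>
      obtain ⟨s', st, k', hcost', hk, hu, hout', hprev⟩ :=
        krylovLoop_outcome hA hmv m (k + 1) s1 hout.1 hout.2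
      refine ⟨s', st, k', ?_, by omega, fun h => by rw [hu h]; omega, hout', hprev⟩
      refine (hcost.bind (C := T + 9 * n + 25) (f := _) hcost').mono ?_
      rw [show k' + 1 - k = (k' + 1 - (k + 1)) + 1 by omega, Nat.succ_mul (k' + 1 - (k + 1)),
        add_comm]
    | exhausted =>
      refine ⟨s1, _, k, ?_, le_rfl, fun h => (by simp at h), hout, s, hL, hC⟩
      rw [Nat.add_sub_cancel_left, one_mul]
      refine Costs.bind (C := T + 9 * n + 25) (D := 0) hcost ?_
      exact Costs.pure _
    | converged =>
      refine ⟨s1, _, k, ?_, le_rfl, fun h => (by simp at h), hout, s, hL, hC⟩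
      rw [Nat.add_sub_cancel_left, one_mul]
      refine Costs.bind (C := T + 9 * n + 25) (D := 0) hcost ?_
      exact Costs.pure _

/-- The factorization has broken down at the latest when `6 / (k (k + 2))` falls below `tol / ‖A‖`. -/
theorem IsCholesky.lt_of_tol (hA : A.PosSemidef) (hA0 : A ≠ 0) (hb : b ≠ 0)
    (hL : IsLanczos A b s (k + 1)) (hC : IsCholesky tol s k) {ε : ℝ} (hε : 0 < ε)
    (htol : tol = 2 / 3 * ε * specNorm A) : (k : ℝ) < 3 / √ε := by
  by_contra hcon
  have hsε := Real.sqrt_pos.2 hε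
  have hk3 : 3 / √ε ≤ k := not_lt.1 hcon
  have hkpos : (0 : ℝ) < k := lt_of_lt_of_le (by positivity) hk3
  have hk1 : 1 ≤ k := by exact_mod_cast hkpos
  have hpos := specNorm_pos hA0
  obtain ⟨v, hvz, hv0, hv⟩ := hL.exists_small hA hA0 hb hk1
  have hle := hC.le_sum_sq v hvz
  have hk9 : 9 ≤ ε * (k : ℝ) ^ 2 := by
    have h1 : 3 ≤ k * √ε := (div_le_iff₀ hsε).1 hk3
    have h2 : ε = √ε ^ 2 := (Real.sq_sqrt hε.le).symm
    rw [h2]; nlinarith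
  have hlt : 6 * specNorm A / (k * (k + 2)) < tol := by
    rw [div_lt_iff₀ (by positivity), htol]
    have h1 : 6 < 2 / 3 * ε * (k * (k + 2)) := by nlinarith [mul_pos hε hkpos]
    nlinarith
  have h2 : (6 * specNorm A / (k * (k + 2))) ^ 2 < tol ^ 2 :=
    pow_lt_pow_left₀ hlt (by positivity) two_ne_zero
  have := mul_lt_mul_of_pos_right h2 hv0
  linarith

end Loop

/-! ### The Gaussian starting vector -/

section Gaussian

/-- The first `k` random numbers as a vector. -/
noncomputable def gaussVec (k : ℕ) (ω : ℕ → ℝ) : EuclideanSpace ℝ (Fin k) :=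
  WithLp.toLp 2 fun i => ω i

theorem measurable_gaussVec (k : ℕ) : Measurable (gaussVec k) := by
  unfold gaussVec; fun_prop

theorem map_gaussVec (k : ℕ) :
    gaussianStream.map (gaussVec k) = stdGaussian (EuclideanSpace ℝ (Fin k)) := by
  have h := Measure.map_infinitePi_infinitePi_of_inj (P := fun _ : ℕ => gaussianReal 0 1)
    (f := fun i : Fin k => (i : ℕ)) Fin.val_injective
  rw [← map_pi_eq_stdGaussian, ← Measure.infinitePi_eq_pi, ← h, Measure.map_map (by fun_prop)
    (by fun_prop)]
  rfl

theorem map_inner_gaussVec {k : ℕ} (u : EuclideanSpace ℝ (Fin k)) :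
    gaussianStream.map (fun ω => inner ℝ u (gaussVec k ω)) =
      gaussianReal 0 (‖u‖ ^ 2).toNNReal := by
  have h := IsGaussian.map_eq_gaussianReal (μ := stdGaussian (EuclideanSpace ℝ (Fin k)))
    (innerSL ℝ u)
  rw [variance_dual_stdGaussian, integral_strongDual_stdGaussian, ← map_gaussVec,
    Measure.map_map (by fun_prop) (measurable_gaussVec k), innerSL_apply_norm] at h
  exact h

theorem measurable_inner_gaussVec {k : ℕ} (u : EuclideanSpace ℝ (Fin k)) :
    Measurable fun ω => inner ℝ u (gaussVec k ω) :=
  (innerSL ℝ u).continuous.measurable.comp (measurable_gaussVec k)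

theorem gaussianStream_inner_eq_zero {k : ℕ} {w : EuclideanSpace ℝ (Fin k)} (hw : w ≠ 0) :
    gaussianStream {ω | inner ℝ w (gaussVec k ω) = 0} = 0 := by
  have h : gaussianStream {ω | inner ℝ w (gaussVec k ω) = 0} =
      gaussianStream.map (fun ω => inner ℝ w (gaussVec k ω)) {0} := by
    rw [Measure.map_apply (measurable_inner_gaussVec w) (measurableSet_singleton 0)]; rfl
  have hv : (‖w‖ ^ 2).toNNReal ≠ 0 := by
    have : 0 < ‖w‖ := norm_pos_iff.2 hw
    rw [Ne, Real.toNNReal_eq_zero, not_le]; positivity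
  have := nullSingletonClass_gaussianReal (μ := 0) hv
  rw [h, map_inner_gaussVec, measure_singleton]

theorem gaussianPDFReal_le (x : ℝ) : gaussianPDFReal 0 1 x ≤ 2 / 5 := by
  rw [gaussianPDFReal]
  have h1 : (5 / 2 : ℝ) ≤ √(2 * Real.pi * ((1 : NNReal) : ℝ)) := by
    apply Real.le_sqrt_of_sq_le
    have := Real.pi_gt_d2
    simp only [NNReal.coe_one]
    nlinarith
  have h2 : (√(2 * Real.pi * ((1 : NNReal) : ℝ)))⁻¹ ≤ 2 / 5 := by
    rw [show (2 / 5 : ℝ) = (5 / 2)⁻¹ by norm_num]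
    exact inv_anti₀ (by norm_num) h1
  have h3 : Real.exp (-(x - 0) ^ 2 / (2 * ((1 : NNReal) : ℝ))) ≤ 1 := by
    rw [Real.exp_le_one_iff]
    simp only [NNReal.coe_one]
    nlinarith [sq_nonneg x]
  calc _ ≤ (2 / 5 : ℝ) * 1 := mul_le_mul h2 h3 (Real.exp_nonneg _) (by norm_num)
    _ = _ := by norm_num

theorem gaussianStream_abs_inner_le {k : ℕ} {u : EuclideanSpace ℝ (Fin k)} (hu : ‖u‖ = 1)
    (r : ℝ) :
    gaussianStream {ω | |inner ℝ u (gaussVec k ω)| ≤ r} ≤ ENNReal.ofReal (4 / 5 * r) := by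
  have h : gaussianStream {ω | |inner ℝ u (gaussVec k ω)| ≤ r} =
      gaussianStream.map (fun ω => inner ℝ u (gaussVec k ω)) (Set.Icc (-r) r) := by
    rw [Measure.map_apply (measurable_inner_gaussVec u) measurableSet_Icc]
    congr 1
    ext ω
    exact abs_le (a := inner ℝ u (gaussVec k ω)) (b := r)
  rw [h, map_inner_gaussVec, hu, one_pow, Real.toNNReal_one, gaussianReal_apply 0 one_ne_zero]
  calc ∫⁻ x in Set.Icc (-r) r, gaussianPDF 0 1 x
      ≤ ∫⁻ _ in Set.Icc (-r) r, ENNReal.ofReal (2 / 5) :=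
        lintegral_mono fun x => ENNReal.ofReal_le_ofReal (gaussianPDFReal_le x)
    _ = ENNReal.ofReal (4 / 5 * r) := by
        rw [setLIntegral_const, Real.volume_Icc, ← ENNReal.ofReal_mul (by norm_num)]
        congr 1; ring

theorem lintegral_gaussianStream_sq (i : ℕ) :
    ∫⁻ ω, ENNReal.ofReal (ω i ^ 2) ∂gaussianStream = 1 := by
  have hmap : gaussianStream.map (fun ω : ℕ → ℝ => ω i) = gaussianReal 0 1 :=
    Measure.infinitePi_map_eval (fun _ : ℕ => gaussianReal 0 1) i
  have h1 : ∫⁻ ω, ENNReal.ofReal (ω i ^ 2) ∂gaussianStream =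
      ∫⁻ x, ENNReal.ofReal (x ^ 2) ∂gaussianReal 0 1 := by
    rw [← hmap, lintegral_map (by fun_prop) (by fun_prop)]
  have hint : Integrable (fun x : ℝ => x ^ 2) (gaussianReal 0 1) :=
    (memLp_id_gaussianReal' 2 (by simp)).integrable_sq
  rw [h1, ← ofReal_integral_eq_lintegral_ofReal hint (ae_of_all _ fun x => sq_nonneg x)]
  have h2 := variance_fun_id_gaussianReal (μ := 0) (v := 1)
  rw [variance_eq_integral (by fun_prop)] at h2
  simp only [integral_id_gaussianReal, sub_zero] at h2
  rw [h2]; simp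

theorem gaussianStream_le_norm_sq (k : ℕ) {R : ℝ} (hR : 0 < R) :
    gaussianStream {ω | R ≤ ‖gaussVec k ω‖ ^ 2} ≤ ENNReal.ofReal (k / R) := by
  have hE : ∫⁻ ω, ENNReal.ofReal (‖gaussVec k ω‖ ^ 2) ∂gaussianStream = k := by
    have : ∀ ω : ℕ → ℝ, ENNReal.ofReal (‖gaussVec k ω‖ ^ 2) =
        ∑ i : Fin k, ENNReal.ofReal (ω i ^ 2) := fun ω => by
      rw [EuclideanSpace.real_norm_sq_eq, ENNReal.ofReal_sum_of_nonneg fun _ _ => sq_nonneg _]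
      rfl
    simp_rw [this]
    rw [lintegral_finsetSum _ fun i _ => by fun_prop]
    simp [lintegral_gaussianStream_sq]
  have hmeas : Measurable fun ω => ENNReal.ofReal (‖gaussVec k ω‖ ^ 2) :=
    ((measurable_gaussVec k).norm.pow_const 2).ennreal_ofReal
  have h := meas_ge_le_lintegral_div hmeas.aemeasurable (μ := gaussianStream)
    (ε := ENNReal.ofReal R) (by simpa using hR) ENNReal.ofReal_ne_top
  rw [hE] at h
  rw [ENNReal.ofReal_div_of_pos hR, ENNReal.ofReal_natCast]
  refine le_trans (measure_mono fun ω hω => ?_) h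
  exact ENNReal.ofReal_le_ofReal hω

/-- This is where the constant `2.23` of the algorithm enters, by way of `2 · 2.23 · ln (9 / 4) ≥ 7 / 2`. -/
theorem pow_mul_sqrt_le_of_log_le {x : ℝ} (hx : 2 ≤ x) {N : ℕ}
    (hN : 223 / 100 * Real.log x ≤ N) : x ^ 3 * √x ≤ (9 / 4 : ℝ) ^ (2 * N) := by
  have hx0 : 0 < x := by linarith
  have hlog : (4 / 5 : ℝ) ≤ Real.log (9 / 4) := by
    rw [Real.le_log_iff_exp_le (by norm_num)]
    have h1 : Real.exp (4 / 5) ^ 5 = Real.exp 1 ^ 4 := by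
      rw [← Real.exp_nat_mul, ← Real.exp_nat_mul]; norm_num
    have h2 : Real.exp 1 ^ 4 ≤ (9 / 4 : ℝ) ^ 5 := by
      have := Real.exp_one_lt_d9.le
      calc Real.exp 1 ^ 4 ≤ (2.7182818286 : ℝ) ^ 4 :=
            pow_le_pow_left₀ (Real.exp_nonneg _) this 4
        _ ≤ _ := by norm_num
    exact le_of_pow_le_pow_left₀ (by norm_num) (by norm_num) (h1.le.trans h2)
  have hlx : 0 ≤ Real.log x := Real.log_nonneg (by linarith)
  rw [← Real.log_le_log_iff (by positivity) (by positivity), Real.log_mul (by positivity)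
    (by positivity), Real.log_pow, Real.log_pow, Real.log_sqrt hx0.le]
  push_cast
  nlinarith

/-- With `g` the Gaussian starting vector and `u` a unit vector, it is unlikely that `(u, g)²` is smaller
than `(9/4)^(-2N) ‖g‖²`: otherwise `‖g‖² ≥ 2 k / δ`, which has probability at most `δ / 2` by
Markov's inequality, or `|(u, g)|` is tiny. -/
theorem gaussianStream_bad_le {k : ℕ} (hk : 1 ≤ k) {δ : ℝ} (hδ0 : 0 < δ) (hδ1 : δ < 1)
    {N : ℕ} (hN : 223 / 100 * Real.log (k / δ ^ 2) ≤ N) {u w : EuclideanSpace ℝ (Fin k)}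
    (hu : ‖u‖ = 1) (hw : w ≠ 0) :
    gaussianStream {ω | inner ℝ u (gaussVec k ω) ^ 2 * (9 / 4) ^ (2 * N) < ‖gaussVec k ω‖ ^ 2 ∨
      inner ℝ w (gaussVec k ω) = 0} ≤ ENNReal.ofReal δ := by
  refine (measure_union_le (μ := gaussianStream)
    {ω | inner ℝ u (gaussVec k ω) ^ 2 * (9 / 4) ^ (2 * N) < ‖gaussVec k ω‖ ^ 2}
    {ω | inner ℝ w (gaussVec k ω) = 0}).trans ?_
  rw [gaussianStream_inner_eq_zero hw, add_zero]
  rcases hk.eq_or_lt with rfl | hk2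
  · -- In dimension one `(u, g)² = ‖g‖²`.
    rw [show {ω | inner ℝ u (gaussVec 1 ω) ^ 2 * (9 / 4) ^ (2 * N) < ‖gaussVec 1 ω‖ ^ 2} = ∅ from
      Set.eq_empty_of_forall_notMem fun ω hω => ?_]
    · simp
    · have h1 : inner ℝ u (gaussVec 1 ω) ^ 2 = ‖gaussVec 1 ω‖ ^ 2 := by
        have hu2 : ‖u‖ ^ 2 = 1 := by rw [hu, one_pow]
        rw [EuclideanSpace.real_norm_sq_eq] at hu2 ⊢
        rw [PiLp.inner_apply]
        simp only [Fin.sum_univ_one, RCLike.inner_apply, conj_trivial] at hu2 ⊢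
        rw [mul_pow, hu2, mul_one]
      have h2 : (1 : ℝ) ≤ (9 / 4) ^ (2 * N) := one_le_pow₀ (by norm_num)
      have h3 := sq_nonneg ‖gaussVec 1 ω‖
      change inner ℝ u (gaussVec 1 ω) ^ 2 * (9 / 4) ^ (2 * N) < ‖gaussVec 1 ω‖ ^ 2 at hω
      rw [h1] at hω
      nlinarith
  · have hkr : (2 : ℝ) ≤ k := by exact_mod_cast hk2
    set x : ℝ := k / δ ^ 2 with hx
    have hδ2 : δ ^ 2 ≤ 1 := by nlinarith
    have hx2 : 2 / δ ^ 2 ≤ x := div_le_div_of_nonneg_right hkr (by positivity)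
    have hx2' : 2 ≤ x := le_trans (by rw [le_div_iff₀ (by positivity)]; linarith) hx2
    have hxpos : 0 < x := by linarith
    have hkx : (k : ℝ) = x * δ ^ 2 := by rw [hx]; field_simp
    have hpow := pow_mul_sqrt_le_of_log_le hx2' hN
    set r : ℝ := 5 / 8 * δ with hr
    have hsub : {ω | inner ℝ u (gaussVec k ω) ^ 2 * (9 / 4) ^ (2 * N) < ‖gaussVec k ω‖ ^ 2} ⊆
        {ω | 2 * k / δ ≤ ‖gaussVec k ω‖ ^ 2} ∪ {ω | |inner ℝ u (gaussVec k ω)| ≤ r} := by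
      intro ω hω
      by_contra hcon
      simp only [Set.mem_union, Set.mem_ofPred_eq, not_or, not_le] at hcon hω
      obtain ⟨h1, h2⟩ := hcon
      have h3 : r ^ 2 < inner ℝ u (gaussVec k ω) ^ 2 := by
        rw [← sq_abs (inner ℝ u _)]
        exact pow_lt_pow_left₀ h2 (by positivity) two_ne_zero
      -- The numbers: `(25 / 64) δ² x³ √x ≥ 2 x δ`, since `x δ² ≥ 2`, `x ≥ 2` and `√x ≥ 7 / 5`.
      have h4 : r ^ 2 * (x ^ 3 * √x) < 2 * k / δ := by
        calc r ^ 2 * (x ^ 3 * √x) ≤ r ^ 2 * (9 / 4) ^ (2 * N) :=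
              mul_le_mul_of_nonneg_left hpow (sq_nonneg r)
          _ ≤ inner ℝ u (gaussVec k ω) ^ 2 * (9 / 4) ^ (2 * N) :=
              mul_le_mul_of_nonneg_right h3.le (by positivity)
          _ < _ := hω.trans h1
      have h5 : 2 * k / δ = 2 * x * δ := by rw [hkx]; field_simp
      have h6 : (7 / 5 : ℝ) ≤ √x := Real.le_sqrt_of_sq_le (by linarith)
      have h7 : 2 ≤ x * δ ^ 2 := by rw [← hkx]; exact hkr
      have h8 : 4 ≤ δ * x ^ 2 := by nlinarith
      rw [h5, hr] at h4
      have h9 : 2 * x * δ ≤ 25 / 64 * (7 / 5) * (δ * x) * (δ * x ^ 2) := by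
        have := mul_le_mul_of_nonneg_left h8 (show 0 ≤ 25 / 64 * (7 / 5) * (δ * x) by positivity)
        have h10 : 0 < δ * x := by positivity
        nlinarith
      have h11 : 25 / 64 * (7 / 5) * (δ * x) * (δ * x ^ 2) ≤ (5 / 8 * δ) ^ 2 * (x ^ 3 * √x) := by
        have := mul_le_mul_of_nonneg_left h6 (show 0 ≤ 25 / 64 * (δ ^ 2 * x ^ 3) by positivity)
        nlinarith
      linarith
    refine (measure_mono hsub).trans ((measure_union_le _ _).trans ?_)
    refine (add_le_add (gaussianStream_le_norm_sq k (R := 2 * k / δ) (by positivity))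
      (gaussianStream_abs_inner_le hu r)).trans ?_
    rw [← ENNReal.ofReal_add (by positivity) (by positivity)]
    refine ENNReal.ofReal_le_ofReal (le_of_eq ?_)
    rw [hr]
    field_simp
    ring

end Gaussian

/-! ### Inverse iteration -/

section Abstract

theorem pow_succ_le_of_log_convex {x y z c : ℝ} {m : ℕ} (hx : 0 < x) (hz : 0 ≤ z)
    (h : x ^ 2 ≤ y * z) (hm : y ^ (m + 1) ≤ c * x ^ m) : x ^ (m + 2) ≤ c * z ^ (m + 1) := by
  have h1 : x ^ m * x ^ (m + 2) ≤ x ^ m * (c * z ^ (m + 1)) := by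
    calc x ^ m * x ^ (m + 2) = (x ^ 2) ^ (m + 1) := by ring
      _ ≤ (y * z) ^ (m + 1) := pow_le_pow_left₀ (sq_nonneg x) h _
      _ = y ^ (m + 1) * z ^ (m + 1) := mul_pow _ _ _
      _ ≤ c * x ^ m * z ^ (m + 1) := mul_le_mul_of_nonneg_right hm (by positivity)
      _ = _ := by ring
  exact le_of_mul_le_mul_left h1 (by positivity)

variable {E : Type*} [NormedAddCommGroup E] [InnerProductSpace ℝ E]

theorem inner_sq_le (x y : E) : inner ℝ x y ^ 2 ≤ ‖x‖ ^ 2 * ‖y‖ ^ 2 := by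
  rw [← mul_pow, ← sq_abs (inner ℝ x y)]
  exact pow_le_pow_left₀ (abs_nonneg _) (abs_real_inner_le_norm x y) 2

/-- Inverse iteration `L* L W (i + 1) = W i`: the numbers `‖W 0‖², ‖L W 1‖², ‖W 1‖², ‖L W 2‖², …` are
log-convex, by the Cauchy-Schwarz inequality. -/
theorem inverseIteration_log_convex (L L' : E →ₗ[ℝ] E)
    (hadj : ∀ x y, inner ℝ (L x) y = inner ℝ x (L' y)) (W : ℕ → E)
    (hW : ∀ i, L' (L (W (i + 1))) = W i) (hne : ∀ i, W i ≠ 0) (N : ℕ) :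
    (‖L (W (N + 1))‖ ^ 2) ^ (2 * N + 2) ≤ ‖W 0‖ ^ 2 * (‖W (N + 1)‖ ^ 2) ^ (2 * N + 1) := by
  have h1 : ∀ i, (‖L (W (i + 1))‖ ^ 2) ^ 2 ≤ ‖W i‖ ^ 2 * ‖W (i + 1)‖ ^ 2 := fun i => by
    rw [mul_comm]
    refine le_trans (le_of_eq ?_) (inner_sq_le (W (i + 1)) (W i))
    rw [← hW i, ← hadj, real_inner_self_eq_norm_sq]
  have h2 : ∀ i, (‖W (i + 1)‖ ^ 2) ^ 2 ≤ ‖L (W (i + 1))‖ ^ 2 * ‖L (W (i + 2))‖ ^ 2 := fun i => by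
    refine le_trans (le_of_eq ?_) (inner_sq_le (L (W (i + 1))) (L (W (i + 2))))
    rw [hadj, hW (i + 1), real_inner_self_eq_norm_sq]
  have hpos : ∀ i, 0 < ‖W i‖ ^ 2 := fun i => by
    have := norm_pos_iff.2 (hne i); positivity
  have hposL : ∀ i, 0 < ‖L (W (i + 1))‖ ^ 2 := fun i => by
    have : L (W (i + 1)) ≠ 0 := fun h0 => hne i (by rw [← hW i, h0, map_zero])
    have := norm_pos_iff.2 this
    positivity
  induction N with
  | zero => simpa using h1 0
  | succ N ih =>
    have h3 := pow_succ_le_of_log_convex (hpos (N + 1)) (hposL (N + 1)).le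
      (h2 N) ih
    exact pow_succ_le_of_log_convex (hposL (N + 1)) (hpos (N + 2)).le
      (h1 (N + 1)) h3

/-- If the component of the starting vector in an eigenvector `u` of `L* L` is not too small, the
quotient `‖L W‖² / ‖W‖²` is at most `9 / 4` times the eigenvalue after `N` steps. -/
theorem inverseIteration_quotient_le (L L' : E →ₗ[ℝ] E)
    (hadj : ∀ x y, inner ℝ (L x) y = inner ℝ x (L' y)) (W : ℕ → E)
    (hW : ∀ i, L' (L (W (i + 1))) = W i) (h0 : W 0 ≠ 0) {u : E} (hu : ‖u‖ = 1) {l : ℝ}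
    (hl : 0 ≤ l) (heig : L' (L u) = l • u) {N : ℕ} (hN : N ≠ 0)
    (hgood : ‖W 0‖ ^ 2 ≤ inner ℝ u (W 0) ^ 2 * (9 / 4) ^ (2 * N)) :
    ‖L (W N)‖ ^ 2 ≤ 9 / 4 * l * ‖W N‖ ^ 2 := by
  have hne : ∀ i, W i ≠ 0 := by
    intro i
    induction i with
    | zero => exact h0
    | succ i ih => exact fun h => ih (by rw [← hW i, h, map_zero, map_zero])
  have hsymm : ∀ x, inner ℝ u (L' (L x)) = l * inner ℝ u x := fun x => by
    rw [← hadj, real_inner_comm, hadj, heig, inner_smul_right, real_inner_comm]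
  have hcomp : ∀ i, inner ℝ u (W 0) = l ^ i * inner ℝ u (W i) := by
    intro i
    induction i with
    | zero => simp
    | succ i ih => rw [ih, ← hW i, hsymm]; ring
  obtain ⟨m, rfl⟩ := Nat.exists_eq_succ_of_ne_zero hN
  have hlog := inverseIteration_log_convex L L' hadj W hW hne m
  have hWpos : 0 < ‖W (m + 1)‖ ^ 2 := by
    have := norm_pos_iff.2 (hne (m + 1)); positivity
  have hbessel : inner ℝ u (W (m + 1)) ^ 2 ≤ ‖W (m + 1)‖ ^ 2 := by
    have := inner_sq_le u (W (m + 1))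
    rwa [hu, one_pow, one_mul] at this
  have hmain : (‖L (W (m + 1))‖ ^ 2) ^ (2 * m + 2) ≤
      (9 / 4 * l * ‖W (m + 1)‖ ^ 2) ^ (2 * m + 2) := by
    calc _ ≤ ‖W 0‖ ^ 2 * (‖W (m + 1)‖ ^ 2) ^ (2 * m + 1) := hlog
      _ ≤ (inner ℝ u (W 0) ^ 2 * (9 / 4) ^ (2 * (m + 1))) * (‖W (m + 1)‖ ^ 2) ^ (2 * m + 1) :=
          mul_le_mul_of_nonneg_right hgood (by positivity)
      _ = (9 / 4) ^ (2 * m + 2) * l ^ (2 * m + 2) * (‖W (m + 1)‖ ^ 2) ^ (2 * m + 1) *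
          inner ℝ u (W (m + 1)) ^ 2 := by rw [hcomp (m + 1)]; ring
      _ ≤ (9 / 4) ^ (2 * m + 2) * l ^ (2 * m + 2) * (‖W (m + 1)‖ ^ 2) ^ (2 * m + 1) *
          ‖W (m + 1)‖ ^ 2 := mul_le_mul_of_nonneg_left hbessel (by positivity)
      _ = _ := by ring
  exact le_of_pow_le_pow_left₀ (by omega) (by positivity) hmain

/-- A Rayleigh quotient bounds the smallest eigenvalue of `L* L`. -/
theorem exists_eigenvector_le [FiniteDimensional ℝ E] (L : E →ₗ[ℝ] E) {w : E} (hw : w ≠ 0)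
    {c : ℝ} (h : ‖L w‖ ^ 2 ≤ c * ‖w‖ ^ 2) :
    ∃ (u : E) (l : ℝ), ‖u‖ = 1 ∧ 0 ≤ l ∧ l ≤ c ∧ L.adjoint (L u) = l • u := by
  have hB : (L.adjoint ∘ₗ L).IsSymmetric := LinearMap.isSymmetric_adjoint_mul_self L
  set e := hB.eigenvectorBasis rfl with he
  have heig : ∀ i, L.adjoint (L (e i)) = hB.eigenvalues rfl i • e i := fun i =>
    hB.apply_eigenvectorBasis rfl i
  by_contra! hcon
  have hlam : ∀ i, c < hB.eigenvalues rfl i := fun i => by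
    by_contra! hle
    refine hcon (e i) (hB.eigenvalues rfl i) (e.orthonormal.1 i) ?_ hle (heig i)
    have h1 : inner ℝ (e i) (L.adjoint (L (e i))) = hB.eigenvalues rfl i := by
      rw [heig, inner_smul_right, real_inner_self_eq_norm_sq, e.orthonormal.1 i]; simp
    rw [← h1, LinearMap.adjoint_inner_right]
    exact real_inner_self_nonneg
  have hsum : ‖L w‖ ^ 2 = ∑ i, hB.eigenvalues rfl i * inner ℝ (e i) w ^ 2 := by
    rw [← real_inner_self_eq_norm_sq, ← LinearMap.adjoint_inner_left, ← e.sum_inner_mul_inner]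
    refine Finset.sum_congr rfl fun i _ => ?_
    have : inner ℝ (L.adjoint (L w)) (e i) = hB.eigenvalues rfl i * inner ℝ (e i) w := by
      rw [LinearMap.adjoint_inner_left, ← LinearMap.adjoint_inner_right, heig, inner_smul_right,
        real_inner_comm]
    rw [this]; ring
  have hsum2 : ‖w‖ ^ 2 = ∑ i, inner ℝ (e i) w ^ 2 := by
    rw [← e.sum_sq_norm_inner_right]; simp
  rw [hsum, hsum2, Finset.mul_sum] at h
  have hall : ∀ i, inner ℝ (e i) w = 0 := by
    by_contra! ⟨i, hi⟩
    refine absurd h (not_le.2 (Finset.sum_lt_sum (fun j _ => ?_) ⟨i, Finset.mem_univ _, ?_⟩))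
    · exact mul_le_mul_of_nonneg_right (hlam j).le (sq_nonneg _)
    · exact mul_lt_mul_of_pos_right (hlam i) (by positivity)
  refine hw ?_
  have : ‖w‖ ^ 2 = 0 := by rw [hsum2]; simp [hall]
  simpa using this

end Abstract

section Concrete

variable {n k : ℕ} {s : State ℝ n}

/-- The entries `1, …, k` of an array as a vector. -/
noncomputable def toVec (k : ℕ) (v : ℕ → ℝ) : EuclideanSpace ℝ (Fin k) :=
  WithLp.toLp 2 fun i => v (i + 1)

/-- A vector as an array with entries `1, …, k`. -/
noncomputable def pad {k : ℕ} (x : EuclideanSpace ℝ (Fin k)) (j : ℕ) : ℝ :=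
  if h : 1 ≤ j ∧ j ≤ k then x ⟨j - 1, by omega⟩ else 0

theorem toVec_pad (x : EuclideanSpace ℝ (Fin k)) : toVec k (pad x) = x := by
  ext i
  change pad x (i + 1) = x i
  rw [pad, dif_pos (by omega)]
  rfl

theorem pad_of_lt (x : EuclideanSpace ℝ (Fin k)) {j : ℕ} (hj : k < j) : pad x j = 0 :=
  dif_neg (by omega)

theorem pad_toVec {v : ℕ → ℝ} (h0 : v 0 = 0) (hv : ∀ j, k < j → v j = 0) :
    pad (toVec k v) = v := by
  funext j
  by_cases h : 1 ≤ j ∧ j ≤ k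
  · rw [pad, dif_pos h]
    change v (j - 1 + 1) = v j
    rw [Nat.sub_add_cancel h.1]
  · rw [pad, dif_neg h]
    rcases Nat.eq_zero_or_pos j with rfl | hj
    · exact h0.symm
    · exact (hv j (by omega)).symm

theorem pad_add (x y : EuclideanSpace ℝ (Fin k)) (j : ℕ) : pad (x + y) j = pad x j + pad y j := by
  unfold pad; split_ifs <;> simp

theorem pad_smul (c : ℝ) (x : EuclideanSpace ℝ (Fin k)) (j : ℕ) :
    pad (c • x) j = c * pad x j := by
  unfold pad; split_ifs <;> simp

theorem norm_toVec_sq (k : ℕ) (v : ℕ → ℝ) :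
    ‖toVec k v‖ ^ 2 = ∑ i ∈ Finset.range k, v (i + 1) ^ 2 := by
  rw [EuclideanSpace.real_norm_sq_eq, ← Fin.sum_univ_eq_sum_range (fun i => v (i + 1) ^ 2)]
  rfl

theorem inner_toVec (k : ℕ) (v w : ℕ → ℝ) :
    inner ℝ (toVec k v) (toVec k w) = ∑ i ∈ Finset.range k, v (i + 1) * w (i + 1) := by
  rw [toVec, toVec, inner_toLp, ← Fin.sum_univ_eq_sum_range (fun i => v (i + 1) * w (i + 1))]
  rfl

/-- The linear map of the matrix `T̃`. -/
noncomputable def State.shiftedMap (s : State ℝ n) (k : ℕ) :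
    EuclideanSpace ℝ (Fin k) →ₗ[ℝ] EuclideanSpace ℝ (Fin k) where
  toFun x := toVec k (s.shiftedMul (pad x))
  map_add' x y := by
    ext i
    simp only [toVec, State.shiftedMul, pad_add, PiLp.add_apply]
    ring
  map_smul' c x := by
    ext i
    simp only [toVec, State.shiftedMul, pad_smul, PiLp.smul_apply, smul_eq_mul, RingHom.id_apply]
    ring

theorem State.shiftedMap_toVec (s : State ℝ n) {v : ℕ → ℝ} (h0 : v 0 = 0)
    (hv : ∀ j, k < j → v j = 0) : s.shiftedMap k (toVec k v) = toVec k (s.shiftedMul v) := by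
  change toVec k (s.shiftedMul (pad (toVec k v))) = _
  rw [pad_toVec h0 hv]

/-- Entry `j` of `T̃ᵀ y`. -/
noncomputable def State.shiftedTMul (s : State ℝ n) (y : ℕ → ℝ) (j : ℕ) : ℝ :=
  s.be (j + 1) * y j + s.tMid 0 j * y (j - 1) + s.tTop 0 j * y (j - 2)

theorem State.sum_shiftedMul_mul (s : State ℝ n) (x y : ℕ → ℝ) (hx : ∀ j, k < j → x j = 0) :
    ∑ i ∈ Finset.range k, s.shiftedMul x (i + 1) * y (i + 1) =
      ∑ i ∈ Finset.range k, x (i + 1) * s.shiftedTMul y (i + 1) := by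
  -- For arbitrary `x`, boundary terms with `x (m + 1)` and `x (m + 2)` appear.
  have key : ∀ m : ℕ, ∑ i ∈ Finset.range m, s.shiftedMul x (i + 1) * y (i + 1) =
      ∑ i ∈ Finset.range m, x (i + 1) * s.shiftedTMul y (i + 1) +
        (s.tMid 0 (m + 1) * x (m + 1) * y m + s.tTop 0 (m + 1) * x (m + 1) * y (m - 1) +
          s.tTop 0 (m + 2) * x (m + 2) * y m) := by
    intro m
    induction m with
    | zero => simp [State.tMid, State.tTop]
    | succ m ih =>
      rw [Finset.sum_range_succ, Finset.sum_range_succ, ih, State.shiftedMul_eq,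
        State.shiftedTMul]
      simp only [Nat.add_sub_cancel, show m + 1 - 2 = m - 1 by omega]
      ring
  rw [key k, hx (k + 1) (by omega), hx (k + 2) (by omega)]
  simp

theorem State.adjoint_shiftedMap_toVec (s : State ℝ n) (k : ℕ) (y : ℕ → ℝ) :
    (s.shiftedMap k).adjoint (toVec k y) = toVec k (s.shiftedTMul y) := by
  refine ext_inner_left ℝ fun x => ?_
  rw [LinearMap.adjoint_inner_right]
  conv_rhs => rw [← toVec_pad x]
  change inner ℝ (toVec k (s.shiftedMul (pad x))) (toVec k y) = _
  rw [inner_toVec, inner_toVec]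
  exact s.sum_shiftedMul_mul _ _ fun j hj => pad_of_lt x hj

/-- Forward substitution for `T̃ᵀ y = v`. -/
noncomputable def State.forwardSolve (s : State ℝ n) (v : ℕ → ℝ) : ℕ → ℕ → ℝ
  | 0 => fun _ => 0
  | j + 1 => Function.update (s.forwardSolve v j) (j + 1)
      ((v (j + 1) - s.tMid 0 (j + 1) * s.forwardSolve v j j -
        s.tTop 0 (j + 1) * s.forwardSolve v j (j - 1)) / s.be (j + 2))

theorem State.forwardSolve_spec (hbe : ∀ j, 1 ≤ j → j ≤ k + 1 → 0 < s.be j) (v : ℕ → ℝ) {m : ℕ}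
    (hm : m ≤ k) {j : ℕ} (h1 : 1 ≤ j) (h2 : j ≤ m) :
    s.shiftedTMul (s.forwardSolve v m) j = v j := by
  induction m with
  | zero => omega
  | succ m ih =>
    rw [State.forwardSolve, State.shiftedTMul, Function.update_of_ne (by omega) _ _ (a := j - 1),
      Function.update_of_ne (by omega) _ _ (a := j - 2)]
    by_cases hj : j = m + 1
    · subst hj
      rw [Function.update_self, Nat.add_sub_cancel, show m + 1 - 2 = m - 1 by omega]
      have := (hbe (m + 2) (by omega) (by omega)).ne'
      field_simp
      ring
    · rw [Function.update_of_ne hj]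
      exact ih (by omega) (by omega)

theorem forwardSubst_costs (hbe : ∀ j, 1 ≤ j → j ≤ k + 1 → 0 < s.be j) (v : ℕ → ℝ) :
    ∀ {m : ℕ}, m ≤ k → Costs (forwardSubst 0 s v m) (s.forwardSolve v m) (m * 5)
  | 0, _ => Costs.pure _
  | m + 1, hm => by
    have h1 := forwardSubst_costs hbe v (m := m) (by omega)
    have h2 := (hbe (m + 2) (by omega) (by omega)).ne'
    refine Costs.mono (C := m * 5 + 5) ?_ (by omega)
    refine h1.bind ?_
    refine Costs.bind_one (Costs.mul _ _) ?_
    refine Costs.bind_one (Costs.mul _ _) ?_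
    refine Costs.bind_one (Costs.sub _ _) ?_
    refine Costs.bind_one (Costs.sub _ _) ?_
    refine Costs.bind_one (Costs.div _ h2) ?_
    exact Costs.pure _

/-- Back substitution for `T̃ v = y`. -/
noncomputable def State.backwardSolve (s : State ℝ n) (y : ℕ → ℝ) (top : ℕ) (v : ℕ → ℝ) (m : ℕ) :
    ℕ → ℝ :=
  backSolve (fun j => s.be (j + 1)) s.al s.be y top v m

theorem backSubst_costs {top : ℕ} (hbe : ∀ j, 1 ≤ j → j ≤ top + 1 → 0 < s.be j) (y v : ℕ → ℝ) :
    ∀ {m : ℕ}, m ≤ top →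
      Costs (backSubst s y top v m) (s.backwardSolve y top v m) (m * 5)
  | 0, _ => Costs.pure _
  | m + 1, hm => by
    have h1 := backSubst_costs hbe y v (m := m) (by omega)
    have h2 := (hbe (top - m + 1) (by omega) (by omega)).ne'
    refine Costs.mono (C := m * 5 + 5) ?_ (by omega)
    refine h1.bind ?_
    refine Costs.bind_one (Costs.mul _ _) ?_
    refine Costs.bind_one (Costs.mul _ _) ?_
    refine Costs.bind_one (Costs.sub _ _) ?_
    refine Costs.bind_one (Costs.sub _ _) ?_
    refine Costs.bind_one (Costs.div _ h2) ?_
    exact Costs.pure _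

theorem State.backwardSolve_spec {top : ℕ} (hbe : ∀ j, 1 ≤ j → j ≤ top + 1 → 0 < s.be j)
    (y v : ℕ → ℝ) {i : ℕ} (h1 : 1 ≤ i) (h2 : i ≤ top) :
    s.shiftedMul (s.backwardSolve y top v top) i = y i :=
  backSolve_spec (fun j => s.be (j + 1)) s.al s.be y v le_rfl
    (fun i _ h4 => (hbe (i + 1) (by omega) (by omega)).ne') (by omega) h2

theorem State.backwardSolve_of_lt (s : State ℝ n) (y v : ℕ → ℝ) {top j : ℕ}
    (h : j = 0 ∨ top < j) : s.backwardSolve y top v top j = v j :=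
  backSolve_of_le _ _ _ _ _ le_rfl (by omega)

/-- The solution of `T̃ᵀ T̃ v' = v` by forward and back substitution. -/
noncomputable def State.solve (s : State ℝ n) (k : ℕ) (v : ℕ → ℝ) : ℕ → ℝ :=
  s.backwardSolve (s.forwardSolve v k) k (fun _ => 0) k

theorem toVec_congr {v w : ℕ → ℝ} (h : ∀ j, 1 ≤ j → j ≤ k → v j = w j) :
    toVec k v = toVec k w := by
  ext i
  exact h (i + 1) (by omega) (by omega)

theorem State.solve_spec (hbe : ∀ j, 1 ≤ j → j ≤ k + 1 → 0 < s.be j) (v : ℕ → ℝ) :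
    (s.shiftedMap k).adjoint (s.shiftedMap k (toVec k (s.solve k v))) = toVec k v := by
  rw [s.shiftedMap_toVec (s.backwardSolve_of_lt _ _ (Or.inl rfl))
    (fun j hj => s.backwardSolve_of_lt _ _ (Or.inr hj)),
    toVec_congr (v := s.shiftedMul (s.solve k v)) (w := s.forwardSolve v k) fun j h1 h2 =>
      State.backwardSolve_spec hbe (s.forwardSolve v k) (fun _ => 0) h1 h2,
    s.adjoint_shiftedMap_toVec]
  exact toVec_congr fun j h1 h2 => State.forwardSolve_spec hbe v le_rfl h1 h2

/-- The result of one step of inverse iteration. -/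
noncomputable def State.normalizedSolve (s : State ℝ n) (k : ℕ) (v : ℕ → ℝ) : ℕ → ℝ :=
  fun j => if 1 ≤ j ∧ j ≤ k then
    s.solve k v j / √(∑ i : Fin k, s.solve k v (i + 1) * s.solve k v (i + 1)) else 0

theorem State.norm_solve (s : State ℝ n) (k : ℕ) (v : ℕ → ℝ) :
    √(∑ i : Fin k, s.solve k v (i + 1) * s.solve k v (i + 1)) = ‖toVec k (s.solve k v)‖ := by
  rw [← Real.sqrt_sq (norm_nonneg (toVec k (s.solve k v))), EuclideanSpace.real_norm_sq_eq]
  simp [toVec, sq]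

theorem State.toVec_normalizedSolve (s : State ℝ n) (k : ℕ) (v : ℕ → ℝ) :
    toVec k (s.normalizedSolve k v) =
      ‖toVec k (s.solve k v)‖⁻¹ • toVec k (s.solve k v) := by
  ext i
  change s.normalizedSolve k v (i + 1) = _ * s.solve k v (i + 1)
  rw [State.normalizedSolve, if_pos (by omega), s.norm_solve, div_eq_inv_mul]

theorem inverseStep_costs (hbe : ∀ j, 1 ≤ j → j ≤ k + 1 → 0 < s.be j) (v : ℕ → ℝ)
    (hv : toVec k v ≠ 0) :
    Costs (inverseStep 0 s k v) (s.normalizedSolve k v) (13 * k + 2) := by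
  have hne : √(∑ i : Fin k, s.solve k v (i + 1) * s.solve k v (i + 1)) ≠ 0 := by
    rw [s.norm_solve, norm_ne_zero_iff]
    intro h0
    have := State.solve_spec hbe v
    rw [h0, map_zero, map_zero] at this
    exact hv this.symm
  refine Costs.mono (C := k * 5 + (k * 5 + ((k * (1 + 1) + 1) + (1 + k * 1)))) ?_ (by omega)
  refine (forwardSubst_costs hbe v le_rfl).bind ?_
  refine (backSubst_costs hbe _ _ le_rfl).bind ?_
  refine (Costs.sum fun j => Costs.mul _ _).bind ?_
  refine (Costs.sqrt (Finset.sum_nonneg fun _ _ => mul_self_nonneg _)).bind ?_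
  exact Costs.fill 0 fun j => Costs.div _ hne

/-- Up to normalization, `N` steps of inverse iteration amount to `N` applications of the inverse `S` of
`T̃ᵀ T̃`. -/
theorem State.iterate_normalizedSolve (hbe : ∀ j, 1 ≤ j → j ≤ k + 1 → 0 < s.be j)
    (S : EuclideanSpace ℝ (Fin k) → EuclideanSpace ℝ (Fin k))
    (hS : ∀ x, S ((s.shiftedMap k).adjoint (s.shiftedMap k x)) = x)
    (hSsmul : ∀ (c : ℝ) x, S (c • x) = c • S x) (N : ℕ) (v : ℕ → ℝ) (hv : toVec k v ≠ 0) :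
    ∃ c : ℝ, 0 < c ∧ toVec k ((s.normalizedSolve k)^[N] v) = c • S^[N] (toVec k v) := by
  have hstep : ∀ v, S (toVec k v) = toVec k (s.solve k v) := fun v => by
    rw [← State.solve_spec hbe v, hS]
  have hiter : ∀ (N : ℕ) (c : ℝ) x, S^[N] (c • x) = c • S^[N] x := by
    intro N
    induction N with
    | zero => intro c x; rfl
    | succ N ih => intro c x; rw [Function.iterate_succ_apply, hSsmul, ih]; rfl
  induction N generalizing v with
  | zero => exact ⟨1, one_pos, by simp⟩
  | succ N ih =>
    have hne : toVec k (s.solve k v) ≠ 0 := fun h0 => by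
      have := State.solve_spec hbe v
      rw [h0, map_zero, map_zero] at this
      exact hv this.symm
    have hpos : 0 < ‖toVec k (s.solve k v)‖⁻¹ := inv_pos.2 (norm_pos_iff.2 hne)
    obtain ⟨c, hc, h⟩ := ih (s.normalizedSolve k v) (by
      rw [s.toVec_normalizedSolve]; exact smul_ne_zero hpos.ne' hne)
    refine ⟨c * ‖toVec k (s.solve k v)‖⁻¹, by positivity, ?_⟩
    rw [Function.iterate_succ_apply, h, s.toVec_normalizedSolve, hiter, smul_smul, ← hstep,
      Function.iterate_succ_apply]

end Concrete

/-! ### Backward error of the outputs -/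

section Output

variable {n k : ℕ} {A : Matrix (Fin n) (Fin n) ℝ} {b : Fin n → ℝ} {s : State ℝ n} {tol ε : ℝ}

/-- The perturbation `(b - A x) xᵀ / (x, x)` shows that the backward error is at most
`‖b - A x‖ / (‖A‖ ‖x‖)`. -/
theorem berr_le {x : Fin n → ℝ} (hA0 : A ≠ 0) (hε : 0 ≤ ε) (hx : 0 < x ⬝ᵥ x)
    (h : (b - A.mulVec x) ⬝ᵥ (b - A.mulVec x) ≤ (ε * specNorm A) ^ 2 * (x ⬝ᵥ x)) :
    berr A b x ≤ ENNReal.ofReal ε := by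
  have hpos := specNorm_pos hA0
  set r := b - A.mulVec x with hr
  set E : Matrix (Fin n) (Fin n) ℝ := (x ⬝ᵥ x)⁻¹ • Matrix.vecMulVec r x with hE
  have hmul : ∀ y, E.mulVec y = ((x ⬝ᵥ x)⁻¹ * (x ⬝ᵥ y)) • r := fun y => by
    rw [hE, Matrix.smul_mulVec, Matrix.vecMulVec_mulVec, mul_smul]
    simp
  have hEx : (A + E).mulVec x = b := by
    rw [Matrix.add_mulVec, hmul, inv_mul_cancel₀ hx.ne', one_smul, hr]; abel
  refine (iInf₂_le E hEx).trans (ENNReal.ofReal_le_ofReal ?_)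
  rw [div_le_iff₀ hpos]
  refine ContinuousLinearMap.opNorm_le_bound _ (by positivity) fun y => ?_
  have hy : y = WithLp.toLp 2 y.ofLp := rfl
  rw [hy, Matrix.toEuclideanCLM_toLp, hmul, WithLp.toLp_smul, norm_smul]
  set nx := ‖WithLp.toLp 2 x‖ with hnx
  have hxx : x ⬝ᵥ x = nx ^ 2 := (norm_toLp_sq x).symm
  have hnx0 : 0 < nx := by
    refine (norm_nonneg _).lt_of_ne fun h0 => ?_
    rw [hxx, hnx, ← h0] at hx; simp at hx
  have hrn : ‖WithLp.toLp 2 r‖ ≤ ε * specNorm A * nx := by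
    refine le_of_pow_le_pow_left₀ two_ne_zero (by positivity) ?_
    rw [norm_toLp_sq, mul_pow, ← hxx]; exact h
  have hcs : |x ⬝ᵥ y.ofLp| ≤ nx * ‖WithLp.toLp 2 y.ofLp‖ := by
    rw [← inner_toLp]; exact abs_real_inner_le_norm _ _
  rw [Real.norm_eq_abs, abs_mul, abs_of_pos (inv_pos.2 hx), hxx]
  calc (nx ^ 2)⁻¹ * |x ⬝ᵥ y.ofLp| * ‖WithLp.toLp 2 r‖
      ≤ (nx ^ 2)⁻¹ * (nx * ‖WithLp.toLp 2 y.ofLp‖) * (ε * specNorm A * nx) := by gcongr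
    _ = _ := by field_simp

/-- The vector `Q v`. -/
noncomputable def State.comb (s : State ℝ n) (k : ℕ) (v : ℕ → ℝ) : Fin n → ℝ :=
  ∑ j ∈ Finset.range k, v (j + 1) • s.q (j + 1)

theorem applyBasis_costs (s : State ℝ n) (k : ℕ) (v : ℕ → ℝ) :
    Costs (applyBasis s k v) (s.comb k v) (n * (k * 2 + 1)) := by
  refine Costs.tabulate fun i => ?_
  have : s.comb k v i = ∑ j : Fin k, s.q (j + 1) i * v (j + 1) := by
    rw [State.comb, Finset.sum_apply,
      Fin.sum_univ_eq_sum_range (fun j => s.q (j + 1) i * v (j + 1))]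
    exact Finset.sum_congr rfl fun j _ => by simp [mul_comm]
  rw [this]
  exact Costs.sum fun j => Costs.mul _ _

theorem scaling_costs {nb : ℝ} (hnb : nb ≠ 0) (s : State ℝ n) (v : ℕ → ℝ) :
    Costs (scaling nb s v) ((s.al 1 * v 1 + s.be 2 * v 2) / nb) 4 := by
  refine Costs.bind_one (Costs.mul _ _) ?_
  refine Costs.bind_one (Costs.mul _ _) ?_
  refine Costs.bind_one (Costs.add _ _) ?_
  exact Costs.div _ hnb

theorem sqrt_dotProduct_ne_zero (hb : b ≠ 0) : √(b ⬝ᵥ b) ≠ 0 := by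
  rw [Real.sqrt_ne_zero (dotProduct_self_nonneg' b)]
  simpa using hb

theorem IsLanczos.smul_q_one (h : IsLanczos A b s k) (c : ℝ) :
    c • s.q 1 = (c / √(b ⬝ᵥ b)) • b := by
  rw [h.q_one, smul_smul, div_eq_mul_inv]

/-- Output in the case of an exhausted Krylov space. -/
theorem exhaustedOutput_costs (hA0 : A ≠ 0) (hb : b ≠ 0) (hε : 0 < ε)
    (htol : tol = 2 / 3 * ε * specNorm A) (hout : Outcome A b tol s (k + 1) .exhausted) :
    ∃ x, Costs (exhaustedOutput 0 tol √(b ⬝ᵥ b) s (k + 1)) x (5 * k + n * (2 * k + 4) + 8) ∧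
      berr A b x ≤ ENNReal.ofReal ε := by
  obtain ⟨hL, hbe0, hlast⟩ := hout
  have hpos := specNorm_pos hA0
  have hnb := sqrt_dotProduct_ne_zero hb
  have htol0 : 0 < tol := by rw [htol]; positivity
  set nb := √(b ⬝ᵥ b) with hnbdef
  have hnb2 : b ⬝ᵥ b = nb ^ 2 := (Real.sq_sqrt (dotProduct_self_nonneg' b)).symm
  set v := s.backwardSolve (fun _ => 0) k (Function.update (fun _ => 0) (k + 1) (1 : ℝ)) k with hv
  have hvk : v (k + 1) = 1 := by
    rw [hv, s.backwardSolve_of_lt _ _ (Or.inr (by omega)), Function.update_self]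
  have hvz : ∀ j, k + 1 < j → v j = 0 := fun j hj => by
    rw [hv, s.backwardSolve_of_lt _ _ (Or.inr (by omega)), Function.update_of_ne (by omega)]
  have hrows : ∀ i, 1 ≤ i → i ≤ k + 1 → s.shiftedMul v i = 0 := fun i h1 h2 => by
    rcases Nat.lt_or_eq_of_le h2 with h3 | rfl
    · exact State.backwardSolve_spec (top := k) hL.be_pos _ _ h1 (by omega)
    · rw [State.shiftedMul, hbe0, hvz (k + 2) (by omega), hvz (k + 3) (by omega)]; ring
  have hrec : ∀ j, 1 ≤ j → j ≤ k + 1 →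
      A.mulVec (s.q j) = s.be (j + 1) • s.q (j + 1) + s.al j • s.q j + s.be j • s.q (j - 1) :=
    fun j h1 h2 => by
      rcases Nat.lt_or_eq_of_le h2 with h3 | rfl
      · exact hL.recurrence j h1 h3
      · rw [hbe0, zero_smul, zero_add, hlast]
  have hAQ : A.mulVec (s.comb (k + 1) v) = ((s.al 1 * v 1 + s.be 2 * v 2) / nb) • b := by
    rw [State.comb, mulVec_comb hL.q_zero hrec v hvz, Finset.sum_eq_zero, add_zero,
      hL.smul_q_one]
    intro i hi
    rw [hrows (i + 1) (by omega) (by simpa using hi), zero_smul]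
  set α := (s.al 1 * v 1 + s.be 2 * v 2) / nb with hα
  have hsub : Costs (backSubst s (fun _ => 0) (k + 1 - 1)
      (Function.update (fun _ => (0 : ℝ)) (k + 1) ((1 : ℚ) : ℝ)) (k + 1 - 1)) v (k * 5) := by
    rw [Rat.cast_one]
    exact backSubst_costs (top := k) hL.be_pos _ _ le_rfl
  by_cases hα0 : α = 0
  · refine ⟨(tol / nb)⁻¹ • s.comb (k + 1) v, ?_, ?_⟩
    · refine Costs.mono
        (C := 1 + (k * 5 + (4 + (n * ((k + 1) * 2 + 1) + (1 + (1 + (1 + n * 1))))))) ?_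
        (by ring_nf; omega)
      refine (Costs.const 1).bind ?_
      refine hsub.bind ?_
      refine (scaling_costs hnb s v).bind ?_
      refine (applyBasis_costs s (k + 1) v).bind ?_
      refine (Costs.mul _ _).bind ?_
      refine (Costs.lt_of_not_lt (x := 0) (y := α * α) (by rw [hα0]; simp)).bind ?_
      refine (Costs.div _ hnb).bind ?_
      exact Costs.divBy _ (div_ne_zero htol0.ne' hnb)
    · have hQQ : 1 ≤ s.comb (k + 1) v ⬝ᵥ s.comb (k + 1) v := by
        rw [State.comb, hL.dotProduct_comb, Finset.sum_range_succ, hvk]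
        have : 0 ≤ ∑ i ∈ Finset.range k, v (i + 1) ^ 2 := Finset.sum_nonneg fun _ _ => sq_nonneg _
        linarith
      have hnbp : 0 < nb := lt_of_le_of_ne (Real.sqrt_nonneg _) hnb.symm
      have hxx : (tol / nb)⁻¹ • s.comb (k + 1) v ⬝ᵥ (tol / nb)⁻¹ • s.comb (k + 1) v =
          (nb / tol) ^ 2 * (s.comb (k + 1) v ⬝ᵥ s.comb (k + 1) v) := by
        rw [smul_dotProduct, dotProduct_smul, inv_div]; simp only [smul_eq_mul]; ring
      refine berr_le hA0 hε.le ?_ ?_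
      · rw [hxx]; positivity
      · rw [hxx, Matrix.mulVec_smul, hAQ, hα0, zero_smul, smul_zero, sub_zero, hnb2]
        have h1 : tol ^ 2 ≤ (ε * specNorm A) ^ 2 :=
          pow_le_pow_left₀ htol0.le (by rw [htol]; nlinarith [mul_pos hε hpos]) 2
        calc nb ^ 2 = tol ^ 2 * ((nb / tol) ^ 2 * 1) := by field_simp
          _ ≤ (ε * specNorm A) ^ 2 *
              ((nb / tol) ^ 2 * (s.comb (k + 1) v ⬝ᵥ s.comb (k + 1) v)) := by gcongr
  · refine ⟨α⁻¹ • s.comb (k + 1) v, ?_, ?_⟩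
    · refine Costs.mono (C := 1 + (k * 5 + (4 + (n * ((k + 1) * 2 + 1) + (1 + (1 + n * 1)))))) ?_
        (by ring_nf; omega)
      refine (Costs.const 1).bind ?_
      refine hsub.bind ?_
      refine (scaling_costs hnb s v).bind ?_
      refine (applyBasis_costs s (k + 1) v).bind ?_
      refine (Costs.mul _ _).bind ?_
      refine (Costs.lt_of_lt (x := 0) (y := α * α) (mul_self_pos.2 hα0)).bind ?_
      exact Costs.divBy _ hα0
    · have hAx : A.mulVec (α⁻¹ • s.comb (k + 1) v) = b := by
        rw [Matrix.mulVec_smul, hAQ, smul_smul, inv_mul_cancel₀ hα0, one_smul]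
      have hx0 : α⁻¹ • s.comb (k + 1) v ≠ 0 := fun h0 => hb (by rw [← hAx, h0, Matrix.mulVec_zero])
      have hxx : 0 < α⁻¹ • s.comb (k + 1) v ⬝ᵥ α⁻¹ • s.comb (k + 1) v :=
        (dotProduct_self_nonneg' _).lt_of_ne fun h0 => hx0 (dotProduct_self_eq_zero.1 h0.symm)
      refine berr_le hA0 hε.le hxx ?_
      rw [hAx, sub_self, dotProduct_zero]
      positivity

/-- Started at the beginning of the random stream `ω`, the program `p` returns a result with the property
`Q` after at most `C` operations. -/
def Yields {α : Type} (p : Prog ℝ α) (ω : ℕ → ℝ) (Q : α → Prop) (C : ℕ) : Prop :=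
  ∀ t : ℕ, ∃ x c d, c ≤ C ∧ p.run ω ⟨t, 0⟩ = some (x, ⟨t + c, d⟩) ∧ Q x

namespace Yields

variable {α β : Type} {ω : ℕ → ℝ}

theorem of_costs {p : Prog ℝ α} {a : α} {C : ℕ} (h : Costs p a C) {Q : α → Prop} (hQ : Q a) :
    Yields p ω Q C := by
  intro t
  obtain ⟨c, hc, hr⟩ := h ω ⟨t, 0⟩
  exact ⟨a, c, 0, hc, hr, hQ⟩

theorem mono {p : Prog ℝ α} {Q : α → Prop} {C D : ℕ} (h : Yields p ω Q C) (hCD : C ≤ D) :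
    Yields p ω Q D := by
  intro t
  obtain ⟨x, c, d, hc, hr⟩ := h t
  exact ⟨x, c, d, hc.trans hCD, hr⟩

theorem costs_bind {p : Prog ℝ α} {f : α → Prog ℝ β} {a : α} {Q : β → Prop} {C D : ℕ}
    (hp : Costs p a C) (hf : Yields (f a) ω Q D) : Yields (p >>= f) ω Q (C + D) := by
  intro t
  obtain ⟨c, hc, hr⟩ := hp ω ⟨t, 0⟩
  obtain ⟨x, c', d, hc', hr', hx⟩ := hf (t + c)
  refine ⟨x, c + c', d, by omega, ?_, hx⟩
  rw [Prog.run_bind, hr]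
  simpa [Counters.tick, add_assoc] using hr'

theorem bind_costs {p : Prog ℝ α} {f : α → Prog ℝ β} {a : α} {b : β} {Q : β → Prop} {C D : ℕ}
    (hp : Yields p ω (· = a) C) (hf : Costs (f a) b D) (hQ : Q b) :
    Yields (p >>= f) ω Q (C + D) := by
  intro t
  obtain ⟨x, c, d, hc, hr, rfl⟩ := hp t
  obtain ⟨c', hc', hr'⟩ := hf ω ⟨t + c, d⟩
  refine ⟨b, c + c', d, by omega, ?_, hQ⟩
  rw [Prog.run_bind, hr]
  simpa [Counters.tick, add_assoc] using hr'

/-- The block of `k` Gaussian numbers at the start of the stream. -/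
theorem fill_gauss (k : ℕ) : Yields (fill 0 k fun _ => gauss) ω
    (· = fun j => if 1 ≤ j ∧ j ≤ k then ω (j - 1) else 0) k := by
  intro t
  exact ⟨_, k, k, le_rfl, by simpa using run_fill_gauss 0 ω ⟨t, 0⟩ k, rfl⟩

end Yields

/-- The Gaussian starting array of inverse iteration. -/
noncomputable def gaussArray (k : ℕ) (ω : ℕ → ℝ) : ℕ → ℝ :=
  fun j => if 1 ≤ j ∧ j ≤ k then ω (j - 1) else 0

theorem toVec_gaussArray (k : ℕ) (ω : ℕ → ℝ) : toVec k (gaussArray k ω) = gaussVec k ω := by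
  ext i
  change gaussArray k ω (i + 1) = ω i
  rw [gaussArray, if_pos (by omega), Nat.add_sub_cancel]

/-- The number of steps of inverse iteration. -/
noncomputable def iterations (k : ℕ) (δ : ℝ) : ℕ := ⌈223 / 100 * Real.log (k / δ ^ 2)⌉₊

theorem inverseIteration_yields (hbe : ∀ j, 1 ≤ j → j ≤ k + 1 → 0 < s.be j) (hk : 1 ≤ k)
    {δ : ℝ} (hδ : 0 < δ) {ω : ℕ → ℝ} (hω : gaussVec k ω ≠ 0) :
    Yields (inverseIteration 0 δ s k) ω
      (· = (s.normalizedSolve k)^[iterations k δ] (gaussArray k ω))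
      (k + (7 + 2 * iterations k δ + iterations k δ * (13 * k + 2))) := by
  set N := iterations k δ with hN
  have hkr : (0 : ℝ) < k := by exact_mod_cast hk
  have hloop : Costs (iterate (inverseStep 0 s k) N (gaussArray k ω))
      ((s.normalizedSolve k)^[N] (gaussArray k ω)) (N * (13 * k + 2)) := by
    refine Costs.iterate (fun v => toVec k v ≠ 0) (fun v hv => ?_)
      (fun v hv => inverseStep_costs hbe v hv) N _ (by rwa [toVec_gaussArray])
    have hne : toVec k (s.solve k v) ≠ 0 := fun h0 => by
      have := State.solve_spec hbe v
      rw [h0, map_zero, map_zero] at this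
      exact hv this.symm
    rw [s.toVec_normalizedSolve]
    exact smul_ne_zero (inv_ne_zero (norm_ne_zero_iff.2 hne)) hne
  refine Yields.bind_costs (Yields.fill_gauss k)
    (b := (s.normalizedSolve k)^[N] (gaussArray k ω)) ?_ rfl
  refine Costs.mono
    (C := N * (13 * k + 2) + (2 * N + 1) + 1 + 1 + 1 + 1 + 1 + 1) ?_ (by omega)
  have hδ2 : δ * δ ≠ 0 := by positivity
  refine Costs.bind_one (Costs.const _) ?_
  refine Costs.bind_one (Costs.mul _ _) ?_
  refine Costs.bind_one (Costs.div _ hδ2) ?_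
  refine Costs.bind_one (Costs.log (by push_cast; positivity)) ?_
  refine Costs.bind_one (Costs.const _) ?_
  refine Costs.bind_one (Costs.mul _ _) ?_
  rw [add_comm (N * (13 * k + 2))]
  have hcount : Costs (countTo (((223 / 100 : ℚ) : ℝ) * Real.log (((k : ℚ) : ℝ) / (δ * δ)))) N
      (2 * N + 1) := by
    have h := Costs.countTo (((223 / 100 : ℚ) : ℝ) * Real.log (((k : ℚ) : ℝ) / (δ * δ)))
    have e : ⌈((223 / 100 : ℚ) : ℝ) * Real.log (((k : ℚ) : ℝ) / (δ * δ))⌉₊ = N := by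
      rw [hN, iterations, sq]; push_cast; rfl
    rwa [e] at h
  exact hcount.bind hloop

/-- The first entry of `T v` does not vanish for all `v`: otherwise `A q 1 = β q 2` with `β ≠ 0`, which
is impossible for a semidefinite matrix if there is only one column. -/
theorem IsLanczos.exists_first_row_ne_zero (hA : A.PosSemidef) (hL : IsLanczos A b s (k + 1))
    (hk : 1 ≤ k) : ∃ x : EuclideanSpace ℝ (Fin k), s.al 1 * pad x 1 + s.be 2 * pad x 2 ≠ 0 := by
  have hbe2 := hL.be_pos 2 (by omega) (by omega)
  rcases hk.eq_or_lt with rfl | hk2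
  · refine ⟨WithLp.toLp 2 fun _ => 1, ?_⟩
    rw [pad_of_lt _ (by omega : 1 < 2), pad, dif_pos (by omega)]
    simp only [mul_one, mul_zero, add_zero]
    intro hal
    have hrec := hL.recurrence 1 le_rfl (by omega)
    rw [hal, zero_smul, add_zero, Nat.sub_self, hL.q_zero, smul_zero, add_zero] at hrec
    have horth := hL.orth 1 2 le_rfl (by omega) (by omega) le_rfl
    have hone := hL.orth 2 2 (by omega) le_rfl (by omega) le_rfl
    have h0 : star (s.q 1) ⬝ᵥ A.mulVec (s.q 1) = 0 := by
      rw [hrec, dotProduct_smul, star_trivial, horth]; simp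
    have hz := (hA.dotProduct_mulVec_zero_iff (s.q 1)).1 h0
    rw [hz] at hrec
    have hq2 := (smul_eq_zero.1 hrec.symm).resolve_left hbe2.ne'
    rw [show (1 + 1 : ℕ) = 2 from rfl] at hq2
    rw [hq2] at hone
    simp at hone
  · refine ⟨WithLp.toLp 2 fun i => if (i : ℕ) = 1 then 1 else 0, ?_⟩
    rw [pad, dif_pos (by omega), pad, dif_pos (by omega)]
    simpa using hbe2.ne'

theorem IsLanczos.dotProduct_comb_succ (hL : IsLanczos A b s (k + 1)) (c : ℕ → ℝ) :
    (∑ i ∈ Finset.range k, c (i + 1) • s.q (i + 2)) ⬝ᵥ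
      (∑ i ∈ Finset.range k, c (i + 1) • s.q (i + 2)) = ∑ i ∈ Finset.range k, c (i + 1) ^ 2 := by
  have h := hL.dotProduct_comb fun j => if j = 1 then 0 else c (j - 1)
  rw [Finset.sum_range_succ', Finset.sum_range_succ'] at h
  simpa using h

/-- Backward error of the output `Q v / α` in the regular case. -/
theorem berr_comb_le (hA0 : A ≠ 0) (hε : 0 < ε)
    (htol : tol = 2 / 3 * ε * specNorm A) (hL : IsLanczos A b s (k + 1)) {v : ℕ → ℝ}
    (h0 : v 0 = 0) (hvz : ∀ j, k < j → v j = 0) {α : ℝ}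
    (hα : α = (s.al 1 * v 1 + s.be 2 * v 2) / √(b ⬝ᵥ b)) (hα0 : α ≠ 0) (hv : toVec k v ≠ 0)
    (h : ‖s.shiftedMap k (toVec k v)‖ ^ 2 ≤ 9 / 4 * tol ^ 2 * ‖toVec k v‖ ^ 2) :
    berr A b (α⁻¹ • s.comb k v) ≤ ENNReal.ofReal ε := by
  have hk' : IsLanczos A b s k := ⟨hL.q_zero, hL.be_one, hL.q_one, fun j h1 h2 => hL.be_pos j h1
    (by omega), fun i j h1 h2 h3 h4 => hL.orth i j h1 (by omega) h3 (by omega),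
    fun j h1 h2 => hL.recurrence j h1 (by omega)⟩
  have hQQ : s.comb k v ⬝ᵥ s.comb k v = ‖toVec k v‖ ^ 2 := by
    rw [State.comb, hk'.dotProduct_comb, norm_toVec_sq]
  have hxx : α⁻¹ • s.comb k v ⬝ᵥ α⁻¹ • s.comb k v = α⁻¹ ^ 2 * ‖toVec k v‖ ^ 2 := by
    rw [smul_dotProduct, dotProduct_smul, hQQ]; simp only [smul_eq_mul]; ring
  set r := ∑ i ∈ Finset.range k, s.shiftedMul v (i + 1) • s.q (i + 2) with hr
  have hAQ : A.mulVec (s.comb k v) = α • b + r := by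
    rw [State.comb, mulVec_comb hL.q_zero (fun j h1 h2 => hL.recurrence j h1 (by omega)) v hvz,
      hL.smul_q_one, hα]
  have hres : b - A.mulVec (α⁻¹ • s.comb k v) = (-α⁻¹) • r := by
    rw [Matrix.mulVec_smul, hAQ, smul_add, smul_smul, inv_mul_cancel₀ hα0, one_smul, neg_smul]
    abel
  have hvpos : 0 < ‖toVec k v‖ ^ 2 := by
    have := norm_pos_iff.2 hv; positivity
  have hαpos : 0 < α⁻¹ ^ 2 := by positivity
  refine berr_le hA0 hε.le (by rw [hxx]; positivity) ?_
  rw [hres, hxx, smul_dotProduct, dotProduct_smul, hr, hL.dotProduct_comb_succ,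
    ← norm_toVec_sq, ← s.shiftedMap_toVec h0 hvz]
  simp only [smul_eq_mul]
  calc -α⁻¹ * (-α⁻¹ * ‖s.shiftedMap k (toVec k v)‖ ^ 2)
      = α⁻¹ ^ 2 * ‖s.shiftedMap k (toVec k v)‖ ^ 2 := by ring
    _ ≤ α⁻¹ ^ 2 * (9 / 4 * tol ^ 2 * ‖toVec k v‖ ^ 2) := mul_le_mul_of_nonneg_left h hαpos.le
    _ = _ := by rw [htol]; ring

theorem iterations_pos (hk : 1 ≤ k) {δ : ℝ} (hδ0 : 0 < δ) (hδ1 : δ < 1) :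
    iterations k δ ≠ 0 := by
  have hkr : (1 : ℝ) ≤ k := by exact_mod_cast hk
  have h1 : 1 < (k : ℝ) / δ ^ 2 := by
    rw [lt_div_iff₀ (by positivity)]; nlinarith
  have := Real.log_pos h1
  exact (Nat.ceil_pos.2 (by positivity)).ne'

theorem normalizedSolve_iterate_supp (s : State ℝ n) (k : ℕ) (N : ℕ) (v : ℕ → ℝ)
    (hv : ∀ j, j = 0 ∨ k < j → v j = 0) (j : ℕ) (hj : j = 0 ∨ k < j) :
    (s.normalizedSolve k)^[N] v j = 0 := by
  cases N with
  | zero => exact hv j hj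
  | succ N =>
    rw [Function.iterate_succ_apply', State.normalizedSolve, if_neg (by omega)]

/-- Output in the regular case, for all random numbers outside of an event of the kind considered in
`gaussianStream_bad_le`. -/
theorem regularOutput_yields (hA : A.PosSemidef) (hA0 : A ≠ 0) (hb : b ≠ 0) (hε : 0 < ε)
    (htol : tol = 2 / 3 * ε * specNorm A) {δ : ℝ} (hδ0 : 0 < δ) (hδ1 : δ < 1) (hk : 1 ≤ k)
    (hout : Outcome A b tol s k .converged) :
    ∃ u w : EuclideanSpace ℝ (Fin k), ‖u‖ = 1 ∧ w ≠ 0 ∧ ∀ ω : ℕ → ℝ,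
      ¬ (inner ℝ u (gaussVec k ω) ^ 2 * (9 / 4) ^ (2 * iterations k δ) < ‖gaussVec k ω‖ ^ 2 ∨
        inner ℝ w (gaussVec k ω) = 0) →
      Yields (regularOutput 0 δ √(b ⬝ᵥ b) s k) ω (fun x => berr A b x ≤ ENNReal.ofReal ε)
        (k + (7 + 2 * iterations k δ + iterations k δ * (13 * k + 2)) + (4 + n * (2 * k + 2))) := by
  obtain ⟨hL, v₀, hv₀z, hv₀pos, hv₀⟩ := hout
  have hbe := hL.be_pos
  have hnb := sqrt_dotProduct_ne_zero hb
  set N := iterations k δ with hN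
  set L := s.shiftedMap k with hLdef
  -- `v₁` is `v₀` with place `0`, which does not count, set to zero.
  set v₁ : ℕ → ℝ := Function.update v₀ 0 0 with hv₁
  have hv₁' : ∀ j, 1 ≤ j → v₁ j = v₀ j := fun j hj => Function.update_of_ne (by omega) _ _
  have hv₁n : ‖toVec k v₁‖ ^ 2 = ∑ i ∈ Finset.range k, v₀ (i + 1) ^ 2 := by
    rw [norm_toVec_sq]
    exact Finset.sum_congr rfl fun i _ => by rw [hv₁' (i + 1) (by omega)]
  have hv₁L : ‖L (toVec k v₁)‖ ^ 2 = ∑ i ∈ Finset.range k, s.shiftedMul v₀ (i + 1) ^ 2 := by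
    rw [hLdef, s.shiftedMap_toVec (by rw [hv₁, Function.update_self])
      (fun j hj => by rw [hv₁' j (by omega), hv₀z j hj]), norm_toVec_sq]
    refine Finset.sum_congr rfl fun i _ => ?_
    rw [State.shiftedMul, State.shiftedMul, hv₁' (i + 1) (by omega), hv₁' (i + 1 + 1) (by omega),
      hv₁' (i + 1 + 2) (by omega)]
  have hv₁0 : toVec k v₁ ≠ 0 := fun h0 => by
    rw [← hv₁n, h0] at hv₀pos; simp at hv₀pos
  obtain ⟨u, l, hu, hl0, hl, heig⟩ := exists_eigenvector_le L hv₁0 (c := tol ^ 2)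
    (by rw [hv₁L, hv₁n]; exact hv₀)
  -- Solvability by substitution makes `T̃ᵀ T̃` surjective, hence invertible.
  have hsurj : Function.Surjective (L.adjoint ∘ₗ L) := fun y => ⟨toVec k (s.solve k (pad y)), by
    rw [LinearMap.comp_apply, hLdef, State.solve_spec hbe, toVec_pad]⟩
  have hinj : Function.Injective (L.adjoint ∘ₗ L) := LinearMap.injective_iff_surjective.2 hsurj
  set e := LinearEquiv.ofBijective (L.adjoint ∘ₗ L) ⟨hinj, hsurj⟩ with he
  have hS1 : ∀ x, e.symm (L.adjoint (L x)) = x := fun x => e.symm_apply_apply x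
  have hS2 : ∀ x, L.adjoint (L (e.symm x)) = x := fun x => e.apply_symm_apply x
  -- `w` represents the functional `g ↦ α ‖b‖` for the unnormalized iterate that starts at `g`.
  set φ : EuclideanSpace ℝ (Fin k) →ₗ[ℝ] ℝ :=
    { toFun := fun x => s.al 1 * pad x 1 + s.be 2 * pad x 2
      map_add' := fun x y => by simp only [pad_add]; ring
      map_smul' := fun c x => by simp only [pad_smul, smul_eq_mul, RingHom.id_apply]; ring } with hφ
  set ψ : EuclideanSpace ℝ (Fin k) →ₗ[ℝ] ℝ := φ ∘ₗ (e.symm.toLinearMap ^ N) with hψ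
  have hψapp : ∀ x, ψ x = φ (e.symm^[N] x) := fun x => by
    rw [hψ, LinearMap.comp_apply, Module.End.pow_apply]; rfl
  set w := (InnerProductSpace.toDual ℝ (EuclideanSpace ℝ (Fin k))).symm ψ.toContinuousLinearMap
    with hwdef
  have hw : ∀ x, inner ℝ w x = ψ x := fun x => by
    rw [hwdef, InnerProductSpace.toDual_symm_apply]; rfl
  have hw0 : w ≠ 0 := by
    intro h0
    obtain ⟨x, hx⟩ := hL.exists_first_row_ne_zero hA hk
    obtain ⟨y, hy⟩ := (e.symm.surjective.iterate N) x
    have h1 := hw y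
    rw [h0, inner_zero_left, hψapp, hy] at h1
    exact hx h1.symm
  refine ⟨u, w, hu, hw0, fun ω hω => ?_⟩
  obtain ⟨hgood, hα0⟩ := not_or.1 hω
  rw [hw, hψapp] at hα0
  rw [not_lt] at hgood
  have hg0 : gaussVec k ω ≠ 0 := fun h0 => hα0 (by
    rw [← hψapp, h0, map_zero])
  set v := (s.normalizedSolve k)^[N] (gaussArray k ω) with hv
  have hsupp : ∀ j, j = 0 ∨ k < j → v j = 0 :=
    normalizedSolve_iterate_supp s k N _ fun j hj => if_neg (by omega)
  obtain ⟨c, hc, hvc⟩ := State.iterate_normalizedSolve hbe e.symm hS1 (fun c x => e.symm.map_smul c x)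
    N (gaussArray k ω) (by rwa [toVec_gaussArray])
  rw [toVec_gaussArray, ← hv] at hvc
  set W : ℕ → EuclideanSpace ℝ (Fin k) := fun i => e.symm^[i] (gaussVec k ω) with hW
  have hquot := inverseIteration_quotient_le L L.adjoint
    (fun x y => (LinearMap.adjoint_inner_right L x y).symm) W
    (fun i => by
      change L.adjoint (L (e.symm^[i + 1] _)) = _
      rw [Function.iterate_succ_apply', hS2]) hg0 hu hl0 heig
    (iterations_pos hk hδ0 hδ1) hgood
  have hWN : W N ≠ 0 := fun h0 => hα0 (by
    change φ (W N) = 0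
    rw [h0, map_zero])
  have hquot' : ‖L (toVec k v)‖ ^ 2 ≤ 9 / 4 * tol ^ 2 * ‖toVec k v‖ ^ 2 := by
    rw [hvc, map_smul, norm_smul, norm_smul, mul_pow, mul_pow]
    have h1 : ‖L (W N)‖ ^ 2 ≤ 9 / 4 * tol ^ 2 * ‖W N‖ ^ 2 :=
      hquot.trans (mul_le_mul_of_nonneg_right (by linarith) (sq_nonneg _))
    calc ‖c‖ ^ 2 * ‖L (W N)‖ ^ 2 ≤ ‖c‖ ^ 2 * (9 / 4 * tol ^ 2 * ‖W N‖ ^ 2) :=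
          mul_le_mul_of_nonneg_left h1 (sq_nonneg _)
      _ = _ := by ring
  have hvne : toVec k v ≠ 0 := by rw [hvc]; exact smul_ne_zero hc.ne' hWN
  set α := (s.al 1 * v 1 + s.be 2 * v 2) / √(b ⬝ᵥ b) with hα
  have hαne : α ≠ 0 := by
    have h1 : s.al 1 * v 1 + s.be 2 * v 2 = φ (toVec k v) := by
      change _ = s.al 1 * pad (toVec k v) 1 + s.be 2 * pad (toVec k v) 2
      rw [pad_toVec (hsupp 0 (Or.inl rfl)) fun j hj => hsupp j (Or.inr hj)]
    rw [hα, h1, hvc, map_smul]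
    exact div_ne_zero (smul_ne_zero hc.ne' hα0) hnb
  refine Yields.bind_costs (inverseIteration_yields hbe hk hδ0 hg0)
    (b := α⁻¹ • s.comb k v) ?_ ?_
  · refine Costs.mono (C := 4 + (n * (k * 2 + 1) + n * 1)) ?_ (by ring_nf; omega)
    refine (scaling_costs hnb s v).bind ?_
    refine (applyBasis_costs s k v).bind ?_
    exact Costs.divBy _ hαne
  · exact berr_comb_le hA0 hε htol hL (hsupp 0 (Or.inl rfl)) (fun j hj => hsupp j (Or.inr hj))
      hα hαne hvne hquot'

end Output

/-! ### The number of steps -/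

section Total

variable {n : ℕ} {A : Matrix (Fin n) (Fin n) ℝ} {b : Fin n → ℝ}

/-- The state before the first iteration. -/
noncomputable def initState (b : Fin n → ℝ) : State ℝ n :=
  { q := Function.update (fun _ _ => 0) 1 ((√(b ⬝ᵥ b))⁻¹ • b)
    al := fun _ => 0
    be := Function.update (fun _ => 0) 1 1
    rd := fun _ => 1
    ru := fun _ => 0 }

theorem isLanczos_initState (A : Matrix (Fin n) (Fin n) ℝ) (hb : b ≠ 0) :
    IsLanczos A b (initState b) 1 where
  q_zero := by simp [initState]; rfl
  be_one := by simp [initState]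
  q_one := by simp [initState]
  be_pos j h1 h2 := by
    obtain rfl : j = 1 := by omega
    rw [initState]; simp
  orth i j h1 h2 h3 h4 := by
    obtain rfl : i = 1 := by omega
    obtain rfl : j = 1 := by omega
    have hnb := sqrt_dotProduct_ne_zero hb
    have h2 := Real.sq_sqrt (dotProduct_self_nonneg' b)
    simp only [initState, Function.update_self, smul_dotProduct, dotProduct_smul, smul_eq_mul,
      if_true]
    nth_rewrite 3 [← h2]
    field_simp
  recurrence j h1 h2 := by omega

theorem isCholesky_initState (b : Fin n → ℝ) (tol : ℝ) : IsCholesky tol (initState b) 0 where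
  rd_pos _ _ := one_pos
  off_diag j h1 h2 := by omega
  diag j h1 h2 := by omega

/-- The total number of operations. The hypothesis adds up the main loop with `k` iterations, the
initialization, and both kinds of output. The logarithm of `k` in the number of steps of inverse
iteration is absorbed by `n`, since `k ≤ n`. -/
theorem cost_le {n k T : ℕ} (hk : 1 ≤ k) (hkn : k ≤ n) {ε δ : ℝ} (hε0 : 0 < ε) (hε1 : ε < 1)
    (hδ0 : 0 < δ) (hδ1 : δ < 1) (hkε : (k : ℝ) < 3 / √ε + 1) {c : ℕ}
    (hc : c ≤ k * (T + 9 * n + 25) + (3 * n + 4) +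
      ((k + (7 + 2 * iterations k δ + iterations k δ * (13 * k + 2)) + (4 + n * (2 * k + 2))) +
        (5 * k + n * (2 * k + 2) + 8))) :
    (c : ℝ) ≤ 600 * (1 / √ε) * (T + n + Real.log (1 / δ)) := by
  have hk1 : (1 : ℝ) ≤ k := by exact_mod_cast hk
  have hkn' : (k : ℝ) ≤ n := by exact_mod_cast hkn
  have hsε : 0 < √ε := Real.sqrt_pos.2 hε0
  have hsε1 : √ε < 1 := by rw [Real.sqrt_lt' one_pos]; simpa using hε1
  have hk4 : (k : ℝ) ≤ 4 * (1 / √ε) := by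
    have : 1 ≤ 1 / √ε := by rw [le_div_iff₀ hsε]; linarith
    have h3 : 3 / √ε = 3 * (1 / √ε) := by ring
    linarith
  set ℓ := Real.log (1 / δ) with hℓ
  have hℓ0 : 0 ≤ ℓ := Real.log_nonneg (by rw [le_div_iff₀ hδ0]; linarith)
  have hlog : Real.log (k / δ ^ 2) = Real.log k + 2 * ℓ := by
    rw [hℓ, Real.log_div (by positivity) (by positivity), Real.log_pow, Real.log_div one_ne_zero
      hδ0.ne', Real.log_one]
    push_cast; ring
  have hlogk : Real.log k ≤ n := (Real.log_le_sub_one_of_pos (by linarith)).trans (by linarith)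
  have hlogk0 : 0 ≤ Real.log k := Real.log_nonneg hk1
  have hN : (iterations k δ : ℝ) ≤ 4 * n + 5 * ℓ := by
    have h1 : 0 ≤ 223 / 100 * Real.log (k / δ ^ 2) := by rw [hlog]; positivity
    have h2 := (Nat.ceil_lt_add_one h1).le
    rw [hlog] at h2
    unfold iterations
    rw [hlog]
    linarith
  have hc' : (c : ℝ) ≤ k * (T + 9 * n + 25) + (3 * n + 4) +
      ((k + (7 + 2 * (iterations k δ : ℝ) + iterations k δ * (13 * k + 2)) + (4 + n * (2 * k + 2))) +
        (5 * k + n * (2 * k + 2) + 8)) := by exact_mod_cast hc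
  have hN0 : (0 : ℝ) ≤ iterations k δ := Nat.cast_nonneg _
  set N : ℝ := (iterations k δ : ℝ)
  have hT0 : (0 : ℝ) ≤ T := Nat.cast_nonneg _
  have hn1 : (1 : ℝ) ≤ n := hk1.trans hkn'
  have hkn1 : (1 : ℝ) ≤ k * n := by nlinarith
  have hn_le : (n : ℝ) ≤ k * n := by nlinarith
  have hk_le : (k : ℝ) ≤ k * n := by nlinarith
  have hkN : N ≤ k * N := by nlinarith
  have hkN' : k * N ≤ k * (4 * n + 5 * ℓ) := mul_le_mul_of_nonneg_left hN (by linarith)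
  have hkT : (0 : ℝ) ≤ k * T := by positivity
  have hkℓ : 0 ≤ k * ℓ := by positivity
  have hfin : (c : ℝ) ≤ 150 * (k * (T + n + ℓ)) := by linarith
  calc (c : ℝ) ≤ 150 * (k * (T + n + ℓ)) := hfin
    _ ≤ 150 * (4 * (1 / √ε) * (T + n + ℓ)) := by gcongr
    _ = _ := by ring

theorem measure_not_solvesWithin_le (hA : A.PosSemidef) (hA0 : A ≠ 0) (hb : b ≠ 0)
    {mv : (Fin n → ℝ) → Prog ℝ (Fin n → ℝ)} {T : ℕ} (hmv : MultipliesBy mv A T) {ε δ : ℝ}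
    (hε0 : 0 < ε) (hε1 : ε < 1) (hδ0 : 0 < δ) (hδ1 : δ < 1) {kmax : ℕ}
    (hkmax : n ≤ kmax ∨ 3 / √ε ≤ kmax) :
    gaussianStream {ω | ¬ SolvesWithin (minberr mv b kmax (2 / 3 * ε * specNorm A) δ) A b ε
      (600 * (1 / √ε) * (T + n + Real.log (1 / δ))) ω} ≤ ENNReal.ofReal δ := by
  set tol := 2 / 3 * ε * specNorm A with htol
  have hsε : 0 < √ε := Real.sqrt_pos.2 hε0
  have hnb := sqrt_dotProduct_ne_zero hb
  have hL0 := isLanczos_initState A hb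
  have hn : 1 ≤ n := hL0.le_dim
  have hkmax1 : 1 ≤ kmax := by
    rcases hkmax with h | h
    · omega
    · have : (0 : ℝ) < kmax := lt_of_lt_of_le (by positivity) h
      exact_mod_cast this
  obtain ⟨s, st, k, hloop, -, hunf, hout, s', hL', hC'⟩ := krylovLoop_outcome (tol := tol)
    hA.isHermitian hmv (kmax - 1) 0 (initState b) hL0 (isCholesky_initState b tol)
  have hkn : k + 1 ≤ n := hL'.le_dim
  have hkε : ((k + 1 : ℕ) : ℝ) < 3 / √ε + 1 := by
    have := hC'.lt_of_tol hA hA0 hb hL' hε0 htol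
    push_cast; linarith
  have hrun : ∀ {ω : ℕ → ℝ} {D : ℕ},
      (st = .exhausted → Yields (exhaustedOutput 0 tol √(b ⬝ᵥ b) s (k + 1)) ω
        (fun x => berr A b x ≤ ENNReal.ofReal ε) D) →
      (st ≠ .exhausted → Yields (regularOutput 0 δ √(b ⬝ᵥ b) s (k + 1)) ω
        (fun x => berr A b x ≤ ENNReal.ofReal ε) D) →
      Yields (minberr mv b kmax tol δ) ω (fun x => berr A b x ≤ ENNReal.ofReal ε)
        ((k + 1) * (T + 9 * n + 25) + (3 * n + 4) + D) := by
    intro ω D hex hreg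
    refine Yields.mono (C := 1 + (1 + ((n * 2 + 2) + (n * 1 +
      ((k + 1 - 0) * (T + 9 * n + 25) + D))))) ?_ (by rw [Nat.sub_zero]; omega)
    refine Yields.costs_bind (Costs.const 0) ?_
    refine Yields.costs_bind (Costs.const 1) ?_
    refine Yields.costs_bind (Costs.norm b) ?_
    refine Yields.costs_bind (Costs.divBy b hnb) ?_
    rw [Rat.cast_zero, Rat.cast_one]
    refine Yields.costs_bind hloop ?_
    cases st with
    | exhausted => exact hex rfl
    | converged => exact hreg (by simp)
    | unfinished => exact hreg (by simp)
  have hsolves : ∀ {ω : ℕ → ℝ} {C : ℕ}, Yields (minberr mv b kmax tol δ) ω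
      (fun x => berr A b x ≤ ENNReal.ofReal ε) C →
      C ≤ (k + 1) * (T + 9 * n + 25) + (3 * n + 4) + ((k + 1 + (7 + 2 * iterations (k + 1) δ +
        iterations (k + 1) δ * (13 * (k + 1) + 2)) + (4 + n * (2 * (k + 1) + 2))) +
        (5 * (k + 1) + n * (2 * (k + 1) + 2) + 8)) →
      SolvesWithin (minberr mv b kmax tol δ) A b ε
        (600 * (1 / √ε) * (T + n + Real.log (1 / δ))) ω := by
    intro ω C h hC
    obtain ⟨x, c, d, hc, hr, hx⟩ := h 0
    refine ⟨x, _, hr, hx, ?_⟩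
    simp only [zero_add]
    exact cost_le (k := k + 1) (by omega) hkn hε0 hε1 hδ0 hδ1 hkε (hc.trans hC)
  cases st with
  | unfinished =>
    exfalso
    have hk := hunf rfl
    have h1 : k + 1 = kmax := by omega
    rcases hkmax with h | h
    · have := hout.1.le_dim
      omega
    · have := hout.2.lt_of_tol hA hA0 hb hout.1 hε0 htol
      rw [h1] at this
      linarith
  | exhausted =>
    obtain ⟨x, hx, hberr⟩ := exhaustedOutput_costs hA0 hb hε0 htol hout
    have : {ω | ¬ SolvesWithin (minberr mv b kmax tol δ) A b ε
        (600 * (1 / √ε) * (T + n + Real.log (1 / δ))) ω} = ∅ := by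
      refine Set.eq_empty_of_forall_notMem fun ω hω => hω ?_
      refine hsolves (hrun (fun _ => Yields.of_costs hx hberr) fun h => absurd rfl h) ?_
      have e : n * (2 * (k + 1) + 2) = n * (2 * k + 4) := by ring
      rw [e]; omega
    rw [this]; simp
  | converged =>
    obtain ⟨u, w, hu, hw, hgood⟩ :=
      regularOutput_yields hA hA0 hb hε0 htol hδ0 hδ1 (show 1 ≤ k + 1 by omega) hout
    refine le_trans (measure_mono fun ω hω => ?_)
      (gaussianStream_bad_le (show 1 ≤ k + 1 by omega) hδ0 hδ1 (Nat.le_ceil _) hu hw)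
    by_contra hcon
    exact hω (hsolves (hrun (fun h => (by simp at h)) fun _ => hgood ω hcon) (by omega))

end Total

end Minberr

theorem corollary4p6 :
    (∃ C : ℝ, 0 < C ∧
      ∀ (n : ℕ) (A : Matrix (Fin n) (Fin n) ℝ) (b : Fin n → ℝ)
        (mv : (Fin n → ℝ) → Minberr.Prog ℝ (Fin n → ℝ)) (T : ℕ) (ε δ : ℝ) (kmax : ℕ),
        A.PosSemidef → A ≠ 0 → b ≠ 0 → Minberr.MultipliesBy mv A T →
        0 < ε → ε < 1 → 0 < δ → δ < 1 → (n ≤ kmax ∨ 3 / Real.sqrt ε ≤ kmax) →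
        Minberr.gaussianStream
          {ω | ¬ Minberr.SolvesWithin
            (Minberr.minberr mv b kmax (2 / 3 * ε * Minberr.specNorm A) δ) A b ε
            (C * (1 / Real.sqrt ε) * (T + n + Real.log (1 / δ))) ω} ≤ ENNReal.ofReal δ) ∧
    (∀ c : ℝ, 0 < c → ∃ C : ℝ, 0 < C ∧
      ∀ (n : ℕ) (A : Matrix (Fin n) (Fin n) ℝ) (b : Fin n → ℝ) (ε δ : ℝ) (kmax : ℕ),
        A.PosSemidef → A ≠ 0 → b ≠ 0 →
        0 < ε → ε < 1 → 0 < δ → δ < 1 → (n ≤ kmax ∨ 3 / Real.sqrt ε ≤ kmax) →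
        Real.log (1 / δ) ≤ c * (n : ℝ) ^ 2 →
        Minberr.gaussianStream
          {ω | ¬ Minberr.SolvesWithin
            (Minberr.minberr (Minberr.denseMulVec A) b kmax (2 / 3 * ε * Minberr.specNorm A) δ) A b ε
            (C * (n : ℝ) ^ 2 / Real.sqrt ε) ω} ≤ ENNReal.ofReal δ) := by
  refine ⟨⟨600, by norm_num, fun n A b mv T ε δ kmax hA hA0 hb hmv hε0 hε1 hδ0 hδ1 hk =>
    Minberr.measure_not_solvesWithin_le hA hA0 hb hmv hε0 hε1 hδ0 hδ1 hk⟩, fun c hc =>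
    ⟨600 * (4 + c), by positivity, fun n A b ε δ kmax hA hA0 hb hε0 hε1 hδ0 hδ1 hk hlog => ?_⟩⟩
  have hmv : Minberr.MultipliesBy (Minberr.denseMulVec A) A (n * (n * 2 + 1)) := fun v =>
    Minberr.Costs.denseMulVec A v
  refine (measure_mono ?_).trans
    (Minberr.measure_not_solvesWithin_le hA hA0 hb hmv hε0 hε1 hδ0 hδ1 hk)
  refine Set.ofPred_subset_ofPred.2 fun ω hω hs => hω ?_
  obtain ⟨x, s, hrun, hberr, hsteps⟩ := hs
  refine ⟨x, s, hrun, hberr, hsteps.trans ?_⟩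
  have hsε : 0 < √ε := Real.sqrt_pos.2 hε0
  have hn : (n : ℝ) ≤ (n : ℝ) ^ 2 := by exact_mod_cast Nat.le_self_pow two_ne_zero n
  rw [show 600 * (4 + c) * (n : ℝ) ^ 2 / √ε = 600 * (1 / √ε) * ((4 + c) * (n : ℝ) ^ 2) by ring]
  refine mul_le_mul_of_nonneg_left ?_ (by positivity)
  push_cast
  nlinarith
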